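/- **Setting.** Consider a sequence (indexed by $n$) of linear regression problems $Y = X\theta + Z$, with $Y\in\mathbb R^{N}$, $X\in\mathbb R^{N\times p}$ deterministic, $Z\sim N(0,I_N)$ and $p\to\infty$; $X$, $N$, $p$ and all quantities below depend on $n$ unless stated otherwise. $P_\theta$, $E_\theta$ are the law of $Y$ and its expectation. Put $S_\theta=\{i:\theta_i\neq0\}$, $\|X\|=\max_i\|X_{\cdot i}\|_2$, $\bar\lambda = 2\|X\|\sqrt{\log p}$. *Prior.* $\Pi$ draws a dimension $s\in\{0,\dots,p\}$ from a distribution $\pi_p$, then $S\subseteq\{1,\dots,p\}$ uniformly among the sets of size $s$, then independently $\theta_i\sim\mathrm{Lap}(\lambda)$ (density $\tfrac\lambda2e^{-\lambda|x|}$) for $i\in S$ and $\theta_i=0$ for $i\notin S$. Assume that for fixed constants $A_1,A_2,A_3,A_4>0$, $$A_1p^{-A_3}\pi_p(s-1)\le\pi_p(s)\le A_2p^{-A_4}\pi_p(s-1)\quad(s=1,\dots,p),\qquad \lambda>0,\quad \frac{\|X\|}{p}\le\lambda\le2\bar\lambda .$$ $\Pi(\cdot|Y)$ is the posterior. *Variational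 posteriors.* $\widetilde\Pi$, $\hat Q$, $\widetilde Q$ are minimizers of $\mathrm{KL}(\,\cdot\,\|\Pi(\cdot|Y))$ over, respectively, the family of all $\bigotimes_{i=1}^p[\gamma_iN(\mu_i,\sigma_i^2)+(1-\gamma_i)\delta_0]$ ($\mu_i\in\mathbb R$, $\sigma_i>0$, $\gamma_i\in[0,1]$), the family of all $N_S(\mu_S,\Sigma_S)\otimes\delta_{S^c}$ ($S\subseteq\{1,\dots,p\}$, $\mu_S\in\mathbb R^{|S|}$, $\Sigma_S$ positive definite; $\delta_{S^c}$ the point mass at $0$ on the coordinates outside $S$), and its subfamily with $\Sigma_S$ diagonal. *Compatibility.* $$\phi(S)=\inf\Big\{\tfrac{\|X\theta\|_2|S|^{1/2}}{\|X\|\|\theta_S\|_1}:\|\theta_{S^c}\|_1\le7\|\theta_S\|_1,\ \theta_S\ne0\Big\},$$ $$\overline\phi(r)=\inf\Big\{\tfrac{\|X\theta\|_2|S_\theta|^{1/2}}{\|X\|\|\theta\|_1}:0\neq|S_\theta|\le r\Big\},\qquad \widetilde\phi(r)=\inf\Big\{\tfrac{\|X\theta\|_2}{\|X\|\|\theta\|_2}:0\ne|S_\theta|\le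 r\Big\},$$ and, with $r_L(S)=\big(2+\tfrac{4L}{A_4}(1+\tfrac{16}{\phi(S)^2}\tfrac{\lambda}{\bar\lambda})\big)|S|$, $\overline\psi_L(S)=\overline\phi(r_L(S))$, $\widetilde\psi_L(S)=\widetilde\phi(r_L(S))$. For a fixed $c_0>0$, $s_n\ge1$ and $\rho_n>0$ let $$\Theta_{\rho_n,s_n}=\{\theta\in\mathbb R^p:\phi(S_\theta)\ge c_0,\ |S_\theta|\le s_n,\ \widetilde\psi_{\rho_n}(S_\theta)\ge c_0\}.$$ **Theorem 3 (Oracle recovery).** There is a constant $M>0$ depending only on $A_1,\dots,A_4$ such that the following holds in every such setting with $\lambda=O(\|X\|\sqrt{\log p}/s_n)$, for every $\rho_n\to\infty$ and every $c_0>0$. For $\theta_0\in\mathbb R^p\setminus\{0\}$ with $S_0=S_{\theta_0}$, $s_0=|S_0|$, let $\mathcal O(\theta_0)$ be the set of all $\theta_*\in\mathbb R^p$ such that, with $S_*=S_{\theta_*}$ and $s_*=|S_*|$, $1\le s_*\le s_0$ and $\|X(\theta_0-\theta_*)\|_2^2\le(s_0-s_*)\log p$. Then, with suprema over all $\theta_0\in\Theta_{\rho_n,s_n}\setminus\{0\}$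 and $\theta_*\in\mathcal O(\theta_0)$, as $n\to\infty$, $$\sup_{\theta_0,\theta_*}E_{\theta_0}\widetilde\Pi\Big(\theta:\|X(\theta-\theta_0)\|_2\ge\frac{M\rho_n^{1/2}}{\overline\psi_{\rho_n}(S_0)}\Big[\frac{\sqrt{s_*\log p}}{\phi(S_*)}+\|X(\theta_0-\theta_*)\|_2\Big]\Big)\to0,$$ $$\sup_{\theta_0,\theta_*}E_{\theta_0}\widetilde\Pi\Big(\theta:\|\theta-\theta_0\|_1>\|\theta_0-\theta_*\|_1+\frac{M\rho_n}{\overline\psi_{\rho_n}(S_0)^2}\Big[\frac{s_*\sqrt{\log p}}{\|X\|\phi(S_*)^2}+\frac{\|X(\theta_0-\theta_*)\|_2^2}{\|X\|\sqrt{\log p}}\Big]\Big)\to0,$$ $$\sup_{\theta_0,\theta_*}E_{\theta_0}\widetilde\Pi\Big(\theta:\|\theta-\theta_0\|_2>\frac{M\rho_n^{1/2}}{\|X\|\widetilde\psi_{\rho_n}(S_0)^2}\Big[\frac{\sqrt{s_*\log p}}{\phi(S_*)}+\|X(\theta_0-\theta_*)\|_2\Big]\Big)\to0$$ (a bound with $\phi(S_*)=0$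 is read as $+\infty$). The same three limits hold, with the same $M$, for $\hat Q$ and $\widetilde Q$ in place of $\widetilde\Pi$. -/

import Mathlib

open MeasureTheory ProbabilityTheory Filter Topology Asymptotics
open scoped ENNReal NNReal

namespace SparseVB

noncomputable section

/-- The Euclidean norm of a plain vector. -/
def l2 {d : ℕ} (x : Fin d → ℝ) : ℝ := ‖(WithLp.toLp 2 x : EuclideanSpace ℝ (Fin d))‖

/-- The `ℓ₁` norm of a plain vector. -/
def l1 {d : ℕ} (x : Fin d → ℝ) : ℝ := ∑ i, |x i|

/-- The set `S_θ` of non-zero coordinates of `θ`. -/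
def supp {p : ℕ} (θ : Fin p → ℝ) : Finset (Fin p) := Finset.univ.filter fun i => θ i ≠ 0

/-- `‖X‖`, the largest Euclidean norm of a column of `X`. -/
def colNorm {n p : ℕ} (X : Matrix (Fin n) (Fin p) ℝ) : ℝ := ⨆ i : Fin p, l2 fun j => X j i

/-- `2 ‖X‖ √(log p)`. -/
def lamBar {n p : ℕ} (X : Matrix (Fin n) (Fin p) ℝ) : ℝ := 2 * colNorm X * √(Real.log p)

/-! ### The model, the prior and the posterior -/

/-- `P_θ`: the law of `Y = X θ + Z` with `Z` standard Gaussian, that is, of independent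
`Y_j ∼ N((X θ)_j, 1)`. -/
def dataLaw {n p : ℕ} (X : Matrix (Fin n) (Fin p) ℝ) (θ : Fin p → ℝ) : Measure (Fin n → ℝ) :=
  Measure.pi fun j => gaussianReal (X.mulVec θ j) 1

/-- The centred Laplace distribution, with density `(lam / 2) exp (- lam |x|)`. -/
def laplace (lam : ℝ) : Measure ℝ :=
  volume.withDensity fun x => ENNReal.ofReal (lam / 2 * Real.exp (-lam * |x|))

/-- `w` is a probability distribution on `{0, …, p}` with
`A₁ p^{-A₃} w (s-1) ≤ w s ≤ A₂ p^{-A₄} w (s-1)` for `s = 1, …, p`. -/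
structure IsDimensionPrior (A₁ A₂ A₃ A₄ : ℝ) (p : ℕ) (w : ℕ → ℝ) : Prop where
  nonneg : ∀ s ≤ p, 0 ≤ w s
  sum_eq_one : ∑ s ∈ Finset.range (p + 1), w s = 1
  lower : ∀ s, 1 ≤ s → s ≤ p → A₁ * (p : ℝ) ^ (-A₃) * w (s - 1) ≤ w s
  upper : ∀ s, 1 ≤ s → s ≤ p → w s ≤ A₂ * (p : ℝ) ^ (-A₄) * w (s - 1)

/-- The model selection prior: a dimension `s` with probability `w s`, then a uniformly chosen set
`S` of that size, then independent Laplace coordinates on `S` and zeros off `S`. -/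
def modelPrior (p : ℕ) (w : ℕ → ℝ) (lam : ℝ) : Measure (Fin p → ℝ) :=
  ∑ S : Finset (Fin p), ENNReal.ofReal (w S.card / (p.choose S.card : ℝ)) •
    Measure.pi fun i => if i ∈ S then laplace lam else Measure.dirac 0

/-- The Gaussian likelihood `exp (- ‖y - X θ‖₂² / 2)`, without the constant that cancels in Bayes'
formula. -/
def likelihood {n p : ℕ} (X : Matrix (Fin n) (Fin p) ℝ) (y : Fin n → ℝ) (θ : Fin p → ℝ) : ℝ≥0∞ :=
  ENNReal.ofReal (Real.exp (-(l2 (y - X.mulVec θ)) ^ 2 / 2))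

/-- The posterior distribution `Π(· | Y = y)` by Bayes' formula. -/
def modelPosterior {n p : ℕ} (X : Matrix (Fin n) (Fin p) ℝ) (w : ℕ → ℝ) (lam : ℝ) (y : Fin n → ℝ) :
    Measure (Fin p → ℝ) :=
  (∫⁻ θ, likelihood X y θ ∂(modelPrior p w lam))⁻¹ • (modelPrior p w lam).withDensity (likelihood X y)

/-! ### Variational families and variational posteriors -/

/-- The mean-field spike and slab family: all `⨂ᵢ [γᵢ N(μᵢ, σᵢ²) + (1 - γᵢ) δ₀]`. -/
def familyPMF (p : ℕ) : Set (Measure (Fin p → ℝ)) :=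
  {Q | ∃ (μ : Fin p → ℝ) (σ : Fin p → ℝ≥0) (γ : Fin p → ℝ),
    (∀ i, 0 < σ i) ∧ (∀ i, γ i ∈ Set.Icc (0 : ℝ) 1) ∧
    Q = Measure.pi fun i => ENNReal.ofReal (γ i) • gaussianReal (μ i) (σ i ^ 2) +
      ENNReal.ofReal (1 - γ i) • Measure.dirac 0}

/-- The distribution `N_S(μ, V) ⊗ δ_{Sᶜ}`: Gaussian on the coordinates in `S`, zero elsewhere. -/
def gaussDirac {p : ℕ} (S : Finset (Fin p)) (μ : EuclideanSpace ℝ {i // i ∈ S})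
    (V : Matrix {i // i ∈ S} {i // i ∈ S} ℝ) : Measure (Fin p → ℝ) :=
  (multivariateGaussian μ V).map fun v i => if h : i ∈ S then v ⟨i, h⟩ else 0

/-- All `N_S(μ, V) ⊗ δ_{Sᶜ}` with `V` positive definite. -/
def familyQ (p : ℕ) : Set (Measure (Fin p → ℝ)) :=
  {Q | ∃ (S : Finset (Fin p)) (μ : EuclideanSpace ℝ {i // i ∈ S})
    (V : Matrix {i // i ∈ S} {i // i ∈ S} ℝ), V.PosDef ∧ Q = gaussDirac S μ V}

/-- All `N_S(μ, D) ⊗ δ_{Sᶜ}` with `D` positive definite and diagonal. -/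
def familyQMF (p : ℕ) : Set (Measure (Fin p → ℝ)) :=
  {Q | ∃ (S : Finset (Fin p)) (μ : EuclideanSpace ℝ {i // i ∈ S})
    (D : Matrix {i // i ∈ S} {i // i ∈ S} ℝ), D.PosDef ∧ D.IsDiag ∧ Q = gaussDirac S μ D}

/-- `Q` minimizes the Kullback-Leibler divergence to `P` over the family `F`. -/
def IsVBPosterior {α : Type*} [MeasurableSpace α] (F : Set (Measure α)) (P Q : Measure α) : Prop :=
  Q ∈ F ∧ ∀ Q' ∈ F, InformationTheory.klDiv Q P ≤ InformationTheory.klDiv Q' P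

/-! ### Compatibility numbers

They are infima in `[0, ∞]`, so that an infimum over no vector is `∞`. -/

/-- The compatibility number `φ(S)`. -/
def compat {n p : ℕ} (X : Matrix (Fin n) (Fin p) ℝ) (S : Finset (Fin p)) : ℝ≥0∞ :=
  ⨅ (θ : Fin p → ℝ)
    (_ : (∃ i ∈ S, θ i ≠ 0) ∧ ∑ i ∈ Sᶜ, |θ i| ≤ 7 * ∑ i ∈ S, |θ i|),
    ENNReal.ofReal (l2 (X.mulVec θ) * √(S.card : ℝ) / (colNorm X * ∑ i ∈ S, |θ i|))

/-- The uniform compatibility number of dimension `r`. -/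
def unifCompat {n p : ℕ} (X : Matrix (Fin n) (Fin p) ℝ) (r : ℝ≥0∞) : ℝ≥0∞ :=
  ⨅ (θ : Fin p → ℝ) (_ : (supp θ).card ≠ 0 ∧ ((supp θ).card : ℝ≥0∞) ≤ r),
    ENNReal.ofReal (l2 (X.mulVec θ) * √((supp θ).card : ℝ) / (colNorm X * l1 θ))

/-- The smallest scaled sparse singular value of dimension `r`. -/
def sparseSing {n p : ℕ} (X : Matrix (Fin n) (Fin p) ℝ) (r : ℝ≥0∞) : ℝ≥0∞ :=
  ⨅ (θ : Fin p → ℝ) (_ : (supp θ).card ≠ 0 ∧ ((supp θ).card : ℝ≥0∞) ≤ r),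
    ENNReal.ofReal (l2 (X.mulVec θ) / (colNorm X * l2 θ))

/-- `(2 + (4 M / A₄) (1 + (16 / φ(S)²) (lam / lamBar))) |S|`. -/
def psiDim {n p : ℕ} (X : Matrix (Fin n) (Fin p) ℝ) (A₄ lam M : ℝ) (S : Finset (Fin p)) : ℝ≥0∞ :=
  (2 + ENNReal.ofReal (4 * M / A₄) *
    (1 + 16 / compat X S ^ 2 * ENNReal.ofReal (lam / lamBar X))) * (S.card : ℝ≥0∞)

/-- `ψ̄_M(S)`. -/
def psiBar {n p : ℕ} (X : Matrix (Fin n) (Fin p) ℝ) (A₄ lam M : ℝ) (S : Finset (Fin p)) : ℝ≥0∞ :=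
  unifCompat X (psiDim X A₄ lam M S)

/-- `ψ̃_M(S)`. -/
def psiTilde {n p : ℕ} (X : Matrix (Fin n) (Fin p) ℝ) (A₄ lam M : ℝ) (S : Finset (Fin p)) :
    ℝ≥0∞ :=
  sparseSing X (psiDim X A₄ lam M S)

/-- The parameter set `Θ_{ρ,s}` with compatibility bound `c₀`. -/
def paramSet {n p : ℕ} (X : Matrix (Fin n) (Fin p) ℝ) (A₄ lam c₀ ρ s : ℝ) : Set (Fin p → ℝ) :=
  {θ | ENNReal.ofReal c₀ ≤ compat X (supp θ) ∧ ((supp θ).card : ℝ) ≤ s ∧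
    ENNReal.ofReal c₀ ≤ psiTilde X A₄ lam ρ (supp θ)}

/-- The vectors `θs` with `1 ≤ s_* ≤ s₀` and `‖X (θ₀ - θs)‖₂² ≤ (s₀ - s_*) log p`. -/
def oracleSet {n p : ℕ} (X : Matrix (Fin n) (Fin p) ℝ) (θ₀ : Fin p → ℝ) : Set (Fin p → ℝ) :=
  {θs | 1 ≤ (supp θs).card ∧ (supp θs).card ≤ (supp θ₀).card ∧
    l2 (X.mulVec (θ₀ - θs)) ^ 2 ≤ (((supp θ₀).card : ℝ) - ((supp θs).card : ℝ)) * Real.log p}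

/-! ### Oracle rates

They take values in `[0, ∞]`: where `φ(S_*) = 0`, the rate is infinite. -/

/-- `√(s_* log p) / φ(S_*) + ‖X (θ₀ - θs)‖₂`. -/
def oracleTerm {n p : ℕ} (X : Matrix (Fin n) (Fin p) ℝ) (θ₀ θs : Fin p → ℝ) : ℝ≥0∞ :=
  ENNReal.ofReal √((supp θs).card * Real.log p) / compat X (supp θs) +
    ENNReal.ofReal (l2 (X.mulVec (θ₀ - θs)))

/-- `(M ρ^{1/2} / ψ̄_ρ(S₀)) [√(s_* log p) / φ(S_*) + ‖X (θ₀ - θs)‖₂]`. -/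
def ratePred {n p : ℕ} (X : Matrix (Fin n) (Fin p) ℝ) (A₄ lam M ρ : ℝ) (θ₀ θs : Fin p → ℝ) :
    ℝ≥0∞ :=
  ENNReal.ofReal (M * √ρ) / psiBar X A₄ lam ρ (supp θ₀) * oracleTerm X θ₀ θs

/-- `‖θ₀ - θs‖₁ + (M ρ / ψ̄_ρ(S₀)²)
[s_* √(log p) / (‖X‖ φ(S_*)²) + ‖X (θ₀ - θs)‖₂² / (‖X‖ √(log p))]`. -/
def rateL1 {n p : ℕ} (X : Matrix (Fin n) (Fin p) ℝ) (A₄ lam M ρ : ℝ) (θ₀ θs : Fin p → ℝ) :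
    ℝ≥0∞ :=
  ENNReal.ofReal (l1 (θ₀ - θs)) +
    ENNReal.ofReal (M * ρ) / psiBar X A₄ lam ρ (supp θ₀) ^ 2 *
      (ENNReal.ofReal ((supp θs).card * √(Real.log p) / colNorm X) / compat X (supp θs) ^ 2 +
        ENNReal.ofReal (l2 (X.mulVec (θ₀ - θs)) ^ 2 / (colNorm X * √(Real.log p))))

/-- `(M ρ^{1/2} / (‖X‖ ψ̃_ρ(S₀)²)) [√(s_* log p) / φ(S_*) + ‖X (θ₀ - θs)‖₂]`. -/
def rateL2 {n p : ℕ} (X : Matrix (Fin n) (Fin p) ℝ) (A₄ lam M ρ : ℝ) (θ₀ θs : Fin p → ℝ) :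
    ℝ≥0∞ :=
  ENNReal.ofReal (M * √ρ / colNorm X) / psiTilde X A₄ lam ρ (supp θ₀) ^ 2 * oracleTerm X θ₀ θs

/-! ### Expectations of possibly non-measurable functions -/

/-- Outer expectation: the infimum of the expectations of measurable majorants. No measurability of
the choice of a minimizer as a function of the data is then needed. -/
def outerExp {α : Type*} [MeasurableSpace α] (P : Measure α) (f : α → ℝ≥0∞) : ℝ≥0∞ :=
  ⨅ (g : α → ℝ≥0∞) (_ : Measurable g) (_ : f ≤ g), ∫⁻ y, g y ∂P

/-- For measurable functions, the outer expectation is the expectation. -/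
theorem outerExp_eq_lintegral {α : Type*} [MeasurableSpace α] (P : Measure α) {f : α → ℝ≥0∞}
    (hf : Measurable f) : outerExp P f = ∫⁻ y, f y ∂P := by
  apply le_antisymm
  · exact iInf_le_of_le f (iInf_le_of_le hf (iInf_le_of_le le_rfl le_rfl))
  · exact le_iInf fun g => le_iInf fun _ => le_iInf fun hfg => lintegral_mono hfg

/-- The supremum, over `θ₀` in `Θ_{ρ,s}` and over the oracle vectors `θs` for `θ₀`, of the expected
mass `E_{θ₀} Q (B θ₀ θs)` that the data-dependent distribution `Q` gives to the set `B θ₀ θs`. -/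
def worstMass {n p : ℕ} (X : Matrix (Fin n) (Fin p) ℝ) (A₄ lam c₀ ρ s : ℝ)
    (Q : (Fin n → ℝ) → Measure (Fin p → ℝ))
    (B : (Fin p → ℝ) → (Fin p → ℝ) → Set (Fin p → ℝ)) : ℝ≥0∞ :=
  ⨆ θ₀ ∈ paramSet X A₄ lam c₀ ρ s, ⨆ θs ∈ oracleSet X θ₀,
    outerExp (dataLaw X θ₀) fun y => Q y (B θ₀ θs)

end

end SparseVB

open SparseVB

/-!
The proof compares the variational posterior `Q` with one explicit Gaussian and transfers
exponentially small posterior probabilities to `Q`.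

**Transfer.** The Donsker-Varadhan inequality gives, for every set `B` and `δ ≥ 0`,
`δ * Q B ≤ KL(Q ‖ Π(· | y)) + exp δ * Π(B | y)` (`ofReal_mul_measure_le_klDiv_add`). Hence `Q B` is
small as soon as `KL(Q ‖ Π(· | y))` is at most a multiple of some `E` while `Π(B | y)` is at most
`exp (-c ρ E)` with `ρ → ∞`. For an oracle `θs` the right scale is
`E = s_* log p / φ(S_*)² + ‖X (θ₀ - θs)‖₂²` (`oracleScale`).

**Divergence.** The Gaussian on the support of `θs`, centred at `θs` with independent coordinates of
standard deviation `1 / ‖X‖`, lies in all three variational families, so its divergence dominates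
that of every minimizer. Its cost relative to the prior consists of the model weight and the entropy
(both of order `s_* log p`), the residual sum of squares at `θs`, the term `lam * ‖θs‖₁` and the
logarithm of the evidence (`exp_neg_cost_le_evidence_and_klDiv_le`). The evidence is the dangerous
term: it has to be bounded from above, which is done through its expectation.

**Likelihood ratios.** On the event that `Xᵀ Z` is bounded coordinatewise by `λ̄`, a fraction
`λ / (2 λ̄)` of the linear term in the likelihood ratio of `θ` to `θ₀` is at most
`(λ / 2) ‖θ - θs‖₁`; the rest has an explicit Gaussian expectation, which leaves a negative multiple
of `‖X (θ - θs)‖₂²` (`setLIntegral_likRatio_le`). The compatibility number of `S_*` turns this,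
together with the prior density `exp (-λ ‖θ‖₁)`, into a bound by `exp (C E - λ ‖θs‖₁)` times the
integrable function `exp (-(λ / 4) ‖θ - θs‖₁)` (`l1_exponent_le`). The term `λ ‖θs‖₁` cancels against
the cost of the candidate. Integrating over the prior bounds the evidence, and likewise the posterior
mass of large dimensions (`LargeSetting.lintegral_likRatio_le`, `LargeSetting.outerExp_le`).

**Bad sets.** Three sets of parameters have small variational mass: those with a dimension above a
multiple of `ρ s₀` or of `ρ E / log p`, by the decay of the prior on dimensions (for the first,
`θ₀` itself serves as the oracle), and those with a dimension below these thresholds and a prediction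
error above a multiple of `√(ρ E) / ψ̄`, for which the quadratic term of the likelihood ratio wins
(`badSet`, `LargeSetting.outerExp_badSet_le`). Off their union, the difference `θ - θ₀` has at most
`r_ρ(S₀)` non-zero coordinates and the three error bounds hold deterministically by the definitions of the
uniform compatibility number and of the smallest sparse singular value.

All bounds are non-asymptotic: the mass of the bad set is at most `18 / p + C / ρ`, uniformly in the
parameter and in the oracle.
-/

namespace SparseVB

open InformationTheory

/-! ### Two inequalities for the Kullback-Leibler divergence -/

/-- If `P` dominates `e^{-f} Q`, then the log-density of `Q` with respect to `P` is at most `f`, so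
the divergence is at most `∫ f ∂Q`. This bounds a divergence without computing a
density of `Q` with respect to `P`. -/
theorem klDiv_le_of_withDensity_le {α : Type*} [MeasurableSpace α] {Q P : Measure α}
    [IsProbabilityMeasure Q] [IsProbabilityMeasure P] {f : α → ℝ} (hf : Measurable f)
    (hint : Integrable f Q)
    (hle : Q.withDensity (fun x => ENNReal.ofReal (Real.exp (-f x))) ≤ P) :
    0 ≤ ∫ x, f x ∂Q ∧ klDiv Q P ≤ ENNReal.ofReal (∫ x, f x ∂Q) := by
  have hme : Measurable fun x => ENNReal.ofReal (Real.exp (-f x)) := by fun_prop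
  have hac : Q ≪ P := by
    refine (withDensity_absolutelyContinuous' hme.aemeasurable ?_).trans
      (Measure.absolutelyContinuous_of_le hle)
    exact ae_of_all _ fun x => by simp [Real.exp_pos]
  have hQ : P.withDensity (Q.rnDeriv P) = Q := Measure.withDensity_rnDeriv_eq _ _ hac
  have hr : Measurable (Q.rnDeriv P) := Measure.measurable_rnDeriv _ _
  have hle' : ∀ᵐ x ∂P, Q.rnDeriv P x * ENNReal.ofReal (Real.exp (-f x)) ≤ 1 := by
    refine ae_le_of_forall_setLIntegral_le_of_sigmaFinite (hr.mul hme) fun s hs _ => ?_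
    have h1 := hle s
    rw [← hQ, ← withDensity_mul _ hr hme, withDensity_apply _ hs] at h1
    simpa using h1
  have hpt : ∀ᵐ x ∂P, klFun (Q.rnDeriv P x).toReal
      ≤ (Q.rnDeriv P x).toReal * f x + 1 - (Q.rnDeriv P x).toReal := by
    filter_upwards [hle', Measure.rnDeriv_lt_top Q P] with x hx hfin
    rw [klFun_apply]
    have h1 : (Q.rnDeriv P x).toReal * Real.exp (-f x) ≤ 1 := by
      have := ENNReal.toReal_mono ENNReal.one_ne_top hx
      rwa [ENNReal.toReal_mul, ENNReal.toReal_ofReal (Real.exp_pos _).le, ENNReal.toReal_one]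
        at this
    set r := (Q.rnDeriv P x).toReal with hrdef
    rcases (ENNReal.toReal_nonneg : 0 ≤ (Q.rnDeriv P x).toReal).eq_or_lt with h0 | h0
    · rw [← hrdef] at h0; simp [← h0]
    · rw [← hrdef] at h0
      have : Real.log r ≤ f x := by
        rw [Real.log_le_iff_le_exp h0]
        rw [Real.exp_neg] at h1
        have := Real.exp_pos (f x)
        field_simp at h1
        linarith
      nlinarith
  have hi1 : Integrable (fun x => (Q.rnDeriv P x).toReal * f x) P :=
    (integrable_rnDeriv_smul_iff hac).2 hint
  have hi2 : Integrable (fun x => (Q.rnDeriv P x).toReal) P := Measure.integrable_toReal_rnDeriv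
  have hi3 : Integrable (fun x => (Q.rnDeriv P x).toReal * f x + 1 - (Q.rnDeriv P x).toReal) P :=
    (hi1.add (integrable_const 1)).sub hi2
  have hnn : ∀ᵐ x ∂P, 0 ≤ (Q.rnDeriv P x).toReal * f x + 1 - (Q.rnDeriv P x).toReal := by
    filter_upwards [hpt] with x hx
    exact (klFun_nonneg ENNReal.toReal_nonneg).trans hx
  have hval : ∫ x, ((Q.rnDeriv P x).toReal * f x + 1 - (Q.rnDeriv P x).toReal) ∂P
      = ∫ x, f x ∂Q := by
    have hi4 : Integrable (fun x => (Q.rnDeriv P x).toReal * f x + 1) P :=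
      hi1.add (integrable_const 1)
    rw [integral_sub hi4 hi2, integral_add hi1 (integrable_const 1)]
    have h1 : ∫ x, (Q.rnDeriv P x).toReal * f x ∂P = ∫ x, f x ∂Q := integral_rnDeriv_smul hac
    rw [h1, Measure.integral_toReal_rnDeriv hac]
    simp
  refine ⟨hval ▸ integral_nonneg_of_ae hnn, ?_⟩
  rw [klDiv_eq_lintegral_klFun_of_ac hac, ← hval, ofReal_integral_eq_lintegral_ofReal hi3 hnn]
  refine lintegral_mono_ae ?_
  filter_upwards [hpt] with x hx
  exact ENNReal.ofReal_le_ofReal hx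

/-- The Young inequality for the pair `klFun`, `exp - 1` of convex conjugates. -/
theorem mul_le_klFun_add_exp {r : ℝ} (hr : 0 ≤ r) (t : ℝ) : r * t ≤ klFun r + (Real.exp t - 1) := by
  have h := klFun_nonneg (mul_nonneg hr (Real.exp_pos (-t)).le)
  rw [klFun_apply] at h ⊢
  rcases hr.eq_or_lt with rfl | h0
  · simpa using (Real.exp_pos t).le
  · rw [Real.log_mul h0.ne' (Real.exp_pos _).ne', Real.log_exp] at h
    have he : Real.exp (-t) * Real.exp t = 1 := by rw [← Real.exp_add]; simp
    have := mul_nonneg h (Real.exp_pos t).le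
    have h2 : (r * Real.exp (-t) * (Real.log r + -t) + 1 - r * Real.exp (-t)) * Real.exp t
      = (r * (Real.log r - t) - r) * (Real.exp (-t) * Real.exp t) + Real.exp t := by ring
    rw [h2, he] at this
    linarith

/-- The Donsker-Varadhan inequality for a multiple of an indicator: a set of small `P`-mass has small
`Q`-mass as soon as its `P`-mass is exponentially small on the scale of the divergence. -/
theorem ofReal_mul_measure_le_klDiv_add {α : Type*} [MeasurableSpace α] {Q P : Measure α}
    [IsProbabilityMeasure Q] [IsProbabilityMeasure P] (B : Set α)
    {δ : ℝ} (hδ : 0 ≤ δ) :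
    ENNReal.ofReal δ * Q B ≤ klDiv Q P + ENNReal.ofReal (Real.exp δ) * P B := by
  by_cases hac : Q ≪ P
  swap
  · simp [klDiv_of_not_ac hac]
  rw [klDiv_eq_lintegral_klFun_of_ac hac]
  have hr : Measurable (Q.rnDeriv P) := Measure.measurable_rnDeriv _ _
  have hQB : Q B = ∫⁻ x in B, Q.rnDeriv P x ∂P := (Measure.setLIntegral_rnDeriv hac _).symm
  have hPB : ENNReal.ofReal (Real.exp δ) * P B = ∫⁻ _ in B, ENNReal.ofReal (Real.exp δ) ∂P := by
    simp
  calc ENNReal.ofReal δ * Q B = ∫⁻ x in B, ENNReal.ofReal δ * Q.rnDeriv P x ∂P := by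
        rw [hQB, lintegral_const_mul _ hr]
    _ ≤ ∫⁻ x in B, (ENNReal.ofReal (klFun (Q.rnDeriv P x).toReal)
          + ENNReal.ofReal (Real.exp δ)) ∂P := by
        refine lintegral_mono_ae (ae_restrict_of_ae ?_)
        filter_upwards [Measure.rnDeriv_lt_top Q P] with x hx
        conv_lhs => rw [← ENNReal.ofReal_toReal hx.ne]
        rw [← ENNReal.ofReal_mul hδ, ← ENNReal.ofReal_add (klFun_nonneg ENNReal.toReal_nonneg)
          (Real.exp_pos _).le]
        refine ENNReal.ofReal_le_ofReal ?_
        have := mul_le_klFun_add_exp (ENNReal.toReal_nonneg (a := Q.rnDeriv P x)) δ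
        linarith
    _ ≤ _ := by
        rw [lintegral_add_right _ measurable_const, ← hPB]
        gcongr
        exact Measure.restrict_le_self

end SparseVB

namespace SparseVB

open scoped Matrix

/-! ### Norms, scalar products and the column norm -/

theorem l2_nonneg {d : ℕ} (x : Fin d → ℝ) : 0 ≤ l2 x := norm_nonneg _

theorem l2_sq {d : ℕ} (x : Fin d → ℝ) : l2 x ^ 2 = x ⬝ᵥ x := by
  rw [l2, EuclideanSpace.real_norm_sq_eq]
  simp [dotProduct, sq]

theorem l2_add_le {d : ℕ} (x y : Fin d → ℝ) : l2 (x + y) ≤ l2 x + l2 y := by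
  simp only [l2, WithLp.toLp_add]
  exact norm_add_le _ _

theorem l2_sub_comm {d : ℕ} (x y : Fin d → ℝ) : l2 (x - y) = l2 (y - x) := by
  simp only [l2, WithLp.toLp_sub]
  exact norm_sub_rev _ _

theorem dotProduct_le_l2_mul_l2 {d : ℕ} (x y : Fin d → ℝ) : x ⬝ᵥ y ≤ l2 x * l2 y := by
  have h := real_inner_le_norm (WithLp.toLp 2 x : EuclideanSpace ℝ (Fin d)) (WithLp.toLp 2 y)
  rw [EuclideanSpace.inner_eq_star_dotProduct] at h
  simpa [l2, dotProduct_comm] using h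

theorem l2_pos {d : ℕ} {x : Fin d → ℝ} {i : Fin d} (h : x i ≠ 0) : 0 < l2 x := by
  refine norm_pos_iff.2 fun h0 => h ?_
  simpa using congrArg (fun v : EuclideanSpace ℝ (Fin d) => v i) h0

theorem l1_nonneg {d : ℕ} (x : Fin d → ℝ) : 0 ≤ l1 x := Finset.sum_nonneg fun _ _ => abs_nonneg _

theorem l1_add_le {d : ℕ} (x y : Fin d → ℝ) : l1 (x + y) ≤ l1 x + l1 y := by
  rw [l1, l1, l1, ← Finset.sum_add_distrib]
  exact Finset.sum_le_sum fun i _ => abs_add_le _ _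

theorem mem_supp {d : ℕ} {x : Fin d → ℝ} {i : Fin d} : i ∈ supp x ↔ x i ≠ 0 := by simp [supp]

theorem l1_eq_sum_supp {d : ℕ} (x : Fin d → ℝ) : l1 x = ∑ i ∈ supp x, |x i| := by
  refine (Finset.sum_subset (Finset.subset_univ _) fun i _ hi => ?_).symm
  simpa [mem_supp] using hi

theorem l1_pos {d : ℕ} {x : Fin d → ℝ} {i : Fin d} (h : x i ≠ 0) : 0 < l1 x :=
  Finset.sum_pos' (fun _ _ => abs_nonneg _) ⟨i, Finset.mem_univ _, abs_pos.2 h⟩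

theorem l1_le_sqrt_card_mul_l2 {d : ℕ} (x : Fin d → ℝ) : l1 x ≤ √((supp x).card : ℝ) * l2 x := by
  refine abs_le_of_sq_le_sq' ?_ (mul_nonneg (Real.sqrt_nonneg _) (l2_nonneg _)) |>.2
  rw [mul_pow, Real.sq_sqrt (Nat.cast_nonneg _), l2_sq, l1_eq_sum_supp]
  refine sq_sum_le_card_mul_sum_sq.trans ?_
  gcongr
  rw [dotProduct]
  refine (Finset.sum_le_sum_of_subset_of_nonneg (Finset.subset_univ _) ?_).trans_eq ?_
  · intros; positivity
  · exact Finset.sum_congr rfl fun i _ => by rw [sq_abs, sq]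

theorem card_supp_sub_le {d : ℕ} (x y : Fin d → ℝ) :
    (supp (x - y)).card ≤ (supp x).card + (supp y).card := by
  refine (Finset.card_le_card ?_).trans (Finset.card_union_le _ _)
  intro i
  simp only [Finset.mem_union, mem_supp, Pi.sub_apply]
  contrapose!
  rintro ⟨h1, h2⟩
  simp [h1, h2]

theorem l2_col_le_colNorm {n p : ℕ} (X : Matrix (Fin n) (Fin p) ℝ) (i : Fin p) :
    l2 (fun j => X j i) ≤ colNorm X :=
  le_ciSup (f := fun i : Fin p => l2 fun j => X j i) (Set.finite_range _).bddAbove i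

theorem colNorm_nonneg {n p : ℕ} (X : Matrix (Fin n) (Fin p) ℝ) : 0 ≤ colNorm X :=
  Real.iSup_nonneg fun _ => l2_nonneg _

/-! ### Gaussian noise -/

theorem lintegral_pi_prod {ι : Type*} [Fintype ι] (μ : ι → Measure ℝ)
    [∀ i, IsProbabilityMeasure (μ i)] {f : ι → ℝ → ℝ≥0∞} (hf : ∀ i, Measurable (f i)) :
    ∫⁻ x, ∏ i, f i (x i) ∂(Measure.pi μ) = ∏ i, ∫⁻ x, f i x ∂(μ i) := by
  have h := lintegral_prod_eq_prod_lintegral_of_indepFun (μ := Measure.pi μ) Finset.univ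
    (fun i x => f i (x i)) (iIndepFun_pi fun i => (hf i).aemeasurable)
    fun i => (hf i).comp (measurable_pi_apply i)
  refine h.trans ?_
  exact Finset.prod_congr rfl fun i _ => (measurePreserving_eval μ i).lintegral_comp (hf i)

theorem lintegral_exp_gaussianReal (a m : ℝ) :
    ∫⁻ y, ENNReal.ofReal (Real.exp (a * (y - m))) ∂(gaussianReal m 1)
      = ENNReal.ofReal (Real.exp (a * a / 2)) := by
  have h : (fun y => Real.exp (a * (y - m))) = fun y => Real.exp (-(a * m)) * Real.exp (a * y) := by
    funext y; rw [← Real.exp_add]; ring_nf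
  rw [← ofReal_integral_eq_lintegral_ofReal]
  · rw [h, integral_const_mul]
    have := congrFun (mgf_id_gaussianReal (μ := m) (v := 1)) a
    simp only [mgf, id] at this
    rw [this, ← Real.exp_add]
    congr 2
    push_cast
    ring
  · rw [h]; exact (integrable_exp_mul_gaussianReal a).const_mul _
  · exact ae_of_all _ fun _ => (Real.exp_pos _).le

instance isProbabilityMeasure_dataLaw {n p : ℕ} (X : Matrix (Fin n) (Fin p) ℝ) (θ : Fin p → ℝ) :
    IsProbabilityMeasure (dataLaw X θ) := by
  unfold dataLaw; infer_instance

theorem lintegral_exp_dotProduct_dataLaw {n p : ℕ} (X : Matrix (Fin n) (Fin p) ℝ) (θ : Fin p → ℝ)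
    (a : Fin n → ℝ) :
    ∫⁻ y, ENNReal.ofReal (Real.exp (a ⬝ᵥ (y - X.mulVec θ))) ∂(dataLaw X θ)
      = ENNReal.ofReal (Real.exp (a ⬝ᵥ a / 2)) := by
  have h : ∀ y : Fin n → ℝ, ENNReal.ofReal (Real.exp (a ⬝ᵥ (y - X.mulVec θ)))
      = ∏ j, ENNReal.ofReal (Real.exp (a j * (y j - X.mulVec θ j))) := fun y => by
    rw [dotProduct, Real.exp_sum, ENNReal.ofReal_prod_of_nonneg fun _ _ => (Real.exp_pos _).le]
    rfl
  simp_rw [h]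
  rw [dataLaw, lintegral_pi_prod (fun j => gaussianReal (X.mulVec θ j) 1)
    (f := fun j x => ENNReal.ofReal (Real.exp (a j * (x - X.mulVec θ j)))) (fun j => by fun_prop)]
  simp_rw [lintegral_exp_gaussianReal]
  rw [← ENNReal.ofReal_prod_of_nonneg fun _ _ => (Real.exp_pos _).le, ← Real.exp_sum,
    dotProduct, Finset.sum_div]

theorem measurable_dotProduct_sub {n : ℕ} (a b : Fin n → ℝ) :
    Measurable fun y : Fin n → ℝ => a ⬝ᵥ (y - b) := by
  unfold dotProduct; fun_prop

/-- The Chernoff bound for a linear form in the noise. -/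
theorem dataLaw_lt_dotProduct_le {n p : ℕ} (X : Matrix (Fin n) (Fin p) ℝ) (θ : Fin p → ℝ)
    (a : Fin n → ℝ) (t : ℝ) :
    dataLaw X θ {y | a ⬝ᵥ a / 2 + t < a ⬝ᵥ (y - X.mulVec θ)} ≤ ENNReal.ofReal (Real.exp (-t)) := by
  have hm : Measurable fun y : Fin n → ℝ =>
      ENNReal.ofReal (Real.exp (a ⬝ᵥ (y - X.mulVec θ))) :=
    ENNReal.measurable_ofReal.comp (Real.measurable_exp.comp (measurable_dotProduct_sub _ _))
  have h := meas_ge_le_lintegral_div (μ := dataLaw X θ) hm.aemeasurable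
    (ε := ENNReal.ofReal (Real.exp (a ⬝ᵥ a / 2 + t))) (by simp [Real.exp_pos]) (by simp)
  rw [lintegral_exp_dotProduct_dataLaw, ← ENNReal.ofReal_div_of_pos (Real.exp_pos _),
    ← Real.exp_sub, show a ⬝ᵥ a / 2 - (a ⬝ᵥ a / 2 + t) = -t by ring] at h
  refine (measure_mono fun y hy => ?_).trans h
  exact ENNReal.ofReal_le_ofReal (Real.exp_le_exp.2 (le_of_lt hy))

/-- The event that every column of `X` has scalar product at most `2 ‖X‖ √(log p)` with the noise
`y - X θ`. -/
def noiseEvent {n p : ℕ} (X : Matrix (Fin n) (Fin p) ℝ) (θ : Fin p → ℝ) : Set (Fin n → ℝ) :=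
  {y | ∀ i, |(fun j => X j i) ⬝ᵥ (y - X.mulVec θ)| ≤ lamBar X}

theorem measurableSet_noiseEvent {n p : ℕ} (X : Matrix (Fin n) (Fin p) ℝ) (θ : Fin p → ℝ) :
    MeasurableSet (noiseEvent X θ) := by
  simp only [noiseEvent, Set.ofPred_forall]
  refine MeasurableSet.iInter fun i => measurableSet_le ?_ measurable_const
  exact (measurable_dotProduct_sub _ _).abs

theorem dataLaw_compl_noiseEvent_le {n p : ℕ} (X : Matrix (Fin n) (Fin p) ℝ) (θ : Fin p → ℝ)
    (hX : 0 < colNorm X) (hp : 2 ≤ p) :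
    dataLaw X θ (noiseEvent X θ)ᶜ ≤ ENNReal.ofReal (2 / p) := by
  have hp0 : (0 : ℝ) < p := by exact_mod_cast (show 0 < p by omega)
  have hlog : 0 < Real.log p := Real.log_pos (by exact_mod_cast (show 1 < p by omega))
  -- The tilt `± 2 √(log p) / ‖X‖` minimizes the Chernoff bound at the threshold `2 ‖X‖ √(log p)`.
  have key : ∀ (i : Fin p) (ε : ℝ), ε * ε = 1 →
      dataLaw X θ {y | lamBar X < ε * ((fun j => X j i) ⬝ᵥ (y - X.mulVec θ))}
        ≤ ENNReal.ofReal ((p : ℝ)⁻¹ * (p : ℝ)⁻¹) := by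
    intro i ε hε
    set τ : ℝ := 2 * √(Real.log p) / colNorm X with hτ
    set c : Fin n → ℝ := fun j => X j i
    have h := dataLaw_lt_dotProduct_le X θ ((τ * ε) • c) (2 * Real.log p)
    have he : Real.exp (-(2 * Real.log p)) = (p : ℝ)⁻¹ * (p : ℝ)⁻¹ := by
      rw [two_mul, neg_add, Real.exp_add, Real.exp_neg, Real.exp_log hp0]
    rw [he] at h
    refine (measure_mono fun y hy => ?_).trans h
    simp only [Set.mem_ofPred_eq, smul_dotProduct, dotProduct_smul, smul_eq_mul] at hy ⊢
    have hτ0 : 0 < τ := by positivity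
    have h1 : c ⬝ᵥ c ≤ colNorm X ^ 2 := by
      rw [← l2_sq]
      exact pow_le_pow_left₀ (l2_nonneg _) (l2_col_le_colNorm X i) 2
    have h2 : τ ^ 2 * colNorm X ^ 2 = 4 * Real.log p := by
      rw [hτ, div_pow, mul_pow, Real.sq_sqrt hlog.le]; field_simp; norm_num
    have h3 : τ * lamBar X = 4 * Real.log p := by
      rw [hτ, lamBar]; field_simp; rw [Real.sq_sqrt hlog.le]; ring
    have h4 := mul_lt_mul_of_pos_left hy hτ0
    have h5 : τ * ε * (τ * ε * c ⬝ᵥ c) = τ ^ 2 * (c ⬝ᵥ c) := by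
      linear_combination (τ ^ 2 * (c ⬝ᵥ c)) * hε
    have h6 := mul_le_mul_of_nonneg_left h1 (sq_nonneg τ)
    rw [h5]
    nlinarith
  have hsub : (noiseEvent X θ)ᶜ ⊆ ⋃ i : Fin p,
      ({y | lamBar X < 1 * ((fun j => X j i) ⬝ᵥ (y - X.mulVec θ))} ∪
        {y | lamBar X < (-1) * ((fun j => X j i) ⬝ᵥ (y - X.mulVec θ))}) := by
    intro y hy
    simp only [noiseEvent, Set.mem_compl_iff, Set.mem_ofPred_eq, not_forall, not_le] at hy
    obtain ⟨i, hi⟩ := hy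
    refine Set.mem_iUnion.2 ⟨i, ?_⟩
    simpa [lt_abs] using hi
  calc dataLaw X θ (noiseEvent X θ)ᶜ ≤ _ := measure_mono hsub
    _ ≤ ∑ i : Fin p, _ := measure_iUnion_fintype_le _ _
    _ ≤ ∑ _i : Fin p, (ENNReal.ofReal ((p : ℝ)⁻¹ * (p : ℝ)⁻¹)
          + ENNReal.ofReal ((p : ℝ)⁻¹ * (p : ℝ)⁻¹)) := by
        refine Finset.sum_le_sum fun i _ => (measure_union_le _ _).trans ?_
        exact add_le_add (key i 1 (by norm_num)) (key i (-1) (by norm_num))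
    _ = ENNReal.ofReal (2 / p) := by
        rw [← ENNReal.ofReal_add (by positivity) (by positivity), Finset.sum_const,
          Finset.card_univ, Fintype.card_fin, nsmul_eq_mul, ← ENNReal.ofReal_natCast,
          ← ENNReal.ofReal_mul (by positivity)]
        congr 1
        field_simp
        norm_num

/-- On the noise event, linear forms in the noise are controlled by the `ℓ₁` norm. -/
theorem dotProduct_mulVec_le_of_mem_noiseEvent {n p : ℕ} {X : Matrix (Fin n) (Fin p) ℝ}
    {θ : Fin p → ℝ} {y : Fin n → ℝ} (hy : y ∈ noiseEvent X θ) (h : Fin p → ℝ) :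
    (y - X.mulVec θ) ⬝ᵥ X.mulVec h ≤ lamBar X * l1 h := by
  rw [Matrix.dotProduct_mulVec, dotProduct, l1, Finset.mul_sum]
  refine Finset.sum_le_sum fun i _ => ?_
  have h1 := hy i
  have h2 : ((y - X.mulVec θ) ᵥ* X) i = (fun j => X j i) ⬝ᵥ (y - X.mulVec θ) := by
    rw [Matrix.vecMul, dotProduct_comm]
  rw [h2]
  calc _ ≤ |(fun j => X j i) ⬝ᵥ (y - X.mulVec θ) * h i| := le_abs_self _
    _ ≤ _ := by rw [abs_mul]; gcongr

end SparseVB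

namespace SparseVB

/-! ### The Laplace distribution and the prior -/

theorem lintegral_exp_neg_mul_abs_sub {b : ℝ} (hb : 0 < b) (c : ℝ) :
    ∫⁻ x, ENNReal.ofReal (Real.exp (-(b * |x - c|))) = ENNReal.ofReal (2 / b) := by
  have h0 : ∫⁻ x, ENNReal.ofReal (Real.exp (-(b * |x - c|)))
      = ∫⁻ x : ℝ, ENNReal.ofReal (Real.exp (-(b * |x|))) :=
    lintegral_sub_right_eq_self (μ := volume)
      (fun x : ℝ => ENNReal.ofReal (Real.exp (-(b * |x|)))) c
  have hint : Integrable (fun x : ℝ => Real.exp (-(b * |x|))) := by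
    rw [← integrableOn_univ, ← Set.Iic_union_Ioi (a := (0 : ℝ)), integrableOn_union]
    constructor
    · refine (integrableOn_exp_mul_Iic hb 0).congr_fun (fun x hx => ?_) measurableSet_Iic
      simp only [abs_of_nonpos (Set.mem_Iic.1 hx)]
      ring_nf
    · refine (integrableOn_exp_mul_Ioi (neg_lt_zero.2 hb) 0).congr_fun (fun x hx => ?_)
        measurableSet_Ioi
      simp only [abs_of_pos (Set.mem_Ioi.1 hx)]
      ring_nf
  rw [h0, ← ofReal_integral_eq_lintegral_ofReal hint (ae_of_all _ fun _ => (Real.exp_pos _).le)]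
  congr 1
  rw [integral_comp_abs (f := fun x => Real.exp (-(b * x)))]
  have := integral_exp_mul_Ioi (neg_lt_zero.2 hb) 0
  simp only [neg_mul, mul_zero, Real.exp_zero] at this
  rw [this]
  field_simp

theorem lintegral_laplace (lam : ℝ) {f : ℝ → ℝ≥0∞} (hf : Measurable f) :
    ∫⁻ x, f x ∂(laplace lam)
      = ∫⁻ x, ENNReal.ofReal (lam / 2 * Real.exp (-lam * |x|)) * f x := by
  rw [laplace, lintegral_withDensity_eq_lintegral_mul _ (by fun_prop) hf]
  rfl

theorem isProbabilityMeasure_laplace {lam : ℝ} (hlam : 0 < lam) :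
    IsProbabilityMeasure (laplace lam) := by
  constructor
  rw [← lintegral_one, lintegral_laplace _ measurable_const]
  simp only [mul_one]
  simp_rw [ENNReal.ofReal_mul (show 0 ≤ lam / 2 by positivity)]
  rw [lintegral_const_mul _ (by fun_prop)]
  have h := lintegral_exp_neg_mul_abs_sub hlam 0
  simp only [sub_zero] at h
  simp only [neg_mul]
  rw [h, ← ENNReal.ofReal_mul (by positivity)]
  field_simp
  simp

/-- The law of the prior given the model `S`: independent Laplace coordinates on `S`, zeros off
`S`. -/
noncomputable def slab (p : ℕ) (lam : ℝ) (S : Finset (Fin p)) : Measure (Fin p → ℝ) :=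
  Measure.pi fun i => if i ∈ S then laplace lam else Measure.dirac 0

theorem isProbabilityMeasure_slab_coord {p : ℕ} {lam : ℝ} (hlam : 0 < lam) (S : Finset (Fin p))
    (i : Fin p) :
    IsProbabilityMeasure (if i ∈ S then laplace lam else Measure.dirac (0 : ℝ)) := by
  have := isProbabilityMeasure_laplace hlam
  split_ifs <;> infer_instance

theorem isProbabilityMeasure_slab {p : ℕ} {lam : ℝ} (hlam : 0 < lam) (S : Finset (Fin p)) :
    IsProbabilityMeasure (slab p lam S) := by
  have := isProbabilityMeasure_slab_coord hlam S
  unfold slab; infer_instance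

theorem modelPrior_eq (p : ℕ) (w : ℕ → ℝ) (lam : ℝ) :
    modelPrior p w lam = ∑ S : Finset (Fin p),
      ENNReal.ofReal (w S.card / (p.choose S.card : ℝ)) • slab p lam S := rfl

theorem lintegral_modelPrior (p : ℕ) (w : ℕ → ℝ) (lam : ℝ) (f : (Fin p → ℝ) → ℝ≥0∞) :
    ∫⁻ θ, f θ ∂(modelPrior p w lam) = ∑ S : Finset (Fin p),
      ENNReal.ofReal (w S.card / (p.choose S.card : ℝ)) * ∫⁻ θ, f θ ∂(slab p lam S) := by
  rw [modelPrior_eq, lintegral_finsetSum_measure]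
  simp [lintegral_smul_measure]

theorem isFiniteMeasure_modelPrior {p : ℕ} (w : ℕ → ℝ) {lam : ℝ} (hlam : 0 < lam) :
    IsFiniteMeasure (modelPrior p w lam) := by
  constructor
  rw [← lintegral_one, lintegral_modelPrior]
  refine ENNReal.sum_lt_top.2 fun S _ => ?_
  have := isProbabilityMeasure_slab hlam S
  simp

theorem smul_slab_le_modelPrior {p : ℕ} (w : ℕ → ℝ) (lam : ℝ) (S : Finset (Fin p)) :
    ENNReal.ofReal (w S.card / (p.choose S.card : ℝ)) • slab p lam S ≤ modelPrior p w lam := by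
  refine Measure.le_iff.2 fun s _ => ?_
  rw [modelPrior_eq, Measure.finsetSum_apply]
  exact Finset.single_le_sum
    (f := fun S => (ENNReal.ofReal (w S.card / (p.choose S.card : ℝ)) • slab p lam S) s)
    (fun _ _ => zero_le) (Finset.mem_univ S)

theorem ae_slab_eq_zero {p : ℕ} {lam : ℝ} (hlam : 0 < lam) (S : Finset (Fin p)) :
    ∀ᵐ θ ∂(slab p lam S), ∀ i ∉ S, θ i = 0 := by
  have := isProbabilityMeasure_slab_coord hlam S
  rw [ae_all_iff]
  intro i
  by_cases hi : i ∈ S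
  · simp [hi]
  · have h : ∀ᵐ x ∂(if i ∈ S then laplace lam else Measure.dirac (0 : ℝ)), x = 0 := by
      rw [if_neg hi, ae_dirac_eq]; rfl
    have := (measurePreserving_eval
      (fun i => if i ∈ S then laplace lam else Measure.dirac (0 : ℝ)) i).quasiMeasurePreserving.ae h
    filter_upwards [this] with θ hθ _ using hθ

theorem ae_slab_supp_subset {p : ℕ} {lam : ℝ} (hlam : 0 < lam) (S : Finset (Fin p)) :
    ∀ᵐ θ ∂(slab p lam S), supp θ ⊆ S := by
  filter_upwards [ae_slab_eq_zero hlam S] with θ hθ i hi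
  by_contra h
  exact mem_supp.1 hi (hθ i h)

theorem measurable_card_supp {d : ℕ} : Measurable fun θ : Fin d → ℝ => ((supp θ).card : ℝ) := by
  have h : ∀ θ : Fin d → ℝ, ((supp θ).card : ℝ) = ∑ i, if θ i ≠ 0 then (1 : ℝ) else 0 := fun θ => by
    rw [Finset.sum_boole, supp]
  simp_rw [h]
  refine Finset.measurable_sum _ fun i _ => Measurable.ite ?_ measurable_const measurable_const
  exact (measurableSet_eq_fun (measurable_pi_apply i) measurable_const).compl

theorem measurableSet_le_card_supp {d : ℕ} (t : ℝ) :
    MeasurableSet {θ : Fin d → ℝ | t ≤ ((supp θ).card : ℝ)} :=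
  measurableSet_le measurable_const measurable_card_supp

theorem measurable_l1 {d : ℕ} : Measurable fun θ : Fin d → ℝ => l1 θ := by
  unfold l1; fun_prop

theorem measurable_l1_sub {d : ℕ} (c : Fin d → ℝ) : Measurable fun θ : Fin d → ℝ => l1 (θ - c) := by
  unfold l1; simp only [Pi.sub_apply]; fun_prop

/-- The factor `e^{λ ‖θ‖₁}` removes the Laplace weights, and `e^{-(λ/4) ‖θ - θs‖₁}` replaces them by
weights around `θs`; each active coordinate then costs a factor `4`. -/
theorem lintegral_slab_tilt_le {p : ℕ} {lam : ℝ} (hlam : 0 < lam) (S : Finset (Fin p))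
    (θs : Fin p → ℝ) :
    ∫⁻ θ, ENNReal.ofReal (Real.exp (lam * l1 θ - lam / 4 * l1 (θ - θs))) ∂(slab p lam S)
      ≤ ENNReal.ofReal (4 ^ S.card) := by
  have := isProbabilityMeasure_slab_coord hlam S
  have h : ∀ θ : Fin p → ℝ,
      ENNReal.ofReal (Real.exp (lam * l1 θ - lam / 4 * l1 (θ - θs)))
        = ∏ i, ENNReal.ofReal (Real.exp (lam * |θ i| - lam / 4 * |θ i - θs i|)) := fun θ => by
    rw [l1, l1, Finset.mul_sum, Finset.mul_sum, ← Finset.sum_sub_distrib, Real.exp_sum,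
      ENNReal.ofReal_prod_of_nonneg fun _ _ => (Real.exp_pos _).le]
    rfl
  simp_rw [h]
  rw [slab, lintegral_pi_prod (fun i => if i ∈ S then laplace lam else Measure.dirac (0 : ℝ))
    (f := fun i x => ENNReal.ofReal (Real.exp (lam * |x| - lam / 4 * |x - θs i|)))
    (fun i => by fun_prop)]
  calc _ ≤ ∏ i : Fin p, (if i ∈ S then ENNReal.ofReal 4 else 1) := by
        refine Finset.prod_le_prod' fun i _ => ?_
        by_cases hi : i ∈ S
        · simp only [hi, if_true]
          rw [lintegral_laplace _ (by fun_prop)]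
          have h1 : ∀ x : ℝ, ENNReal.ofReal (lam / 2 * Real.exp (-lam * |x|))
              * ENNReal.ofReal (Real.exp (lam * |x| - lam / 4 * |x - θs i|))
              = ENNReal.ofReal (lam / 2) * ENNReal.ofReal (Real.exp (-(lam / 4 * |x - θs i|))) := by
            intro x
            rw [← ENNReal.ofReal_mul (by positivity), ← ENNReal.ofReal_mul (by positivity), mul_assoc,
              ← Real.exp_add]
            ring_nf
          simp_rw [h1]
          rw [lintegral_const_mul _ (by fun_prop),
            lintegral_exp_neg_mul_abs_sub (by positivity), ← ENNReal.ofReal_mul (by positivity)]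
          refine ENNReal.ofReal_le_ofReal (le_of_eq ?_)
          field_simp
        · simp only [hi, if_false]
          rw [lintegral_dirac' _ (by fun_prop)]
          rw [← ENNReal.ofReal_one]
          refine ENNReal.ofReal_le_ofReal (Real.exp_le_one_iff.2 ?_)
          have := abs_nonneg (0 - θs i)
          simp only [abs_zero, mul_zero]
          nlinarith
    _ = _ := by
        rw [Finset.prod_ite_mem, Finset.univ_inter, Finset.prod_const, ENNReal.ofReal_pow (by norm_num)]

/-! ### The prior on the dimension -/

section dimension

variable {A₁ A₂ A₃ A₄ : ℝ} {p : ℕ} {w : ℕ → ℝ}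

theorem IsDimensionPrior.le_pow (h : IsDimensionPrior A₁ A₂ A₃ A₄ p w) (hA₂ : 0 < A₂) {s : ℕ}
    (hs : s ≤ p) : w s ≤ (A₂ * (p : ℝ) ^ (-A₄)) ^ s * w 0 := by
  induction s with
  | zero => simp
  | succ s ih =>
    refine (h.upper (s + 1) (by omega) hs).trans ?_
    rw [Nat.add_sub_cancel, pow_succ', mul_assoc (_ * _)]
    exact mul_le_mul_of_nonneg_left (ih (by omega)) (by positivity)

theorem IsDimensionPrior.pow_le (h : IsDimensionPrior A₁ A₂ A₃ A₄ p w) (hA₁ : 0 < A₁) {s : ℕ}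
    (hs : s ≤ p) : (A₁ * (p : ℝ) ^ (-A₃)) ^ s * w 0 ≤ w s := by
  induction s with
  | zero => simp
  | succ s ih =>
    refine le_trans ?_ (h.lower (s + 1) (by omega) hs)
    rw [Nat.add_sub_cancel, pow_succ', mul_assoc (_ * _)]
    exact mul_le_mul_of_nonneg_left (ih (by omega)) (by positivity)

theorem sum_range_pow_le_two {r : ℝ} (h0 : 0 ≤ r) (h1 : r ≤ 1 / 2) (n : ℕ) :
    ∑ s ∈ Finset.range n, r ^ s ≤ 2 := by
  refine (Summable.sum_le_tsum _ (fun _ _ => by positivity)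
    (summable_geometric_of_lt_one h0 (by linarith))).trans ?_
  rw [tsum_geometric_of_lt_one h0 (by linarith), inv_le_comm₀ (by linarith) (by norm_num)]
  linarith

theorem mul_rpow_neg_le {A₂ A₄ : ℝ} {p : ℕ} (hp : 1 ≤ p) (hbig : 8 * A₂ ≤ (p : ℝ) ^ (A₄ / 2)) :
    4 * (A₂ * (p : ℝ) ^ (-A₄)) * Real.exp (A₄ / 2 * Real.log p) ≤ 1 / 2 := by
  have hp0 : (0 : ℝ) < p := by exact_mod_cast hp
  have h1 : (p : ℝ) ^ (-A₄) = ((p : ℝ) ^ (A₄ / 2) * (p : ℝ) ^ (A₄ / 2))⁻¹ := by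
    rw [← Real.rpow_add hp0, ← Real.rpow_neg hp0.le]; ring_nf
  have h2 : Real.exp (A₄ / 2 * Real.log p) = (p : ℝ) ^ (A₄ / 2) := by
    rw [Real.rpow_def_of_pos hp0, mul_comm]
  have h3 : (0 : ℝ) < (p : ℝ) ^ (A₄ / 2) := Real.rpow_pos_of_pos hp0 _
  rw [h1, h2]
  field_simp
  linarith

theorem IsDimensionPrior.half_le (h : IsDimensionPrior A₁ A₂ A₃ A₄ p w) (hA₂ : 0 < A₂)
    (hA₄ : 0 < A₄) (hp : 1 ≤ p) (hbig : 8 * A₂ ≤ (p : ℝ) ^ (A₄ / 2)) : 1 / 2 ≤ w 0 := by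
  have hw0 : 0 ≤ w 0 := h.nonneg 0 (Nat.zero_le _)
  have h1 := mul_rpow_neg_le hp hbig
  have h2 : (1 : ℝ) ≤ Real.exp (A₄ / 2 * Real.log p) :=
    Real.one_le_exp (mul_nonneg (by positivity) (Real.log_nonneg (by exact_mod_cast hp)))
  have h3 : 0 ≤ A₂ * (p : ℝ) ^ (-A₄) := by positivity
  have h4 : A₂ * (p : ℝ) ^ (-A₄) ≤ 1 / 2 := by nlinarith
  have h5 : ∑ s ∈ Finset.range (p + 1), w s
      ≤ ∑ s ∈ Finset.range (p + 1), (A₂ * (p : ℝ) ^ (-A₄)) ^ s * w 0 :=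
    Finset.sum_le_sum fun s hs => h.le_pow hA₂ (by simpa [Nat.lt_succ_iff] using hs)
  rw [h.sum_eq_one, ← Finset.sum_mul] at h5
  have h6 := mul_le_mul_of_nonneg_right (sum_range_pow_le_two h3 h4 (p + 1)) hw0
  linarith

theorem IsDimensionPrior.le_one (h : IsDimensionPrior A₁ A₂ A₃ A₄ p w) : w 0 ≤ 1 := by
  rw [← h.sum_eq_one]
  exact Finset.single_le_sum (f := w) (fun s hs => h.nonneg s (by simpa [Nat.lt_succ_iff] using hs))
    (by simp)

/-- The decay of the prior on the dimension beats the factor `4 ^ |S|` of the tilt, and leaves an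
exponential bound for models of dimension at least `t`. -/
theorem IsDimensionPrior.setLIntegral_tilt_le (h : IsDimensionPrior A₁ A₂ A₃ A₄ p w) (hA₂ : 0 < A₂)
    (hA₄ : 0 < A₄) (hp : 1 ≤ p) (hbig : 8 * A₂ ≤ (p : ℝ) ^ (A₄ / 2)) {lam : ℝ} (hlam : 0 < lam)
    (θs : Fin p → ℝ) (t : ℝ) :
    ∫⁻ θ in {θ | t ≤ ((supp θ).card : ℝ)},
      ENNReal.ofReal (Real.exp (lam * l1 θ - lam / 4 * l1 (θ - θs))) ∂(modelPrior p w lam)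
      ≤ ENNReal.ofReal (2 * Real.exp (-(A₄ / 2 * Real.log p * t))) := by
  set τ : ℝ := A₄ / 2 * Real.log p with hτ
  have hτ0 : 0 ≤ τ := mul_nonneg (by positivity) (Real.log_nonneg (by exact_mod_cast hp))
  set g : (Fin p → ℝ) → ℝ≥0∞ := fun θ =>
    ENNReal.ofReal (Real.exp (lam * l1 θ - lam / 4 * l1 (θ - θs)))
  have hg : Measurable g := by
    have := measurable_l1 (d := p)
    have := measurable_l1_sub θs
    fun_prop
  have hw : ∀ s ≤ p, 0 ≤ w s := h.nonneg
  have hslab : ∀ S : Finset (Fin p),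
      ∫⁻ θ in {θ | t ≤ ((supp θ).card : ℝ)}, g θ ∂(slab p lam S)
        ≤ ENNReal.ofReal (4 ^ S.card * Real.exp (τ * (S.card - t))) := by
    intro S
    by_cases hS : t ≤ (S.card : ℝ)
    · refine (setLIntegral_le_lintegral _ _).trans ((lintegral_slab_tilt_le hlam S θs).trans ?_)
      refine ENNReal.ofReal_le_ofReal (le_mul_of_one_le_right (by positivity) ?_)
      exact Real.one_le_exp (mul_nonneg hτ0 (by linarith))
    · have h0 : slab p lam S {θ | t ≤ ((supp θ).card : ℝ)} = 0 := by
        refine measure_mono_null (fun θ hθ => ?_) (ae_slab_supp_subset hlam S)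
        intro hsub
        have : ((supp θ).card : ℝ) ≤ S.card := by exact_mod_cast Finset.card_le_card hsub
        exact hS (le_trans hθ this)
      rw [setLIntegral_measure_zero _ _ h0]
      exact zero_le
  have hcard : ∀ S : Finset (Fin p), S.card ≤ p := fun S => by
    simpa using Finset.card_le_univ S
  calc ∫⁻ θ in {θ | t ≤ ((supp θ).card : ℝ)}, g θ ∂(modelPrior p w lam)
      = ∑ S : Finset (Fin p), ENNReal.ofReal (w S.card / (p.choose S.card : ℝ))
          * ∫⁻ θ in {θ | t ≤ ((supp θ).card : ℝ)}, g θ ∂(slab p lam S) := by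
        rw [← lintegral_indicator (measurableSet_le_card_supp t), lintegral_modelPrior]
        simp_rw [lintegral_indicator (measurableSet_le_card_supp t)]
    _ ≤ ∑ S : Finset (Fin p), ENNReal.ofReal (w S.card / (p.choose S.card : ℝ))
          * ENNReal.ofReal (4 ^ S.card * Real.exp (τ * (S.card - t))) := by
        gcongr with S _
        exact hslab S
    _ = ENNReal.ofReal (∑ S : Finset (Fin p), w S.card / (p.choose S.card : ℝ)
          * (4 ^ S.card * Real.exp (τ * (S.card - t)))) := by
        rw [ENNReal.ofReal_sum_of_nonneg]
        · refine Finset.sum_congr rfl fun S _ => (ENNReal.ofReal_mul ?_).symm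
          exact div_nonneg (hw _ (hcard S)) (by positivity)
        · exact fun S _ => mul_nonneg (div_nonneg (hw _ (hcard S)) (by positivity)) (by positivity)
    _ ≤ _ := by
        refine ENNReal.ofReal_le_ofReal ?_
        have h1 := Finset.sum_powerset_apply_card (x := (Finset.univ : Finset (Fin p)))
          (fun s : ℕ => w s / (p.choose s : ℝ) * (4 ^ s * Real.exp (τ * (s - t))))
        rw [Finset.powerset_univ, Finset.card_univ, Fintype.card_fin] at h1
        rw [h1]
        have h2 : ∀ s ∈ Finset.range (p + 1), p.choose s • (w s / (p.choose s : ℝ)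
            * (4 ^ s * Real.exp (τ * (s - t)))) ≤ (1 / 2) ^ s * Real.exp (-(τ * t)) := by
          intro s hs
          have hs' : s ≤ p := by simpa [Nat.lt_succ_iff] using hs
          have hc : (0 : ℝ) < p.choose s := by exact_mod_cast Nat.choose_pos hs'
          have e1 : Real.exp (τ * (s - t)) = Real.exp τ ^ s * Real.exp (-(τ * t)) := by
            rw [← Real.exp_nat_mul, ← Real.exp_add]; ring_nf
          have e2 : p.choose s • (w s / (p.choose s : ℝ) * (4 ^ s * Real.exp (τ * (s - t))))
              = w s * (4 ^ s * Real.exp τ ^ s) * Real.exp (-(τ * t)) := by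
            rw [nsmul_eq_mul, e1]; field_simp
          rw [e2]
          refine mul_le_mul_of_nonneg_right ?_ (Real.exp_pos _).le
          have h3 : w s ≤ (A₂ * (p : ℝ) ^ (-A₄)) ^ s :=
            (h.le_pow hA₂ hs').trans (mul_le_of_le_one_right (by positivity) h.le_one)
          calc w s * (4 ^ s * Real.exp τ ^ s)
              ≤ (A₂ * (p : ℝ) ^ (-A₄)) ^ s * (4 ^ s * Real.exp τ ^ s) := by gcongr
            _ = (4 * (A₂ * (p : ℝ) ^ (-A₄)) * Real.exp τ) ^ s := by
                rw [mul_pow, mul_pow]; ring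
            _ ≤ _ := pow_le_pow_left₀ (by positivity) (mul_rpow_neg_le hp hbig) s
        refine (Finset.sum_le_sum h2).trans ?_
        rw [← Finset.sum_mul]
        gcongr
        exact sum_range_pow_le_two (by norm_num) le_rfl _

/-- The negative log-weight of a model of dimension `s` is of order `s log p`. -/
theorem IsDimensionPrior.neg_log_weight_le (h : IsDimensionPrior A₁ A₂ A₃ A₄ p w) (hA₁ : 0 < A₁)
    (hA₂ : 0 < A₂) (hA₄ : 0 < A₄) (hp : 2 ≤ p) (hbig : 8 * A₂ ≤ (p : ℝ) ^ (A₄ / 2))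
    (hbig' : 1 / A₁ ≤ p) {s : ℕ} (hs1 : 1 ≤ s) (hs : s ≤ p) :
    0 < w s / (p.choose s : ℝ) ∧
      -Real.log (w s / (p.choose s : ℝ)) ≤ (A₃ + 3) * (s * Real.log p) := by
  have hp0 : (0 : ℝ) < p := by exact_mod_cast (show 0 < p by omega)
  have hp2 : (2 : ℝ) ≤ p := by exact_mod_cast hp
  have hc : (0 : ℝ) < p.choose s := by exact_mod_cast Nat.choose_pos hs
  have hw0 := h.half_le hA₂ hA₄ (by omega) hbig
  have hw := h.pow_le hA₁ hs
  have hq : 0 < A₁ * (p : ℝ) ^ (-A₃) := by positivity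
  have hlow : (A₁ * (p : ℝ) ^ (-A₃)) ^ s * (1 / 2) ≤ w s :=
    (mul_le_mul_of_nonneg_left hw0 (by positivity)).trans hw
  have hwpos : 0 < w s := lt_of_lt_of_le (by positivity) hlow
  refine ⟨div_pos hwpos hc, ?_⟩
  have hlog2 : Real.log 2 ≤ Real.log p := Real.log_le_log (by norm_num) hp2
  have hlogA : -Real.log A₁ ≤ Real.log p := by
    rw [← Real.log_inv]
    exact Real.log_le_log (by positivity) (by rwa [← one_div])
  have hlogw := Real.log_le_log (by positivity) hlow
  rw [Real.log_mul (by positivity) (by norm_num), Real.log_pow, Real.log_mul hA₁.ne'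
    (by positivity), Real.log_rpow hp0, one_div, Real.log_inv] at hlogw
  have hch : Real.log (p.choose s) ≤ s * Real.log p := by
    rw [← Real.log_pow]
    refine Real.log_le_log hc ?_
    exact_mod_cast Nat.choose_le_pow p s
  rw [Real.log_div hwpos.ne' hc.ne']
  have hs1' : (1 : ℝ) ≤ s := by exact_mod_cast hs1
  have hl0 : 0 ≤ Real.log p := Real.log_nonneg (by linarith)
  nlinarith

end dimension

end SparseVB

namespace SparseVB

open InformationTheory

/-! ### The posterior and Gaussian candidates in the variational families -/

/-- The standing assumptions on design, prior and scale parameter, together with the lower bounds on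
the dimension `p` that make all later estimates non-asymptotic. -/
structure LargeSetting (A₁ A₂ A₃ A₄ : ℝ) {n p : ℕ} (X : Matrix (Fin n) (Fin p) ℝ) (w : ℕ → ℝ)
    (lam : ℝ) : Prop where
  A₁_pos : 0 < A₁
  A₂_pos : 0 < A₂
  A₃_pos : 0 < A₃
  A₄_pos : 0 < A₄
  prior : IsDimensionPrior A₁ A₂ A₃ A₄ p w
  lam_pos : 0 < lam
  le_lam : colNorm X / (p : ℝ) ≤ lam
  lam_le : lam ≤ 2 * lamBar X
  three_le : 3 ≤ p
  upper_large : 8 * A₂ ≤ (p : ℝ) ^ (A₄ / 2)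
  lower_large : 1 / A₁ ≤ p

/-- The normalizing constant in Bayes' formula. -/
noncomputable def evidence {n p : ℕ} (X : Matrix (Fin n) (Fin p) ℝ) (w : ℕ → ℝ) (lam : ℝ)
    (y : Fin n → ℝ) : ℝ≥0∞ :=
  ∫⁻ θ, likelihood X y θ ∂(modelPrior p w lam)

theorem continuous_l2 {d : ℕ} : Continuous fun x : Fin d → ℝ => l2 x :=
  continuous_norm.comp (PiLp.continuous_toLp 2 _)

theorem measurable_residual {n p : ℕ} (X : Matrix (Fin n) (Fin p) ℝ) :
    Measurable fun q : (Fin n → ℝ) × (Fin p → ℝ) => l2 (q.1 - X.mulVec q.2) :=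
  (continuous_l2.comp
    (continuous_fst.sub (continuous_const.matrix_mulVec continuous_snd))).measurable

theorem measurable_likelihood_right {n p : ℕ} (X : Matrix (Fin n) (Fin p) ℝ) (y : Fin n → ℝ) :
    Measurable (likelihood X y) := by
  have h : Measurable fun θ : Fin p → ℝ => l2 (y - X.mulVec θ) :=
    (continuous_l2.comp
      (continuous_const.sub (continuous_const.matrix_mulVec continuous_id))).measurable
  unfold likelihood
  fun_prop

theorem likelihood_le_one {n p : ℕ} (X : Matrix (Fin n) (Fin p) ℝ) (y : Fin n → ℝ)
    (θ : Fin p → ℝ) : likelihood X y θ ≤ 1 := by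
  rw [likelihood, ← ENNReal.ofReal_one]
  refine ENNReal.ofReal_le_ofReal (Real.exp_le_one_iff.2 ?_)
  have := sq_nonneg (l2 (y - X.mulVec θ))
  linarith

namespace LargeSetting

variable {A₁ A₂ A₃ A₄ : ℝ} {n p : ℕ} {X : Matrix (Fin n) (Fin p) ℝ} {w : ℕ → ℝ} {lam : ℝ}

theorem p_pos (h : LargeSetting A₁ A₂ A₃ A₄ X w lam) : (0 : ℝ) < p := by
  have := h.three_le
  exact_mod_cast (show 0 < p by omega)

theorem one_le_log (h : LargeSetting A₁ A₂ A₃ A₄ X w lam) : 1 ≤ Real.log p := by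
  rw [Real.le_log_iff_exp_le h.p_pos]
  have h3 : (3 : ℝ) ≤ p := by exact_mod_cast h.three_le
  linarith [Real.exp_one_lt_d9]

theorem colNorm_pos (h : LargeSetting A₁ A₂ A₃ A₄ X w lam) : 0 < colNorm X := by
  refine (colNorm_nonneg X).lt_of_ne fun h0 => ?_
  have h1 := h.lam_le
  rw [lamBar, ← h0] at h1
  have := h.lam_pos
  simp at h1
  linarith

theorem lamBar_pos (h : LargeSetting A₁ A₂ A₃ A₄ X w lam) : 0 < lamBar X := by
  linarith [h.lam_le, h.lam_pos]

theorem evidence_ne_top (h : LargeSetting A₁ A₂ A₃ A₄ X w lam) (y : Fin n → ℝ) :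
    evidence X w lam y ≠ ∞ := by
  have := isFiniteMeasure_modelPrior (p := p) w h.lam_pos
  refine ne_top_of_le_ne_top ?_ (lintegral_mono (likelihood_le_one X y))
  simp

theorem evidence_ne_zero (h : LargeSetting A₁ A₂ A₃ A₄ X w lam) (y : Fin n → ℝ) :
    evidence X w lam y ≠ 0 := by
  have hprob := isProbabilityMeasure_slab h.lam_pos (∅ : Finset (Fin p))
  have hw := h.prior.half_le h.A₂_pos h.A₄_pos (by have := h.three_le; omega) h.upper_large
  intro h0
  rw [evidence, lintegral_eq_zero_iff (measurable_likelihood_right X y)] at h0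
  have h1 : ∀ᵐ θ ∂(modelPrior p w lam), False := by
    filter_upwards [h0] with θ hθ
    simp [likelihood] at hθ
    exact absurd hθ (not_le.2 (Real.exp_pos _))
  have h2 : modelPrior p w lam = 0 := by
    rw [← ae_eq_bot]; exact Filter.eventually_false_iff_eq_bot.1 h1
  have h3 := (Measure.le_iff'.1 (smul_slab_le_modelPrior w lam (∅ : Finset (Fin p)))) Set.univ
  rw [h2] at h3
  simp at h3
  linarith

theorem isProbabilityMeasure_posterior (h : LargeSetting A₁ A₂ A₃ A₄ X w lam) (y : Fin n → ℝ) :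
    IsProbabilityMeasure (modelPosterior X w lam y) := by
  constructor
  rw [modelPosterior, Measure.smul_apply, withDensity_apply _ MeasurableSet.univ,
    Measure.restrict_univ, smul_eq_mul]
  exact ENNReal.inv_mul_cancel (h.evidence_ne_zero y) (h.evidence_ne_top y)

end LargeSetting

theorem pi_eq_withDensity_prod {ι : Type*} [Fintype ι] {μ ν : ι → Measure ℝ}
    [∀ i, IsProbabilityMeasure (μ i)] [∀ i, IsProbabilityMeasure (ν i)] {g : ι → ℝ → ℝ≥0∞}
    (hg : ∀ i, Measurable (g i)) (h : ∀ i, ν i = (μ i).withDensity (g i)) :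
    Measure.pi ν = (Measure.pi μ).withDensity fun x => ∏ i, g i (x i) := by
  refine Measure.pi_eq fun s hs => ?_
  have hbox : MeasurableSet (Set.univ.pi s) := MeasurableSet.univ_pi hs
  rw [withDensity_apply _ hbox, ← lintegral_indicator hbox]
  have h1 : (fun x : ι → ℝ => (Set.univ.pi s).indicator (fun x => ∏ i, g i (x i)) x)
      = fun x => ∏ i, (s i).indicator (g i) (x i) := by
    funext x
    by_cases hx : x ∈ Set.univ.pi s
    · rw [Set.indicator_of_mem hx]
      exact Finset.prod_congr rfl fun i _ => (Set.indicator_of_mem (hx i trivial) _).symm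
    · rw [Set.indicator_of_notMem hx]
      obtain ⟨i, hi⟩ : ∃ i, x i ∉ s i := by simpa [Set.mem_pi] using hx
      exact (Finset.prod_eq_zero (Finset.mem_univ i) (Set.indicator_of_notMem hi _)).symm
  rw [h1, lintegral_pi_prod μ fun i => (hg i).indicator (hs i)]
  refine Finset.prod_congr rfl fun i _ => ?_
  rw [h i, withDensity_apply _ (hs i), lintegral_indicator (hs i)]

/-- The product of `N(θs i, σ²)` over the support of `θs` and of point masses at `0` elsewhere; a
Gaussian of zero variance is a point mass. -/
noncomputable def candidate {p : ℕ} (θs : Fin p → ℝ) (σ : ℝ≥0) : Measure (Fin p → ℝ) :=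
  Measure.pi fun i => gaussianReal (θs i) (if i ∈ supp θs then σ ^ 2 else 0)

instance isProbabilityMeasure_candidate {p : ℕ} (θs : Fin p → ℝ) (σ : ℝ≥0) :
    IsProbabilityMeasure (candidate θs σ) := by unfold candidate; infer_instance

theorem candidate_mem_familyPMF {p : ℕ} (θs : Fin p → ℝ) {σ : ℝ≥0} (hσ : 0 < σ) :
    candidate θs σ ∈ familyPMF p := by
  refine ⟨θs, fun _ => σ, fun i => if i ∈ supp θs then 1 else 0, fun _ => hσ, fun i => ?_, ?_⟩
  · by_cases hi : i ∈ supp θs <;> simp [hi]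
  · rw [candidate]
    congr 1
    funext i
    by_cases hi : i ∈ supp θs
    · simp [hi]
    · have : θs i = 0 := by simpa [mem_supp] using hi
      simp [hi, this]

theorem multivariateGaussian_smul_one {ι : Type*} [Fintype ι] [DecidableEq ι]
    (μ : EuclideanSpace ℝ ι) (v : ℝ≥0) :
    multivariateGaussian μ ((v : ℝ) • (1 : Matrix ι ι ℝ))
      = (Measure.pi fun i => gaussianReal (μ i) v).map (WithLp.toLp 2) := by
  have hS : ((v : ℝ) • (1 : Matrix ι ι ℝ)).PosSemidef := Matrix.PosSemidef.one.smul v.2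
  have : IsProbabilityMeasure ((Measure.pi fun i => gaussianReal (μ i) v).map
      (WithLp.toLp 2 : (ι → ℝ) → EuclideanSpace ℝ ι)) :=
    Measure.isProbabilityMeasure_map (by fun_prop)
  apply Measure.ext_of_charFun (E := EuclideanSpace ℝ ι)
  ext t
  rw [charFun_multivariateGaussian hS, charFun_pi]
  simp_rw [charFun_gaussianReal, ← Complex.exp_sum]
  congr 1
  simp only [PiLp.inner_apply, Matrix.smul_mulVec, Matrix.one_mulVec, dotProduct,
    Finset.sum_sub_distrib, ← Finset.sum_mul, ← Finset.sum_div]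
  simp [Finset.mul_sum, sq, mul_comm, mul_left_comm]

theorem candidate_eq_gaussDirac {p : ℕ} (θs : Fin p → ℝ) (σ : ℝ≥0) :
    candidate θs σ = gaussDirac (supp θs) (WithLp.toLp 2 fun i => θs i)
      (((σ ^ 2 : ℝ≥0) : ℝ) • 1) := by
  classical
  have hext : Measurable fun (v : EuclideanSpace ℝ {i // i ∈ supp θs}) (i : Fin p) =>
      if h : i ∈ supp θs then v ⟨i, h⟩ else 0 := by
    refine measurable_pi_lambda _ fun i => ?_
    by_cases hi : i ∈ supp θs
    · simp only [hi, dite_true]; fun_prop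
    · simp only [hi, dite_false]; fun_prop
  have hlp : Measurable (WithLp.toLp 2 : ({i // i ∈ supp θs} → ℝ) → EuclideanSpace ℝ _) := by
    fun_prop
  rw [gaussDirac, multivariateGaussian_smul_one, Measure.map_map hext hlp]
  refine Measure.pi_eq fun s hs => ?_
  rw [Measure.map_apply (hext.comp hlp) (MeasurableSet.univ_pi hs)]
  have hoff : ∀ i ∉ supp θs, gaussianReal (θs i) (if i ∈ supp θs then σ ^ 2 else 0) (s i)
      = if (0 : ℝ) ∈ s i then 1 else 0 := fun i hi => by
    have : θs i = 0 := by simpa [mem_supp] using hi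
    rw [if_neg hi, this, gaussianReal_zero_var, Measure.dirac_apply' _ (hs i)]
    simp [Set.indicator_apply]
  by_cases h0 : ∀ i ∉ supp θs, (0 : ℝ) ∈ s i
  · have hpre : ((fun (v : EuclideanSpace ℝ {i // i ∈ supp θs}) (i : Fin p) =>
        if h : i ∈ supp θs then v ⟨i, h⟩ else 0) ∘ WithLp.toLp 2) ⁻¹' (Set.univ.pi s)
        = Set.univ.pi fun i : {i // i ∈ supp θs} => s i := by
      ext v
      simp only [Set.mem_preimage, Function.comp_apply, Set.mem_pi, Set.mem_univ, forall_const]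
      refine ⟨fun h i => by simpa [i.2] using h i, fun h i => ?_⟩
      by_cases hi : i ∈ supp θs
      · simpa [hi] using h ⟨i, hi⟩
      · simpa [hi] using h0 i hi
    rw [hpre, Measure.pi_pi, ← Finset.prod_subset (Finset.subset_univ (supp θs))
      (fun i _ hi => by rw [hoff i hi, if_pos (h0 i hi)])]
    rw [← Finset.prod_coe_sort (supp θs)]
    refine Finset.prod_congr rfl fun i _ => ?_
    rw [if_pos i.2]
  · push Not at h0
    obtain ⟨i, hi, hsi⟩ := h0
    rw [Finset.prod_eq_zero (Finset.mem_univ i) (by rw [hoff i hi, if_neg hsi])]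
    refine (measure_mono_null (fun v hv => ?_) (measure_empty))
    have := hv i trivial
    simp [hi] at this
    exact hsi this

theorem candidate_mem_familyQMF {p : ℕ} (θs : Fin p → ℝ) {σ : ℝ≥0} (hσ : 0 < σ) :
    candidate θs σ ∈ familyQMF p := by
  refine ⟨supp θs, _, _, ?_, ?_, candidate_eq_gaussDirac θs σ⟩
  · exact Matrix.PosDef.one.smul (by positivity)
  · exact Matrix.isDiag_one.smul _

theorem candidate_mem_familyQ {p : ℕ} (θs : Fin p → ℝ) {σ : ℝ≥0} (hσ : 0 < σ) :
    candidate θs σ ∈ familyQ p := by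
  obtain ⟨S, μ, D, hD, -, hQ⟩ := candidate_mem_familyQMF θs hσ
  exact ⟨S, μ, D, hD, hQ⟩

theorem candidate_mem {p : ℕ} (θs : Fin p → ℝ) {σ : ℝ≥0} (hσ : 0 < σ)
    {F : ∀ d : ℕ, Set (Measure (Fin d → ℝ))}
    (hF : F ∈ ({familyPMF, familyQ, familyQMF} : Set (∀ d : ℕ, Set (Measure (Fin d → ℝ))))) :
    candidate θs σ ∈ F p := by
  rcases hF with rfl | rfl | rfl
  · exact candidate_mem_familyPMF θs hσ
  · exact candidate_mem_familyQ θs hσ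
  · exact candidate_mem_familyQMF θs hσ

theorem isProbabilityMeasure_of_mem {p : ℕ} {F : ∀ d : ℕ, Set (Measure (Fin d → ℝ))}
    (hF : F ∈ ({familyPMF, familyQ, familyQMF} : Set (∀ d : ℕ, Set (Measure (Fin d → ℝ)))))
    {Q : Measure (Fin p → ℝ)} (hQ : Q ∈ F p) : IsProbabilityMeasure Q := by
  have hgauss : ∀ (S : Finset (Fin p)) (μ : EuclideanSpace ℝ {i // i ∈ S})
      (V : Matrix {i // i ∈ S} {i // i ∈ S} ℝ), IsProbabilityMeasure (gaussDirac S μ V) := by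
    intro S μ V
    refine Measure.isProbabilityMeasure_map (Measurable.aemeasurable ?_)
    refine measurable_pi_lambda _ fun i => ?_
    by_cases hi : i ∈ S
    · simp only [hi, dite_true]; fun_prop
    · simp only [hi, dite_false]; fun_prop
  rcases hF with rfl | rfl | rfl
  · obtain ⟨μ, σ, γ, -, hγ, rfl⟩ := hQ
    have : ∀ i, IsProbabilityMeasure (ENNReal.ofReal (γ i) • gaussianReal (μ i) (σ i ^ 2) +
        ENNReal.ofReal (1 - γ i) • Measure.dirac (0 : ℝ)) := fun i => ⟨by
      have h1 := (hγ i).1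
      have h2 := (hγ i).2
      simp only [Measure.add_apply, Measure.smul_apply, measure_univ, smul_eq_mul, mul_one]
      rw [← ENNReal.ofReal_add h1 (by linarith)]
      simp⟩
    infer_instance
  · obtain ⟨S, μ, V, -, rfl⟩ := hQ
    exact hgauss S μ V
  · obtain ⟨S, μ, V, -, -, rfl⟩ := hQ
    exact hgauss S μ V

end SparseVB

namespace SparseVB

open InformationTheory

/-! ### The divergence of a Gaussian candidate -/

theorem withDensity_le_withDensity {α : Type*} [MeasurableSpace α] {μ ν : Measure α} (h : μ ≤ ν)
    (f : α → ℝ≥0∞) : μ.withDensity f ≤ ν.withDensity f := by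
  refine Measure.le_iff.2 fun s hs => ?_
  rw [withDensity_apply _ hs, withDensity_apply _ hs]
  exact lintegral_mono' (Measure.restrict_mono le_rfl h) le_rfl

theorem gaussianReal_eq_laplace_withDensity {lam : ℝ} (hlam : 0 < lam) (m : ℝ) {v : ℝ≥0}
    (hv : v ≠ 0) :
    gaussianReal m v = (laplace lam).withDensity fun x =>
      gaussianPDF m v x * ENNReal.ofReal (2 / lam * Real.exp (lam * |x|)) := by
  have hm := measurable_gaussianPDF m v
  rw [gaussianReal_of_var_ne_zero m hv, laplace, ← withDensity_mul _ (by fun_prop) (by fun_prop)]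
  congr 1
  funext x
  rw [Pi.mul_apply, mul_left_comm, ← ENNReal.ofReal_mul (by positivity)]
  have : lam / 2 * Real.exp (-lam * |x|) * (2 / lam * Real.exp (lam * |x|)) = 1 := by
    have h1 : Real.exp (-lam * |x|) * Real.exp (lam * |x|) = 1 := by
      rw [← Real.exp_add]; simp
    rw [mul_mul_mul_comm, h1, mul_one]
    field_simp
  rw [this]
  simp

theorem gaussianPDFReal_le {m σ : ℝ} (hσ : 0 < σ) {v : ℝ≥0} (hv : (v : ℝ) = σ ^ 2) (x : ℝ) :
    gaussianPDFReal m v x ≤ 1 / (2 * σ) := by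
  rw [gaussianPDFReal_def, hv]
  have h1 : 2 * σ ≤ √(2 * Real.pi * σ ^ 2) := by
    refine Real.le_sqrt_of_sq_le ?_
    have := Real.pi_gt_three
    nlinarith [sq_nonneg σ]
  have h2 : Real.exp (-(x - m) ^ 2 / (2 * σ ^ 2)) ≤ 1 := by
    rw [Real.exp_le_one_iff]
    exact div_nonpos_of_nonpos_of_nonneg (by linarith [sq_nonneg (x - m)]) (by positivity)
  calc _ ≤ (√(2 * Real.pi * σ ^ 2))⁻¹ * 1 := mul_le_mul_of_nonneg_left h2 (by positivity)
    _ ≤ (2 * σ)⁻¹ * 1 := mul_le_mul_of_nonneg_right (inv_anti₀ (by positivity) h1) zero_le_one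
    _ = _ := by rw [mul_one, one_div]

/-- With standard deviation at least `1 / (p λ)`, the density of the candidate with respect to the
Laplace slab is at most `p ^ |S| e^{λ ‖θ‖₁}`. -/
theorem candidate_withDensity_le_slab {p : ℕ} {lam : ℝ} (hlam : 0 < lam) (hp : 1 ≤ p)
    (θs : Fin p → ℝ) {σ : ℝ≥0} (hσ : 0 < σ) (hσp : 1 ≤ lam * σ * p) :
    (candidate θs σ).withDensity (fun θ => ENNReal.ofReal
        (Real.exp (-((supp θs).card * Real.log p + lam * l1 θ)))) ≤ slab p lam (supp θs) := by
  classical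
  have hp0 : (0 : ℝ) < p := by exact_mod_cast hp
  have hσ0 : (0 : ℝ) < σ := by exact_mod_cast hσ
  have := isProbabilityMeasure_slab_coord hlam (supp θs)
  set g : Fin p → ℝ → ℝ≥0∞ := fun i => if i ∈ supp θs then
    fun x => gaussianPDF (θs i) (σ ^ 2) x * ENNReal.ofReal (2 / lam * Real.exp (lam * |x|))
    else fun _ => 1 with hgdef
  have hg : ∀ i, Measurable (g i) := by
    intro i
    have := measurable_gaussianPDF (θs i) (σ ^ 2)
    by_cases hi : i ∈ supp θs
    · simp only [hgdef, hi, if_true]; fun_prop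
    · simp only [hgdef, hi, if_false]; fun_prop
  have hcoord : ∀ i, gaussianReal (θs i) (if i ∈ supp θs then σ ^ 2 else 0)
      = (if i ∈ supp θs then laplace lam else Measure.dirac (0 : ℝ)).withDensity (g i) := by
    intro i
    by_cases hi : i ∈ supp θs
    · simp only [hgdef, hi, if_true]
      exact gaussianReal_eq_laplace_withDensity hlam _ (pow_ne_zero 2 hσ.ne')
    · have h0 : θs i = 0 := by simpa [mem_supp] using hi
      simp only [hgdef, hi, if_false, h0, gaussianReal_zero_var]
      exact (withDensity_one).symm
  have hprod : Measurable fun x : Fin p → ℝ => ∏ i, g i (x i) :=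
    Finset.measurable_prod _ fun i _ => (hg i).comp (measurable_pi_apply i)
  have hl1 := measurable_l1 (d := p)
  rw [candidate, pi_eq_withDensity_prod hg hcoord, ← withDensity_mul _ hprod (by fun_prop)]
  refine (withDensity_mono (g := 1) (ae_of_all _ fun θ => ?_)).trans (by rw [withDensity_one]; rfl)
  have hle : ∀ i, g i (θ i) ≤ ENNReal.ofReal
      (Real.exp ((if i ∈ supp θs then Real.log p else 0) + lam * |θ i|)) := by
    intro i
    by_cases hi : i ∈ supp θs
    · simp only [hgdef, hi, if_true]
      rw [gaussianPDF, ← ENNReal.ofReal_mul (gaussianPDFReal_nonneg _ _ _), Real.exp_add,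
        Real.exp_log hp0, ← mul_assoc]
      refine ENNReal.ofReal_le_ofReal (mul_le_mul_of_nonneg_right ?_ (Real.exp_pos _).le)
      calc gaussianPDFReal (θs i) (σ ^ 2) (θ i) * (2 / lam) ≤ 1 / (2 * σ) * (2 / lam) := by
            gcongr
            exact gaussianPDFReal_le hσ0 (by push_cast; rfl) _
        _ ≤ p := by
            rw [show 1 / (2 * (σ : ℝ)) * (2 / lam) = 1 / (lam * σ) by field_simp,
              div_le_iff₀ (by positivity)]
            linarith
    · simp only [hgdef, hi, if_false, zero_add]
      rw [← ENNReal.ofReal_one]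
      exact ENNReal.ofReal_le_ofReal (Real.one_le_exp (by positivity))
  calc (∏ i, g i (θ i)) * ENNReal.ofReal (Real.exp (-((supp θs).card * Real.log p + lam * l1 θ)))
      ≤ (∏ i, ENNReal.ofReal (Real.exp ((if i ∈ supp θs then Real.log p else 0) + lam * |θ i|)))
        * ENNReal.ofReal (Real.exp (-((supp θs).card * Real.log p + lam * l1 θ))) := by
        gcongr with i _
        exact hle i
    _ = 1 := by
        rw [← ENNReal.ofReal_prod_of_nonneg fun _ _ => (Real.exp_pos _).le, ← Real.exp_sum,
          ← ENNReal.ofReal_mul (Real.exp_pos _).le, ← Real.exp_add, Finset.sum_add_distrib,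
          Finset.sum_ite_mem, Finset.univ_inter, Finset.sum_const, nsmul_eq_mul, ← Finset.mul_sum,
          l1]
        simp

theorem memLp_candidate_coord {p : ℕ} (θs : Fin p → ℝ) (σ : ℝ≥0) (i : Fin p) :
    MemLp (fun θ : Fin p → ℝ => θ i) 2 (candidate θs σ) :=
  (memLp_id_gaussianReal' 2 (by simp)).comp_measurePreserving
    (measurePreserving_eval (fun i => gaussianReal (θs i) (if i ∈ supp θs then σ ^ 2 else 0)) i)

theorem integral_candidate_coord {p : ℕ} (θs : Fin p → ℝ) (σ : ℝ≥0) (i : Fin p) :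
    ∫ θ, θ i ∂(candidate θs σ) = θs i := by
  rw [candidate, integral_eval, integral_id_gaussianReal]

theorem integral_abs_sub_gaussianReal_le (m : ℝ) (σ : ℝ≥0) :
    ∫ x, |x - m| ∂(gaussianReal m (σ ^ 2)) ≤ σ := by
  rcases eq_or_ne σ 0 with rfl | hσ
  · simp
  have hσ0 : (0 : ℝ) < σ := by exact_mod_cast pos_iff_ne_zero.2 hσ
  have hL : MemLp (fun x : ℝ => x) 2 (gaussianReal m (σ ^ 2)) := memLp_id_gaussianReal' 2 (by simp)
  have hLs : MemLp (fun x : ℝ => x - m) 2 (gaussianReal m (σ ^ 2)) := hL.sub (memLp_const m)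
  have hsq : Integrable (fun x : ℝ => (x - m) ^ 2) (gaussianReal m (σ ^ 2)) := hLs.integrable_sq
  have hvar : ∫ x, (x - m) ^ 2 ∂(gaussianReal m (σ ^ 2)) = σ ^ 2 := by
    have h := variance_fun_id_gaussianReal (μ := m) (v := σ ^ 2)
    rw [variance_eq_integral (by fun_prop)] at h
    simpa using h
  calc ∫ x, |x - m| ∂(gaussianReal m (σ ^ 2))
      ≤ ∫ x, ((σ : ℝ) / 2 + (2 * (σ : ℝ))⁻¹ * (x - m) ^ 2) ∂(gaussianReal m (σ ^ 2)) := by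
        refine integral_mono (hLs.integrable (by norm_num)).abs
          ((integrable_const _).add (hsq.const_mul _)) fun x => ?_
        simp only
        rw [← sq_abs (x - m)]
        field_simp
        nlinarith [sq_nonneg (|x - m| - σ)]
    _ = σ := by
        rw [integral_add (integrable_const _) (hsq.const_mul _), integral_const_mul, hvar]
        simp
        field_simp
        norm_num

theorem integrable_l1_candidate {p : ℕ} (θs : Fin p → ℝ) (σ : ℝ≥0) :
    Integrable (fun θ => l1 θ) (candidate θs σ) :=
  integrable_finsetSum _ fun i _ => ((memLp_candidate_coord θs σ i).integrable (by norm_num)).abs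

theorem integral_l1_candidate_le {p : ℕ} (θs : Fin p → ℝ) (σ : ℝ≥0) :
    ∫ θ, l1 θ ∂(candidate θs σ) ≤ l1 θs + (supp θs).card * σ := by
  have hint : ∀ i, Integrable (fun θ : Fin p → ℝ => |θ i|) (candidate θs σ) := fun i =>
    ((memLp_candidate_coord θs σ i).integrable (by norm_num)).abs
  simp only [l1]
  rw [integral_finsetSum _ fun i _ => hint i]
  have h : ∀ i, ∫ θ, |θ i| ∂(candidate θs σ) ≤ |θs i| + if i ∈ supp θs then (σ : ℝ) else 0 := by
    intro i
    rw [candidate, integral_comp_eval (f := fun x : ℝ => |x|)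
      (μ := fun i => gaussianReal (θs i) (if i ∈ supp θs then σ ^ 2 else 0)) (by fun_prop)]
    by_cases hi : i ∈ supp θs
    · simp only [hi, if_true]
      have hL : Integrable (fun x : ℝ => x) (gaussianReal (θs i) (σ ^ 2)) :=
        (memLp_id_gaussianReal' 1 (by simp)).integrable le_rfl
      have hLs : Integrable (fun x : ℝ => |x - θs i|) (gaussianReal (θs i) (σ ^ 2)) :=
        (hL.sub (integrable_const _)).abs
      calc ∫ x, |x| ∂(gaussianReal (θs i) (σ ^ 2))
          ≤ ∫ x, (|θs i| + |x - θs i|) ∂(gaussianReal (θs i) (σ ^ 2)) := by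
            refine integral_mono hL.abs ((integrable_const _).add hLs) fun x => ?_
            have := abs_add_le (θs i) (x - θs i)
            simpa using this
        _ ≤ _ := by
            rw [integral_add (integrable_const _) hLs]
            simpa using integral_abs_sub_gaussianReal_le (θs i) σ
    · have h0 : θs i = 0 := by simpa [mem_supp] using hi
      simp [hi, h0, gaussianReal_zero_var]
  refine (Finset.sum_le_sum fun i _ => h i).trans_eq ?_
  rw [Finset.sum_add_distrib, Finset.sum_ite_mem, Finset.univ_inter, Finset.sum_const, nsmul_eq_mul]

theorem memLp_mulVec_candidate {n p : ℕ} (X : Matrix (Fin n) (Fin p) ℝ) (θs : Fin p → ℝ) (σ : ℝ≥0)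
    (j : Fin n) : MemLp (fun θ : Fin p → ℝ => X.mulVec θ j) 2 (candidate θs σ) := by
  simp only [Matrix.mulVec, dotProduct]
  exact memLp_finsetSum _ fun i _ => (memLp_candidate_coord θs σ i).const_mul _

theorem integrable_residual_candidate {n p : ℕ} (X : Matrix (Fin n) (Fin p) ℝ) (y : Fin n → ℝ)
    (θs : Fin p → ℝ) (σ : ℝ≥0) :
    Integrable (fun θ => l2 (y - X.mulVec θ) ^ 2) (candidate θs σ) := by
  simp_rw [l2_sq, dotProduct, ← sq]
  refine integrable_finsetSum _ fun j _ => MemLp.integrable_sq ?_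
  exact (memLp_const (y j)).sub (memLp_mulVec_candidate X θs σ j)

theorem integral_residual_candidate_le {n p : ℕ} (X : Matrix (Fin n) (Fin p) ℝ) (y : Fin n → ℝ)
    (θs : Fin p → ℝ) (σ : ℝ≥0) :
    ∫ θ, l2 (y - X.mulVec θ) ^ 2 ∂(candidate θs σ)
      ≤ l2 (y - X.mulVec θs) ^ 2 + (supp θs).card * (σ * colNorm X) ^ 2 := by
  have hrow : ∀ j, MemLp (fun θ : Fin p → ℝ => X.mulVec θ j) 2 (candidate θs σ) := fun j =>
    memLp_mulVec_candidate X θs σ j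
  have hmean : ∀ j, ∫ θ, X.mulVec θ j ∂(candidate θs σ) = X.mulVec θs j := fun j => by
    simp only [Matrix.mulVec, dotProduct]
    rw [integral_finsetSum _ fun i _ =>
      ((memLp_candidate_coord θs σ i).integrable (by norm_num)).const_mul _]
    exact Finset.sum_congr rfl fun i _ => by rw [integral_const_mul, integral_candidate_coord]
  have hvar : ∀ j, Var[fun θ : Fin p → ℝ => X.mulVec θ j; candidate θs σ]
      = ∑ i ∈ supp θs, X j i ^ 2 * (σ : ℝ) ^ 2 := fun j => by
    have h1 : (fun θ : Fin p → ℝ => X.mulVec θ j)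
        = ∑ i, fun θ : Fin p → ℝ => (fun x : ℝ => X j i * x) (θ i) := by
      funext θ; simp [Matrix.mulVec, dotProduct]
    rw [h1, candidate, variance_sum_pi (X := fun i x => X j i * x)
      fun i => (memLp_id_gaussianReal' 2 (by simp)).const_mul _]
    rw [← Finset.sum_subset (Finset.subset_univ (supp θs))]
    · refine Finset.sum_congr rfl fun i hi => ?_
      rw [variance_const_mul, variance_fun_id_gaussianReal, if_pos hi]
      push_cast
      rfl
    · intro i _ hi
      rw [variance_const_mul, variance_fun_id_gaussianReal, if_neg hi]
      simp
  have hsq : ∀ j, ∫ θ, (y j - X.mulVec θ j) ^ 2 ∂(candidate θs σ)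
      = (y j - X.mulVec θs j) ^ 2 + ∑ i ∈ supp θs, X j i ^ 2 * (σ : ℝ) ^ 2 := fun j => by
    have hL : MemLp (fun θ : Fin p → ℝ => y j - X.mulVec θ j) 2 (candidate θs σ) :=
      (memLp_const (y j)).sub (hrow j)
    have h1 := variance_eq_sub hL
    rw [variance_const_sub (hrow j).aestronglyMeasurable, hvar j,
      integral_sub (integrable_const _) ((hrow j).integrable (by norm_num)), hmean j] at h1
    simp only [integral_const, probReal_univ, smul_eq_mul, one_mul] at h1
    have h2 : ∫ θ, ((fun θ : Fin p → ℝ => y j - X.mulVec θ j) ^ 2) θ ∂(candidate θs σ)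
      = ∫ θ, (y j - X.mulVec θ j) ^ 2 ∂(candidate θs σ) := rfl
    rw [h2] at h1
    linarith
  have hexp : ∀ θ : Fin p → ℝ, l2 (y - X.mulVec θ) ^ 2 = ∑ j, (y j - X.mulVec θ j) ^ 2 := fun θ => by
    rw [l2_sq, dotProduct]
    exact Finset.sum_congr rfl fun j _ => by rw [← sq]; rfl
  have hint : ∀ j, Integrable (fun θ : Fin p → ℝ => (y j - X.mulVec θ j) ^ 2) (candidate θs σ) :=
    fun j => ((memLp_const (y j)).sub (hrow j)).integrable_sq
  simp_rw [hexp]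
  rw [integral_finsetSum _ fun j _ => hint j]
  simp_rw [hsq]
  rw [Finset.sum_add_distrib, Finset.sum_comm]
  gcongr
  rw [← nsmul_eq_mul]
  refine Finset.sum_le_card_nsmul _ _ _ fun i _ => ?_
  rw [← Finset.sum_mul, mul_pow, mul_comm]
  gcongr
  have h := pow_le_pow_left₀ (l2_nonneg _) (l2_col_le_colNorm X i) 2
  rw [l2_sq, dotProduct] at h
  simpa [sq] using h

end SparseVB

namespace SparseVB

open InformationTheory

/-- An upper bound for the negative evidence lower bound of the Gaussian candidate centred at `θs`
with standard deviation `1 / ‖X‖`. -/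
noncomputable def candidateCost (A₃ : ℝ) {n p : ℕ} (X : Matrix (Fin n) (Fin p) ℝ) (lam : ℝ)
    (θs : Fin p → ℝ) (y : Fin n → ℝ) : ℝ :=
  l2 (y - X.mulVec θs) ^ 2 / 2 + lam * l1 θs + (A₃ + 9) * ((supp θs).card * Real.log p)

namespace LargeSetting

variable {A₁ A₂ A₃ A₄ : ℝ} {n p : ℕ} {X : Matrix (Fin n) (Fin p) ℝ} {w : ℕ → ℝ} {lam : ℝ}

/-- The evidence is bounded below, and the divergence of the candidate from the posterior is bounded
above, in terms of the same cost. -/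
theorem exp_neg_cost_le_evidence_and_klDiv_le (h : LargeSetting A₁ A₂ A₃ A₄ X w lam)
    {θs : Fin p → ℝ} (hs : 1 ≤ (supp θs).card) {σ : ℝ≥0} (hσ : (σ : ℝ) = 1 / colNorm X)
    (y : Fin n → ℝ) :
    ENNReal.ofReal (Real.exp (-candidateCost A₃ X lam θs y)) ≤ evidence X w lam y ∧
      klDiv (candidate θs σ) (modelPosterior X w lam y)
        ≤ ENNReal.ofReal
          (Real.log (evidence X w lam y).toReal + candidateCost A₃ X lam θs y) := by
  have hX := h.colNorm_pos
  have hp := h.three_le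
  have hlam := h.lam_pos
  have hlog := h.one_le_log
  have hprob := h.isProbabilityMeasure_posterior y
  have hσ0 : 0 < σ := by
    have : (0 : ℝ) < σ := by rw [hσ]; positivity
    exact_mod_cast this
  have hσX : (σ : ℝ) * colNorm X = 1 := by rw [hσ]; field_simp
  have hcard : (supp θs).card ≤ p := by simpa using Finset.card_le_univ (supp θs)
  obtain ⟨hc, hlogc⟩ := h.prior.neg_log_weight_le h.A₁_pos h.A₂_pos h.A₄_pos (by omega)
    h.upper_large h.lower_large hs hcard
  set s : ℝ := ((supp θs).card : ℝ) with hsdef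
  have hs1 : 1 ≤ s := by rw [hsdef]; exact_mod_cast hs
  set c : ℝ := w (supp θs).card / (p.choose (supp θs).card : ℝ) with hcdef
  set E : ℝ := (evidence X w lam y).toReal with hEdef
  have hE : 0 < E := ENNReal.toReal_pos (h.evidence_ne_zero y) (h.evidence_ne_top y)
  have hEE : ENNReal.ofReal E = evidence X w lam y := ENNReal.ofReal_toReal (h.evidence_ne_top y)
  set f : (Fin p → ℝ) → ℝ := fun θ =>
    Real.log E - Real.log c + s * Real.log p + (l2 (y - X.mulVec θ) ^ 2 / 2 + lam * l1 θ) with hf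
  have hres : Measurable fun θ : Fin p → ℝ => l2 (y - X.mulVec θ) :=
    (continuous_l2.comp
      (continuous_const.sub (continuous_const.matrix_mulVec continuous_id))).measurable
  have hl1 := measurable_l1 (d := p)
  have hfm : Measurable f := by fun_prop
  have hi1 := (integrable_residual_candidate X y θs σ).div_const 2
  have hi2 := (integrable_l1_candidate θs σ).const_mul lam
  have hfi : Integrable f (candidate θs σ) := (integrable_const _).add (hi1.add hi2)
  -- The mean of `f` is at most the logarithm of the evidence plus the cost.
  have hmean : ∫ θ, f θ ∂(candidate θs σ) ≤ Real.log E + candidateCost A₃ X lam θs y := by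
    have e1 : ∫ θ, f θ ∂(candidate θs σ) = Real.log E - Real.log c + s * Real.log p
        + ((∫ θ, l2 (y - X.mulVec θ) ^ 2 ∂(candidate θs σ)) / 2
          + lam * ∫ θ, l1 θ ∂(candidate θs σ)) := by
      have h12 : Integrable (fun θ => l2 (y - X.mulVec θ) ^ 2 / 2 + lam * l1 θ)
        (candidate θs σ) := hi1.add hi2
      rw [hf, integral_add (integrable_const _) h12, integral_add hi1 hi2, integral_div,
        integral_const_mul]
      simp
    have e2 := integral_residual_candidate_le X y θs σ
    have e3 := mul_le_mul_of_nonneg_left (integral_l1_candidate_le θs σ) hlam.le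
    rw [hσX, ← hsdef] at e2
    have e4 : lam * σ ≤ 4 * Real.log p := by
      have h1 := mul_le_mul_of_nonneg_right h.lam_le (show (0 : ℝ) ≤ σ from σ.2)
      have h2 : 2 * lamBar X * σ = 4 * √(Real.log p) := by
        rw [lamBar]
        linear_combination (4 * √(Real.log p)) * hσX
      have h3 : √(Real.log p) ≤ Real.log p := by
        rw [Real.sqrt_le_left (by linarith)]
        nlinarith
      linarith
    have e5 : lam * (s * σ) ≤ 4 * (s * Real.log p) := by nlinarith
    have e6 : s ≤ s * Real.log p := by nlinarith
    rw [e1, candidateCost, ← hsdef]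
    rw [← hsdef, mul_add] at e3
    linarith
  have hdom : (candidate θs σ).withDensity (fun θ => ENNReal.ofReal (Real.exp (-f θ)))
      ≤ modelPosterior X w lam y := by
    have hlow : 1 ≤ lam * σ * p := by
      have h1 := h.le_lam
      rw [div_le_iff₀ h.p_pos] at h1
      rw [hσ]
      field_simp
      linarith
    have h1 := candidate_withDensity_le_slab hlam (by omega) θs hσ0 hlow
    have hm1 : Measurable fun θ : Fin p → ℝ => ENNReal.ofReal
        (Real.exp (-(s * Real.log p + lam * l1 θ))) := by fun_prop
    have hm2 := measurable_likelihood_right X y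
    have e1 : (fun θ => ENNReal.ofReal (Real.exp (-f θ)))
        = (fun θ => ENNReal.ofReal (Real.exp (-(s * Real.log p + lam * l1 θ))))
          * (fun θ => ENNReal.ofReal (E⁻¹ * c) * likelihood X y θ) := by
      funext θ
      rw [Pi.mul_apply, likelihood, ← ENNReal.ofReal_mul (by positivity),
        ← ENNReal.ofReal_mul (by positivity)]
      congr 1
      have e2 : E⁻¹ * c = Real.exp (-Real.log E + Real.log c) := by
        rw [Real.exp_add, Real.exp_neg, Real.exp_log hE, Real.exp_log hc]
      rw [e2, ← Real.exp_add, ← Real.exp_add, hf]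
      ring_nf
    rw [e1, withDensity_mul _ hm1 (by fun_prop)]
    refine (withDensity_le_withDensity h1 _).trans ?_
    have e3 : (fun θ => ENNReal.ofReal (E⁻¹ * c) * likelihood X y θ)
        = ENNReal.ofReal (E⁻¹ * c) • likelihood X y := rfl
    rw [e3, withDensity_smul _ hm2, ENNReal.ofReal_mul (by positivity),
      ENNReal.ofReal_inv_of_pos hE, hEE, mul_smul, modelPosterior]
    have h2 := withDensity_le_withDensity (smul_slab_le_modelPrior w lam (supp θs)) (likelihood X y)
    rw [withDensity_smul_measure] at h2
    exact smul_le_smul_left _ h2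
  obtain ⟨hnn, hkl⟩ := klDiv_le_of_withDensity_le hfm hfi hdom
  refine ⟨?_, hkl.trans (ENNReal.ofReal_le_ofReal hmean)⟩
  rw [← hEE]
  refine ENNReal.ofReal_le_ofReal ?_
  rw [← Real.le_log_iff_exp_le hE]
  linarith

end LargeSetting

end SparseVB

namespace SparseVB

open scoped Matrix

/-! ### Expected likelihood ratios on the noise event -/

/-- The likelihood ratio `exp (‖y - X θ₀‖² / 2 - ‖y - X θ‖² / 2)`. -/
noncomputable def likRatio {n p : ℕ} (X : Matrix (Fin n) (Fin p) ℝ) (θ₀ : Fin p → ℝ)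
    (y : Fin n → ℝ) (θ : Fin p → ℝ) : ℝ≥0∞ :=
  ENNReal.ofReal (Real.exp (l2 (y - X.mulVec θ₀) ^ 2 / 2 - l2 (y - X.mulVec θ) ^ 2 / 2))

/-- The integrand of `lintegral_slab_tilt_le`. -/
noncomputable def tilt {p : ℕ} (lam : ℝ) (θs θ : Fin p → ℝ) : ℝ≥0∞ :=
  ENNReal.ofReal (Real.exp (lam * l1 θ - lam / 4 * l1 (θ - θs)))

theorem measurable_tilt {p : ℕ} (lam : ℝ) (θs : Fin p → ℝ) : Measurable (tilt lam θs) := by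
  have := measurable_l1 (d := p)
  have := measurable_l1_sub θs
  unfold tilt
  fun_prop

theorem measurable_likRatio {n p : ℕ} (X : Matrix (Fin n) (Fin p) ℝ) (θ₀ : Fin p → ℝ) :
    Measurable fun q : (Fin n → ℝ) × (Fin p → ℝ) => likRatio X θ₀ q.1 q.2 := by
  have h1 := measurable_residual X
  have h2 : Measurable fun q : (Fin n → ℝ) × (Fin p → ℝ) => l2 (q.1 - X.mulVec θ₀) :=
    (continuous_l2.comp (continuous_fst.sub continuous_const)).measurable
  unfold likRatio
  fun_prop

theorem measurable_likRatio_left {n p : ℕ} (X : Matrix (Fin n) (Fin p) ℝ) (θ₀ θ : Fin p → ℝ) :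
    Measurable fun y : Fin n → ℝ => likRatio X θ₀ y θ := by
  have h : ∀ m : Fin n → ℝ, Measurable fun y : Fin n → ℝ => l2 (y - m) := fun m =>
    (continuous_l2.comp (continuous_id.sub continuous_const)).measurable
  have h1 := h (X.mulVec θ₀)
  have h2 := h (X.mulVec θ)
  unfold likRatio
  fun_prop

theorem half_sq_sub_half_sq {n : ℕ} (z d : Fin n → ℝ) :
    l2 z ^ 2 / 2 - l2 (z - d) ^ 2 / 2 = z ⬝ᵥ d - d ⬝ᵥ d / 2 := by
  rw [l2_sq, l2_sq, sub_dotProduct, dotProduct_sub, dotProduct_sub, dotProduct_comm d z]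
  ring

theorem dotProduct_self_nonneg' {n : ℕ} (x : Fin n → ℝ) : 0 ≤ x ⬝ᵥ x := by
  rw [← l2_sq]; positivity

theorem exponent_eq {n p : ℕ} (X : Matrix (Fin n) (Fin p) ℝ) (θ₀ θs θ : Fin p → ℝ)
    (y : Fin n → ℝ) :
    l2 (y - X.mulVec θ₀) ^ 2 / 2 - l2 (y - X.mulVec θ) ^ 2 / 2
      = (y - X.mulVec θ₀) ⬝ᵥ (X.mulVec (θ - θs) - X.mulVec (θ₀ - θs))
        - (X.mulVec (θ - θs) - X.mulVec (θ₀ - θs)) ⬝ᵥ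
          (X.mulVec (θ - θs) - X.mulVec (θ₀ - θs)) / 2 := by
  rw [← half_sq_sub_half_sq]
  congr 4
  rw [Matrix.mulVec_sub, Matrix.mulVec_sub]
  abel

/-- A fraction `a = λ / (2 λ̄)` of the noise term is controlled on the noise event by the prior; the
rest is integrated exactly and leaves a negative multiple of `‖X (θ - θs)‖²`. -/
theorem setLIntegral_likRatio_le {n p : ℕ} (X : Matrix (Fin n) (Fin p) ℝ) (θ₀ θs θ : Fin p → ℝ)
    {a : ℝ} (ha0 : 0 ≤ a) (ha1 : a ≤ 1) :
    ∫⁻ y in noiseEvent X θ₀, likRatio X θ₀ y θ ∂(dataLaw X θ₀)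
      ≤ ENNReal.ofReal (Real.exp (a * (lamBar X * l1 (θ - θs))
        - a / 4 * l2 (X.mulVec (θ - θs)) ^ 2 + a * l2 (X.mulVec (θ₀ - θs)) ^ 2)) := by
  set u := X.mulVec (θ - θs) with hu
  set v := X.mulVec (θ₀ - θs) with hv
  set b : Fin n → ℝ := (1 - a) • u - v with hb
  set r : ℝ := a * (lamBar X * l1 (θ - θs)) - (u - v) ⬝ᵥ (u - v) / 2 with hr
  have hpt : ∀ y ∈ noiseEvent X θ₀, likRatio X θ₀ y θ
      ≤ ENNReal.ofReal (Real.exp r) * ENNReal.ofReal (Real.exp (b ⬝ᵥ (y - X.mulVec θ₀))) := by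
    intro y hy
    rw [← ENNReal.ofReal_mul (Real.exp_pos _).le, ← Real.exp_add, likRatio,
      exponent_eq X θ₀ θs θ y]
    refine ENNReal.ofReal_le_ofReal (Real.exp_le_exp.2 ?_)
    rw [← hu, ← hv]
    have h1 := mul_le_mul_of_nonneg_left
      (dotProduct_mulVec_le_of_mem_noiseEvent hy (θ - θs)) ha0
    rw [← hu] at h1
    have h2 : (y - X.mulVec θ₀) ⬝ᵥ (u - v)
        = a * ((y - X.mulVec θ₀) ⬝ᵥ u) + b ⬝ᵥ (y - X.mulVec θ₀) := by
      rw [hb, sub_dotProduct _ v, smul_dotProduct, dotProduct_sub, dotProduct_comm u,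
        dotProduct_comm v, smul_eq_mul]
      ring
    rw [h2, hr]
    linarith
  have hm : Measurable fun y : Fin n → ℝ => ENNReal.ofReal (Real.exp (b ⬝ᵥ (y - X.mulVec θ₀))) :=
    ENNReal.measurable_ofReal.comp (Real.measurable_exp.comp (measurable_dotProduct_sub _ _))
  calc _ ≤ ∫⁻ y in noiseEvent X θ₀, ENNReal.ofReal (Real.exp r)
        * ENNReal.ofReal (Real.exp (b ⬝ᵥ (y - X.mulVec θ₀))) ∂(dataLaw X θ₀) :=
        setLIntegral_mono (hm.const_mul _) hpt
    _ ≤ ∫⁻ y, ENNReal.ofReal (Real.exp r)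
        * ENNReal.ofReal (Real.exp (b ⬝ᵥ (y - X.mulVec θ₀))) ∂(dataLaw X θ₀) :=
        setLIntegral_le_lintegral _ _
    _ = ENNReal.ofReal (Real.exp (r + b ⬝ᵥ b / 2)) := by
        rw [lintegral_const_mul _ hm, lintegral_exp_dotProduct_dataLaw,
          ← ENNReal.ofReal_mul (Real.exp_pos _).le, ← Real.exp_add]
    _ ≤ _ := by
        refine ENNReal.ofReal_le_ofReal (Real.exp_le_exp.2 ?_)
        have h1 : b ⬝ᵥ b = (1 - a) ^ 2 * (u ⬝ᵥ u) - 2 * (1 - a) * (u ⬝ᵥ v) + v ⬝ᵥ v := by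
          rw [hb]
          simp only [sub_dotProduct, dotProduct_sub, smul_dotProduct, dotProduct_smul, smul_eq_mul,
            dotProduct_comm v u]
          ring
        have h2 : (u - v) ⬝ᵥ (u - v) = u ⬝ᵥ u - 2 * (u ⬝ᵥ v) + v ⬝ᵥ v := by
          simp only [sub_dotProduct, dotProduct_sub, dotProduct_comm v u]
          ring
        have h3 : u ⬝ᵥ v ≤ (u ⬝ᵥ u) / 4 + v ⬝ᵥ v := by
          have := dotProduct_self_nonneg' ((1 / 2 : ℝ) • u - v)
          simp only [sub_dotProduct, dotProduct_sub, smul_dotProduct, dotProduct_smul, smul_eq_mul,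
            dotProduct_comm v u] at this
          linarith
        have h4 := mul_le_mul_of_nonneg_left h3 ha0
        have h5 : 0 ≤ a * (1 - a) * (u ⬝ᵥ u) :=
          mul_nonneg (mul_nonneg ha0 (by linarith)) (dotProduct_self_nonneg' u)
        rw [hr, h1, h2, l2_sq, l2_sq]
        nlinarith

/-- The compatibility inequality, on the cone where the part off `S` is at most seven times the part
on `S`. -/
theorem compat_mul_sum_le {n p : ℕ} {X : Matrix (Fin n) (Fin p) ℝ} (hX : 0 < colNorm X)
    {S : Finset (Fin p)} {φ : ℝ} (hφ : ENNReal.ofReal φ ≤ compat X S) {h : Fin p → ℝ}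
    (hcone : ∑ i ∈ Sᶜ, |h i| ≤ 7 * ∑ i ∈ S, |h i|) :
    φ * colNorm X * ∑ i ∈ S, |h i| ≤ l2 (X.mulVec h) * √(S.card : ℝ) := by
  have hnn : 0 ≤ l2 (X.mulVec h) * √(S.card : ℝ) := mul_nonneg (l2_nonneg _) (Real.sqrt_nonneg _)
  by_cases hne : ∃ i ∈ S, h i ≠ 0
  · obtain ⟨i, hi, hi0⟩ := hne
    have hpos : 0 < ∑ i ∈ S, |h i| :=
      Finset.sum_pos' (fun _ _ => abs_nonneg _) ⟨i, hi, abs_pos.2 hi0⟩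
    have h1 : ENNReal.ofReal φ ≤ _ := hφ.trans (iInf₂_le h ⟨⟨i, hi, hi0⟩, hcone⟩)
    rw [ENNReal.ofReal_le_ofReal_iff (by positivity), le_div_iff₀ (by positivity)] at h1
    linarith
  · push Not at hne
    rw [Finset.sum_eq_zero fun i hi => by simp [hne i hi]]
    simpa using hnn

/-- The cone condition with constant `7` in `compat` is exactly what makes the `ℓ₁` terms negative
outside the cone. -/
theorem l1_exponent_le {n p : ℕ} {X : Matrix (Fin n) (Fin p) ℝ} (hX : 0 < colNorm X)
    {lam : ℝ} (hlam : 0 < lam) (hlam' : lam ≤ 2 * lamBar X) (hp : 1 ≤ p) {θs : Fin p → ℝ} {φ : ℝ}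
    (hφ0 : 0 < φ) (hφ : ENNReal.ofReal φ ≤ compat X (supp θs)) (θ : Fin p → ℝ) :
    lam * l1 θs - lam * l1 θ + lam / 2 * l1 (θ - θs)
        - lam / (2 * lamBar X) / 4 * l2 (X.mulVec (θ - θs)) ^ 2
      ≤ 49 * ((supp θs).card * Real.log p / φ ^ 2) - lam / 4 * l1 (θ - θs) := by
  set S := supp θs with hS
  have hlog : 0 ≤ Real.log p := Real.log_nonneg (by exact_mod_cast hp)
  have hbar : 0 < lamBar X := by linarith
  set x := ∑ i ∈ S, |(θ - θs) i| with hx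
  set z := ∑ i ∈ Sᶜ, |(θ - θs) i| with hz
  have hsum : l1 (θ - θs) = x + z := (Finset.sum_add_sum_compl S _).symm
  have hx0 : 0 ≤ x := Finset.sum_nonneg fun _ _ => abs_nonneg _
  have hz0 : 0 ≤ z := Finset.sum_nonneg fun _ _ => abs_nonneg _
  have hdiff : l1 θs - l1 θ ≤ x - z := by
    have e1 : l1 θs = ∑ i ∈ S, |θs i| := l1_eq_sum_supp θs
    have e2 : l1 θ = ∑ i ∈ S, |θ i| + ∑ i ∈ Sᶜ, |θ i| := (Finset.sum_add_sum_compl S _).symm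
    have e3 : z = ∑ i ∈ Sᶜ, |θ i| := by
      refine Finset.sum_congr rfl fun i hi => ?_
      have : θs i = 0 := by simpa [hS, mem_supp] using hi
      simp [this]
    have e4 : ∑ i ∈ S, |θs i| ≤ ∑ i ∈ S, |θ i| + x := by
      rw [hx, ← Finset.sum_add_distrib]
      refine Finset.sum_le_sum fun i _ => ?_
      have := abs_sub_abs_le_abs_sub (θs i) (θ i)
      rw [abs_sub_comm] at this
      simp only [Pi.sub_apply]
      linarith
    linarith
  have hU := sq_nonneg (l2 (X.mulVec (θ - θs)))
  set U := l2 (X.mulVec (θ - θs)) with hUdef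
  have hdiff' := mul_le_mul_of_nonneg_left hdiff hlam.le
  have hrhs : 0 ≤ 49 * ((S.card : ℝ) * Real.log p / φ ^ 2) := by positivity
  rw [hsum]
  by_cases hcone : z ≤ 7 * x
  · have hc := compat_mul_sum_le hX hφ hcone
    rw [← hx, ← hUdef] at hc
    -- Young's inequality; the factor `λ / λ̄ ≤ 2` is absorbed into the constant `49`.
    have hkey : 7 / 4 * (lam * x) ≤ lam / (2 * lamBar X) / 4 * U ^ 2
        + 49 * ((S.card : ℝ) * Real.log p / φ ^ 2) := by
      set q := √(S.card : ℝ) with hq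
      set l := √(Real.log p) with hl
      have hq2 : q ^ 2 = S.card := Real.sq_sqrt (Nat.cast_nonneg _)
      have hl2 : l ^ 2 = Real.log p := Real.sq_sqrt hlog
      have hlb : lamBar X = 2 * colNorm X * l := rfl
      have hl0 : 0 < l := by
        rw [hlb] at hbar
        exact (mul_pos_iff_of_pos_left (by positivity)).1 hbar
      have hxle : x ≤ U * q / (φ * colNorm X) := by
        rw [le_div_iff₀ (by positivity)]; linarith
      have h1 : 7 / 4 * (lam * x) ≤ 7 / 4 * (lam * (U * q / (φ * colNorm X))) := by gcongr
      have h2 : 49 * ((S.card : ℝ) * Real.log p / φ ^ 2) = 49 * (q * l / φ) ^ 2 := by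
        rw [← hq2, ← hl2]; ring
      rw [h2]
      refine h1.trans ?_
      set m := q * l / φ with hm
      have hm0 : 0 ≤ m := by positivity
      have h3 : U * q / (φ * colNorm X) = U * m / (colNorm X * l) := by
        rw [hm]; field_simp
      set a := lam / (2 * lamBar X) with ha
      have ha0 : 0 ≤ a := by positivity
      have ha1 : a ≤ 1 := by rw [ha, div_le_one (by positivity)]; exact hlam'
      have h4 : lam * (U * m / (colNorm X * l)) = 4 * a * (U * m) := by
        rw [ha, hlb]; field_simp; norm_num
      rw [h3, h4]
      have h5 : 0 ≤ a * (U / 2 - 7 * m) ^ 2 := by positivity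
      have h6 : a * m ^ 2 ≤ m ^ 2 := by nlinarith [sq_nonneg m]
      nlinarith
    nlinarith
  · push Not at hcone
    have h1 : 0 ≤ lam * (z - 7 * x) := mul_nonneg hlam.le (by linarith)
    have h2 : 0 ≤ lam / (2 * lamBar X) / 4 * U ^ 2 := by positivity
    nlinarith

namespace LargeSetting

variable {A₁ A₂ A₃ A₄ : ℝ} {n p : ℕ} {X : Matrix (Fin n) (Fin p) ℝ} {w : ℕ → ℝ} {lam : ℝ}

theorem setLIntegral_likRatio_mul_le (h : LargeSetting A₁ A₂ A₃ A₄ X w lam) {θ₀ θs : Fin p → ℝ}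
    {φ : ℝ} (hφ0 : 0 < φ) (hφ : ENNReal.ofReal φ ≤ compat X (supp θs)) (θ : Fin p → ℝ) :
    (∫⁻ y in noiseEvent X θ₀, likRatio X θ₀ y θ ∂(dataLaw X θ₀))
        * ENNReal.ofReal (Real.exp (lam * l1 θs))
      ≤ ENNReal.ofReal (Real.exp (49 * ((supp θs).card * Real.log p / φ ^ 2)
          + l2 (X.mulVec (θ₀ - θs)) ^ 2)) * tilt lam θs θ := by
  have hbar := h.lamBar_pos
  have hlam := h.lam_pos
  have ha0 : 0 ≤ lam / (2 * lamBar X) := by positivity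
  have ha1 : lam / (2 * lamBar X) ≤ 1 := by rw [div_le_one (by positivity)]; exact h.lam_le
  have h1 := l1_exponent_le h.colNorm_pos hlam h.lam_le (by have := h.three_le; omega) hφ0 hφ θ
  refine (mul_le_mul_left (setLIntegral_likRatio_le X θ₀ θs θ ha0 ha1) _).trans ?_
  rw [tilt, ← ENNReal.ofReal_mul (Real.exp_pos _).le, ← ENNReal.ofReal_mul (Real.exp_pos _).le,
    ← Real.exp_add, ← Real.exp_add]
  refine ENNReal.ofReal_le_ofReal (Real.exp_le_exp.2 ?_)
  have h2 : lam / (2 * lamBar X) * (lamBar X * l1 (θ - θs)) = lam / 2 * l1 (θ - θs) := by field_simp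
  have h3 : lam / (2 * lamBar X) * l2 (X.mulVec (θ₀ - θs)) ^ 2 ≤ l2 (X.mulVec (θ₀ - θs)) ^ 2 :=
    mul_le_of_le_one_left (sq_nonneg _) ha1
  rw [h2]
  linarith

/-- Integration of likelihood ratios over data and prior, given a bound for each parameter by the
tilt. -/
theorem lintegral_likRatio_le (h : LargeSetting A₁ A₂ A₃ A₄ X w lam) {θ₀ θs : Fin p → ℝ}
    {A : Set (Fin n → ℝ)} {B : Set (Fin p → ℝ)} (hBm : MeasurableSet B) {H t : ℝ}
    (hBt : ∀ θ ∈ B, t ≤ ((supp θ).card : ℝ))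
    (hB : ∀ θ ∈ B, (∫⁻ y in A, likRatio X θ₀ y θ ∂(dataLaw X θ₀))
        * ENNReal.ofReal (Real.exp (lam * l1 θs)) ≤ ENNReal.ofReal (Real.exp (-H)) * tilt lam θs θ) :
    (∫⁻ y in A, ∫⁻ θ in B, likRatio X θ₀ y θ ∂(modelPrior p w lam) ∂(dataLaw X θ₀))
        * ENNReal.ofReal (Real.exp (lam * l1 θs))
      ≤ ENNReal.ofReal (2 * Real.exp (-H - A₄ / 2 * Real.log p * t)) := by
  have := isFiniteMeasure_modelPrior (p := p) w h.lam_pos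
  have hm := measurable_likRatio X θ₀
  rw [lintegral_lintegral_swap hm.aemeasurable]
  have hm2 : Measurable fun θ => ∫⁻ y in A, likRatio X θ₀ y θ ∂(dataLaw X θ₀) :=
    Measurable.lintegral_prod_left' hm
  rw [← lintegral_mul_const _ hm2]
  calc _ ≤ ∫⁻ θ in B, ENNReal.ofReal (Real.exp (-H)) * tilt lam θs θ ∂(modelPrior p w lam) :=
        setLIntegral_mono' hBm hB
    _ = ENNReal.ofReal (Real.exp (-H)) * ∫⁻ θ in B, tilt lam θs θ ∂(modelPrior p w lam) :=
        lintegral_const_mul _ (measurable_tilt lam θs)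
    _ ≤ ENNReal.ofReal (Real.exp (-H))
          * ENNReal.ofReal (2 * Real.exp (-(A₄ / 2 * Real.log p * t))) := by
        gcongr
        exact (lintegral_mono_set hBt).trans (h.prior.setLIntegral_tilt_le h.A₂_pos h.A₄_pos
          (by have := h.three_le; omega) h.upper_large h.lam_pos θs t)
    _ = _ := by
        rw [← ENNReal.ofReal_mul (Real.exp_pos _).le, mul_left_comm, ← Real.exp_add]
        rfl

end LargeSetting

end SparseVB

namespace SparseVB

open InformationTheory

open scoped Matrix

/-! ### The mass that a variational posterior gives to a set -/

/-- The noise event, intersected with a bound for the noise in the direction `X (θ₀ - θs)`. -/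
def goodNoise {n p : ℕ} (X : Matrix (Fin n) (Fin p) ℝ) (θ₀ θs : Fin p → ℝ) : Set (Fin n → ℝ) :=
  noiseEvent X θ₀ ∩ {y | |X.mulVec (θ₀ - θs) ⬝ᵥ (y - X.mulVec θ₀)|
    ≤ l2 (X.mulVec (θ₀ - θs)) ^ 2 / 2 + Real.log p}

theorem measurableSet_goodNoise {n p : ℕ} (X : Matrix (Fin n) (Fin p) ℝ) (θ₀ θs : Fin p → ℝ) :
    MeasurableSet (goodNoise X θ₀ θs) :=
  (measurableSet_noiseEvent X θ₀).inter
    (measurableSet_le (measurable_dotProduct_sub _ _).abs measurable_const)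

/-- The event that the evidence, normalized by the likelihood of `θ₀`, is at most
`e^{51 E - λ ‖θs‖₁}`. -/
def smallEvidence {n p : ℕ} (X : Matrix (Fin n) (Fin p) ℝ) (w : ℕ → ℝ) (lam : ℝ)
    (θ₀ θs : Fin p → ℝ) (E : ℝ) : Set (Fin n → ℝ) :=
  {y | (∫⁻ θ, likRatio X θ₀ y θ ∂(modelPrior p w lam)) * ENNReal.ofReal (Real.exp (lam * l1 θs))
    ≤ ENNReal.ofReal (Real.exp (51 * E))}

theorem likRatio_eq {n p : ℕ} (X : Matrix (Fin n) (Fin p) ℝ) (θ₀ : Fin p → ℝ)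
    (y : Fin n → ℝ) (θ : Fin p → ℝ) :
    likRatio X θ₀ y θ
      = ENNReal.ofReal (Real.exp (l2 (y - X.mulVec θ₀) ^ 2 / 2)) * likelihood X y θ := by
  rw [likRatio, likelihood, ← ENNReal.ofReal_mul (Real.exp_pos _).le, ← Real.exp_add]
  congr 2
  ring

namespace LargeSetting

variable {A₁ A₂ A₃ A₄ : ℝ} {n p : ℕ} {X : Matrix (Fin n) (Fin p) ℝ} {w : ℕ → ℝ} {lam : ℝ}

theorem measurable_lintegral_likRatio (h : LargeSetting A₁ A₂ A₃ A₄ X w lam) (θ₀ : Fin p → ℝ)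
    (B : Set (Fin p → ℝ)) :
    Measurable fun y => ∫⁻ θ in B, likRatio X θ₀ y θ ∂(modelPrior p w lam) := by
  have := isFiniteMeasure_modelPrior (p := p) w h.lam_pos
  exact Measurable.lintegral_prod_right' (measurable_likRatio X θ₀)

theorem measurableSet_smallEvidence (h : LargeSetting A₁ A₂ A₃ A₄ X w lam) (θ₀ θs : Fin p → ℝ)
    (E : ℝ) : MeasurableSet (smallEvidence X w lam θ₀ θs E) := by
  have h1 := h.measurable_lintegral_likRatio θ₀ Set.univ
  rw [Measure.restrict_univ] at h1
  exact measurableSet_le (h1.mul_const _) measurable_const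

theorem dataLaw_compl_goodNoise_le (h : LargeSetting A₁ A₂ A₃ A₄ X w lam) (θ₀ θs : Fin p → ℝ) :
    dataLaw X θ₀ (goodNoise X θ₀ θs)ᶜ ≤ ENNReal.ofReal (4 / p) := by
  have hp := h.p_pos
  set v := X.mulVec (θ₀ - θs) with hv
  have key : ∀ ε : ℝ, ε * ε = 1 → dataLaw X θ₀ {y | v ⬝ᵥ v / 2 + Real.log p
      < ε * (v ⬝ᵥ (y - X.mulVec θ₀))} ≤ ENNReal.ofReal (1 / p) := fun ε hε => by
    have h1 := dataLaw_lt_dotProduct_le X θ₀ (ε • v) (Real.log p)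
    rw [Real.exp_neg, Real.exp_log hp, ← one_div] at h1
    have h2 : (ε • v) ⬝ᵥ (ε • v) = v ⬝ᵥ v := by
      rw [smul_dotProduct, dotProduct_smul, smul_eq_mul, smul_eq_mul, ← mul_assoc, hε, one_mul]
    simpa only [h2, smul_dotProduct, smul_eq_mul] using h1
  have hsub : (goodNoise X θ₀ θs)ᶜ ⊆ (noiseEvent X θ₀)ᶜ
      ∪ ({y | v ⬝ᵥ v / 2 + Real.log p < 1 * (v ⬝ᵥ (y - X.mulVec θ₀))}
        ∪ {y | v ⬝ᵥ v / 2 + Real.log p < (-1) * (v ⬝ᵥ (y - X.mulVec θ₀))}) := by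
    intro y hy
    rw [goodNoise, Set.compl_inter] at hy
    refine hy.imp id fun h1 => ?_
    rw [Set.mem_compl_iff, Set.mem_ofPred_eq, not_le, lt_abs, ← hv, l2_sq] at h1
    simpa using h1
  calc _ ≤ _ := measure_mono hsub
    _ ≤ ENNReal.ofReal (2 / p) + (ENNReal.ofReal (1 / p) + ENNReal.ofReal (1 / p)) := by
        refine (measure_union_le _ _).trans (add_le_add ?_ ((measure_union_le _ _).trans ?_))
        · exact dataLaw_compl_noiseEvent_le X θ₀ h.colNorm_pos (by have := h.three_le; omega)
        · exact add_le_add (key 1 (by norm_num)) (key (-1) (by norm_num))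
    _ = _ := by
        rw [← ENNReal.ofReal_add (by positivity) (by positivity),
          ← ENNReal.ofReal_add (by positivity) (by positivity)]
        congr 1
        ring

variable {θ₀ θs : Fin p → ℝ} {φ E : ℝ}

theorem dataLaw_diff_smallEvidence_le (h : LargeSetting A₁ A₂ A₃ A₄ X w lam)
    (hφ0 : 0 < φ) (hφ : ENNReal.ofReal φ ≤ compat X (supp θs)) (hElog : Real.log p ≤ E)
    (hE : (supp θs).card * Real.log p / φ ^ 2 + l2 (X.mulVec (θ₀ - θs)) ^ 2 ≤ E) :
    dataLaw X θ₀ (goodNoise X θ₀ θs \ smallEvidence X w lam θ₀ θs E) ≤ ENNReal.ofReal (2 / p) := by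
  have hlog := h.one_le_log
  have hp := h.p_pos
  have hm := (h.measurable_lintegral_likRatio θ₀ Set.univ).mul_const
    (ENNReal.ofReal (Real.exp (lam * l1 θs)))
  have h1 := h.lintegral_likRatio_le (θ₀ := θ₀) (θs := θs) (A := noiseEvent X θ₀)
    (B := Set.univ) (t := 0) MeasurableSet.univ
    (H := -(49 * ((supp θs).card * Real.log p / φ ^ 2) + l2 (X.mulVec (θ₀ - θs)) ^ 2))
    (fun θ _ => Nat.cast_nonneg _)
    (fun θ _ => by rw [neg_neg]; exact h.setLIntegral_likRatio_mul_le hφ0 hφ θ)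
  rw [← lintegral_mul_const _ (h.measurable_lintegral_likRatio θ₀ Set.univ)] at h1
  set g : (Fin n → ℝ) → ℝ≥0∞ := fun y =>
    (∫⁻ θ in Set.univ, likRatio X θ₀ y θ ∂(modelPrior p w lam))
      * ENNReal.ofReal (Real.exp (lam * l1 θs)) with hg
  have h2 := meas_ge_le_lintegral_div (μ := (dataLaw X θ₀).restrict (noiseEvent X θ₀))
    (f := g) hm.aemeasurable (ε := ENNReal.ofReal (Real.exp (51 * E)))
    (by simp [Real.exp_pos]) (by simp)
  have h3 : goodNoise X θ₀ θs \ smallEvidence X w lam θ₀ θs E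
      ⊆ {y | ENNReal.ofReal (Real.exp (51 * E)) ≤ g y} ∩ noiseEvent X θ₀ := by
    rintro y ⟨hy1, hy2⟩
    refine ⟨?_, hy1.1⟩
    simp only [smallEvidence, Set.mem_ofPred_eq, not_le] at hy2
    simp only [hg, Measure.restrict_univ, Set.mem_ofPred_eq]
    exact hy2.le
  refine (measure_mono h3).trans ((Measure.le_restrict_apply _ _).trans (h2.trans ?_))
  rw [ENNReal.div_le_iff (by simp [Real.exp_pos]) (by simp)]
  refine h1.trans ?_
  rw [← ENNReal.ofReal_mul (by positivity)]
  refine ENNReal.ofReal_le_ofReal ?_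
  have h4 : (2 : ℝ) / p = 2 * Real.exp (-Real.log p) := by
    rw [Real.exp_neg, Real.exp_log hp]; rfl
  rw [h4, mul_assoc 2 (Real.exp _), ← Real.exp_add]
  gcongr
  have h5 := sq_nonneg (l2 (X.mulVec (θ₀ - θs)))
  linarith

theorem cost_le (h : LargeSetting A₁ A₂ A₃ A₄ X w lam) (hs : 1 ≤ (supp θs).card)
    (hE : (supp θs).card * Real.log p + l2 (X.mulVec (θ₀ - θs)) ^ 2 ≤ E)
    {y : Fin n → ℝ} (hy : y ∈ goodNoise X θ₀ θs) :
    candidateCost A₃ X lam θs y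
      ≤ l2 (y - X.mulVec θ₀) ^ 2 / 2 + lam * l1 θs + (A₃ + 10) * E := by
  have hlog := h.one_le_log
  have hA := h.A₃_pos
  have hs1 : (1 : ℝ) ≤ (supp θs).card := by exact_mod_cast hs
  have hy1 := hy.2
  rw [Set.mem_ofPred_eq, abs_le] at hy1
  have hy2 := hy1.2
  have h1 : l2 (y - X.mulVec θs) ^ 2 = l2 (y - X.mulVec θ₀) ^ 2
      + 2 * (X.mulVec (θ₀ - θs) ⬝ᵥ (y - X.mulVec θ₀)) + l2 (X.mulVec (θ₀ - θs)) ^ 2 := by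
    have e : y - X.mulVec θs = (y - X.mulVec θ₀) + X.mulVec (θ₀ - θs) := by
      rw [Matrix.mulVec_sub]; abel
    rw [e, l2_sq, l2_sq, l2_sq, add_dotProduct, dotProduct_add, dotProduct_add,
      dotProduct_comm (y - X.mulVec θ₀) (X.mulVec (θ₀ - θs))]
    ring
  have hv := sq_nonneg (l2 (X.mulVec (θ₀ - θs)))
  rw [candidateCost, h1]
  have h2 : Real.log p ≤ (supp θs).card * Real.log p := by nlinarith
  nlinarith

/-- A set whose expected normalized posterior mass is of order `e^{-H}` has variational mass of order
`E / δ` if `H` exceeds `δ` by a multiple of `E`: the divergence of the variational posterior is at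
most that of the Gaussian candidate, which is of order `E`. -/
theorem outerExp_le (h : LargeSetting A₁ A₂ A₃ A₄ X w lam) (hs : 1 ≤ (supp θs).card)
    (hφ0 : 0 < φ) (hφ1 : φ ≤ 1) (hφ : ENNReal.ofReal φ ≤ compat X (supp θs))
    (hE : (supp θs).card * Real.log p / φ ^ 2 + l2 (X.mulVec (θ₀ - θs)) ^ 2 ≤ E)
    {F : ∀ d : ℕ, Set (Measure (Fin d → ℝ))}
    (hF : F ∈ ({familyPMF, familyQ, familyQMF} : Set (∀ d : ℕ, Set (Measure (Fin d → ℝ)))))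
    {Q : (Fin n → ℝ) → Measure (Fin p → ℝ)}
    (hQ : ∀ y, IsVBPosterior (F p) (modelPosterior X w lam y) (Q y))
    {B : Set (Fin p → ℝ)} (hBm : MeasurableSet B) {δ H : ℝ} (hδ : 0 < δ)
    (hB : (∫⁻ y in goodNoise X θ₀ θs, ∫⁻ θ in B, likRatio X θ₀ y θ
        ∂(modelPrior p w lam) ∂(dataLaw X θ₀)) * ENNReal.ofReal (Real.exp (lam * l1 θs))
      ≤ ENNReal.ofReal (Real.exp (-H)))
    (hH : δ + (A₃ + 10) * E ≤ H) :
    outerExp (dataLaw X θ₀) (fun y => Q y B)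
      ≤ ENNReal.ofReal (6 / p + ((A₃ + 61) * E + 1) / δ) := by
  have hlog := h.one_le_log
  have hX := h.colNorm_pos
  have hp := h.p_pos
  have hs1 : (1 : ℝ) ≤ (supp θs).card := by exact_mod_cast hs
  have hv := sq_nonneg (l2 (X.mulVec (θ₀ - θs)))
  have hslog : (supp θs).card * Real.log p ≤ (supp θs).card * Real.log p / φ ^ 2 :=
    le_div_self (by positivity) (by positivity) (pow_le_one₀ hφ0.le hφ1)
  have hElog : Real.log p ≤ E := by nlinarith
  have hE0 : 0 ≤ E := by linarith
  have hA3 := h.A₃_pos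
  set G := goodNoise X θ₀ θs ∩ smallEvidence X w lam θ₀ θs E with hGdef
  have hGm : MeasurableSet G :=
    (measurableSet_goodNoise X θ₀ θs).inter (h.measurableSet_smallEvidence θ₀ θs E)
  have hGc : dataLaw X θ₀ Gᶜ ≤ ENNReal.ofReal (6 / p) := by
    have h1 : Gᶜ ⊆ (goodNoise X θ₀ θs)ᶜ ∪
        (goodNoise X θ₀ θs \ smallEvidence X w lam θ₀ θs E) := by
      intro y hy
      by_cases h1 : y ∈ goodNoise X θ₀ θs
      · exact Or.inr ⟨h1, fun h2 => hy ⟨h1, h2⟩⟩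
      · exact Or.inl h1
    refine (measure_mono h1).trans ((measure_union_le _ _).trans ((add_le_add
      (h.dataLaw_compl_goodNoise_le θ₀ θs)
      (h.dataLaw_diff_smallEvidence_le hφ0 hφ hElog hE)).trans_eq ?_))
    rw [← ENNReal.ofReal_add (by positivity) (by positivity)]
    congr 1
    ring
  set κ : ℝ := δ + lam * l1 θs + (A₃ + 10) * E with hκ
  set N : (Fin n → ℝ) → ℝ≥0∞ := fun y => ∫⁻ θ in B, likRatio X θ₀ y θ ∂(modelPrior p w lam) with hN
  have hNm : Measurable N := h.measurable_lintegral_likRatio θ₀ B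
  set g : (Fin n → ℝ) → ℝ≥0∞ := fun y => Gᶜ.indicator 1 y +
    ENNReal.ofReal δ⁻¹ * (ENNReal.ofReal ((A₃ + 61) * E)
      + G.indicator (fun y => ENNReal.ofReal (Real.exp κ) * N y) y) with hg
  have hgm : Measurable g := by
    refine (measurable_const.indicator hGm.compl).add (Measurable.const_mul ?_ _)
    exact measurable_const.add ((hNm.const_mul _).indicator hGm)
  have hle : (fun y => Q y B) ≤ g := by
    intro y
    have hPr := h.isProbabilityMeasure_posterior y
    have hQp := isProbabilityMeasure_of_mem hF (hQ y).1
    by_cases hy : y ∈ G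
    swap
    · refine (prob_le_one).trans ?_
      simp only [hg]
      rw [Set.indicator_of_mem (Set.mem_compl hy)]
      exact le_self_add
    have hcost := h.cost_le hs (hE.trans' (by linarith)) hy.1
    obtain ⟨hev, hkl⟩ := h.exp_neg_cost_le_evidence_and_klDiv_le hs
      (σ := (Real.toNNReal (1 / colNorm X))) (Real.coe_toNNReal _ (by positivity)) y
    have hmin := (hQ y).2 _ (candidate_mem θs
      (σ := (Real.toNNReal (1 / colNorm X))) (Real.toNNReal_pos.2 (by positivity)) hF)
    set Z := l2 (y - X.mulVec θ₀) ^ 2 / 2 with hZ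
    -- The upper bound for the evidence cancels the cost up to a multiple of `E`.
    have hkl' : klDiv (Q y) (modelPosterior X w lam y) ≤ ENNReal.ofReal ((A₃ + 61) * E) := by
      refine hmin.trans (hkl.trans (ENNReal.ofReal_le_ofReal ?_))
      have h1 := hy.2
      simp only [smallEvidence, Set.mem_ofPred_eq, likRatio_eq] at h1
      rw [lintegral_const_mul _ (measurable_likelihood_right X y)] at h1
      change ENNReal.ofReal (Real.exp Z) * evidence X w lam y * _ ≤ _ at h1
      have h2 := ENNReal.toReal_mono ENNReal.ofReal_ne_top h1
      rw [ENNReal.toReal_mul, ENNReal.toReal_mul, ENNReal.toReal_ofReal (Real.exp_pos _).le,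
        ENNReal.toReal_ofReal (Real.exp_pos _).le, ENNReal.toReal_ofReal (Real.exp_pos _).le] at h2
      have hpos : 0 < (evidence X w lam y).toReal :=
        ENNReal.toReal_pos (h.evidence_ne_zero y) (h.evidence_ne_top y)
      have h3 : Real.log (evidence X w lam y).toReal ≤ 51 * E - Z - lam * l1 θs := by
        rw [Real.log_le_iff_le_exp hpos, sub_sub, Real.exp_sub, le_div_iff₀ (Real.exp_pos _),
          Real.exp_add]
        linarith
      linarith
    have hpost : ENNReal.ofReal (Real.exp δ) * modelPosterior X w lam y B
        ≤ ENNReal.ofReal (Real.exp κ) * N y := by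
      have h1 : modelPosterior X w lam y B = (evidence X w lam y)⁻¹
          * ∫⁻ θ in B, likelihood X y θ ∂(modelPrior p w lam) := by
        rw [modelPosterior, Measure.smul_apply, withDensity_apply _ hBm, smul_eq_mul]
        rfl
      have h2 : N y = ENNReal.ofReal (Real.exp Z)
          * ∫⁻ θ in B, likelihood X y θ ∂(modelPrior p w lam) := by
        simp only [hN, likRatio_eq]
        rw [lintegral_const_mul _ (measurable_likelihood_right X y)]
      have h3 : (evidence X w lam y)⁻¹
          ≤ ENNReal.ofReal (Real.exp (candidateCost A₃ X lam θs y)) := by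
        rw [ENNReal.inv_le_iff_inv_le, ← ENNReal.ofReal_inv_of_pos (Real.exp_pos _),
          ← Real.exp_neg]
        exact hev
      rw [h1, h2, ← mul_assoc, ← mul_assoc]
      refine mul_le_mul_left ?_ _
      calc _ ≤ ENNReal.ofReal (Real.exp δ)
            * ENNReal.ofReal (Real.exp (candidateCost A₃ X lam θs y)) := by gcongr
        _ ≤ ENNReal.ofReal (Real.exp κ) * ENNReal.ofReal (Real.exp Z) := by
            rw [← ENNReal.ofReal_mul (Real.exp_pos _).le, ← ENNReal.ofReal_mul (Real.exp_pos _).le,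
              ← Real.exp_add, ← Real.exp_add]
            refine ENNReal.ofReal_le_ofReal (Real.exp_le_exp.2 ?_)
            rw [hκ]
            linarith
    have hdv := (ofReal_mul_measure_le_klDiv_add (Q := Q y) (P := modelPosterior X w lam y) B
      hδ.le).trans (add_le_add hkl' hpost)
    simp only [hg]
    rw [Set.indicator_of_mem hy, Set.indicator_of_notMem (Set.notMem_compl_iff.2 hy), zero_add]
    calc Q y B = ENNReal.ofReal δ⁻¹ * (ENNReal.ofReal δ * Q y B) := by
          rw [← mul_assoc, ← ENNReal.ofReal_mul (by positivity), inv_mul_cancel₀ hδ.ne']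
          simp
      _ ≤ _ := by gcongr
  refine (iInf₂_le_of_le g hgm (iInf_le_of_le hle le_rfl) :
    outerExp (dataLaw X θ₀) (fun y => Q y B) ≤ ∫⁻ y, g y ∂(dataLaw X θ₀)).trans ?_
  have hNint : ∫⁻ y, G.indicator (fun y => ENNReal.ofReal (Real.exp κ) * N y) y ∂(dataLaw X θ₀)
      ≤ 1 := by
    rw [lintegral_indicator hGm, lintegral_const_mul _ hNm]
    have h1 : ENNReal.ofReal (Real.exp κ)
        = ENNReal.ofReal (Real.exp (δ + (A₃ + 10) * E)) * ENNReal.ofReal (Real.exp (lam * l1 θs)) := by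
      rw [← ENNReal.ofReal_mul (Real.exp_pos _).le, ← Real.exp_add, hκ]
      congr 2
      ring
    calc _ ≤ ENNReal.ofReal (Real.exp (δ + (A₃ + 10) * E)) *
          ((∫⁻ y in goodNoise X θ₀ θs, N y ∂(dataLaw X θ₀))
            * ENNReal.ofReal (Real.exp (lam * l1 θs))) := by
          rw [h1, mul_assoc, mul_comm (ENNReal.ofReal (Real.exp (lam * l1 θs)))]
          gcongr
          exact Set.inter_subset_left
      _ ≤ ENNReal.ofReal (Real.exp (δ + (A₃ + 10) * E)) * ENNReal.ofReal (Real.exp (-H)) := by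
          gcongr
      _ ≤ 1 := by
          rw [← ENNReal.ofReal_mul (Real.exp_pos _).le, ← Real.exp_add, ← ENNReal.ofReal_one]
          exact ENNReal.ofReal_le_ofReal (Real.exp_le_one_iff.2 (by linarith))
  have hm1 : Measurable (Gᶜ.indicator (1 : (Fin n → ℝ) → ℝ≥0∞)) :=
    measurable_const.indicator hGm.compl
  have hm2 : Measurable fun y => ENNReal.ofReal ((A₃ + 61) * E)
      + G.indicator (fun y => ENNReal.ofReal (Real.exp κ) * N y) y :=
    measurable_const.add ((hNm.const_mul _).indicator hGm)
  simp only [hg]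
  rw [lintegral_add_left hm1, lintegral_const_mul _ hm2, lintegral_add_left measurable_const,
    lintegral_indicator_one hGm.compl, lintegral_const, measure_univ, mul_one]
  calc _ ≤ ENNReal.ofReal (6 / p) + ENNReal.ofReal δ⁻¹ * (ENNReal.ofReal ((A₃ + 61) * E) + 1) := by
        gcongr
    _ = _ := by
        rw [← ENNReal.ofReal_one, ← ENNReal.ofReal_add (by positivity) (by norm_num),
          ← ENNReal.ofReal_mul (by positivity), ← ENNReal.ofReal_add (by positivity) (by positivity)]
        congr 1
        rw [div_eq_inv_mul _ δ]

end LargeSetting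

end SparseVB

namespace SparseVB

open scoped Matrix

/-! ### Compatibility numbers -/

/-- Choosing the signs one after the other, each so that it makes an obtuse angle with the sum so far,
gives a sign vector on `S` whose image is no longer than for orthogonal columns. -/
theorem exists_signs {n p : ℕ} (X : Matrix (Fin n) (Fin p) ℝ) (S : Finset (Fin p)) :
    ∃ ε : Fin p → ℝ, (∀ i ∈ S, |ε i| = 1) ∧ (∀ i ∉ S, ε i = 0) ∧
      l2 (X.mulVec ε) ^ 2 ≤ S.card * colNorm X ^ 2 := by
  induction S using Finset.induction_on with
  | empty => exact ⟨0, by simp, by simp, by simp [l2_sq]⟩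
  | insert a S ha ih =>
    obtain ⟨ε, h1, h2, h3⟩ := ih
    obtain ⟨τ, hτ, hdot⟩ : ∃ τ : ℝ, |τ| = 1 ∧ τ * (X.mulVec ε ⬝ᵥ X.col a) ≤ 0 := by
      rcases le_total (X.mulVec ε ⬝ᵥ X.col a) 0 with h | h
      · exact ⟨1, by simp, by linarith⟩
      · exact ⟨-1, by simp, by linarith⟩
    refine ⟨ε + Pi.single a τ, fun i hi => ?_, fun i hi => ?_, ?_⟩
    · by_cases hia : i = a
      · subst hia; simp [h2 i ha, hτ]
      · simp [hia, h1 i ((Finset.mem_insert.1 hi).resolve_left hia)]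
    · have hia : i ≠ a := fun h => hi (h ▸ Finset.mem_insert_self _ _)
      simp [hia, h2 i fun h => hi (Finset.mem_insert_of_mem h)]
    · have hτ2 : τ * τ = 1 := by rw [← abs_mul_abs_self, hτ, one_mul]
      have hcol : X.col a ⬝ᵥ X.col a ≤ colNorm X ^ 2 := by
        rw [← l2_sq]
        exact pow_le_pow_left₀ (l2_nonneg _) (l2_col_le_colNorm X a) 2
      have hmv : X.mulVec (Pi.single a τ) = τ • X.col a := by
        rw [Matrix.mulVec_single]
        ext j
        simp [mul_comm]
      rw [Finset.card_insert_of_notMem ha, Matrix.mulVec_add, hmv, l2_sq]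
      rw [l2_sq] at h3
      simp only [add_dotProduct, dotProduct_add, smul_dotProduct, dotProduct_smul, smul_eq_mul,
        dotProduct_comm (X.col a) (X.mulVec ε)]
      push_cast
      have h4 : τ * (τ * (X.col a ⬝ᵥ X.col a)) = X.col a ⬝ᵥ X.col a := by
        rw [← mul_assoc, hτ2, one_mul]
      rw [mul_add, h4]
      linarith

theorem compat_le_one {n p : ℕ} {X : Matrix (Fin n) (Fin p) ℝ} (hX : 0 < colNorm X)
    {S : Finset (Fin p)} (hS : 1 ≤ S.card) : compat X S ≤ 1 := by
  obtain ⟨ε, h1, h2, h3⟩ := exists_signs X S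
  obtain ⟨i, hi⟩ := Finset.card_pos.1 hS
  have hsum : ∑ i ∈ S, |ε i| = S.card := by
    rw [Finset.sum_congr rfl h1]; simp
  have hoff : ∑ i ∈ Sᶜ, |ε i| = 0 :=
    Finset.sum_eq_zero fun i hi => by rw [h2 i (Finset.mem_compl.1 hi), abs_zero]
  have hne : ε i ≠ 0 := fun h => by simpa [h] using h1 i hi
  have hc : (0 : ℝ) < S.card := by exact_mod_cast hS
  refine (iInf₂_le ε ⟨⟨i, hi, hne⟩, by rw [hoff, hsum]; positivity⟩).trans ?_
  rw [hsum, ← ENNReal.ofReal_one]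
  refine ENNReal.ofReal_le_ofReal ?_
  rw [div_le_one (by positivity)]
  have h4 : l2 (X.mulVec ε) ≤ √(S.card : ℝ) * colNorm X := by
    refine abs_le_of_sq_le_sq' ?_ (by positivity) |>.2
    rwa [mul_pow, Real.sq_sqrt hc.le]
  calc l2 (X.mulVec ε) * √(S.card : ℝ) ≤ √(S.card : ℝ) * colNorm X * √(S.card : ℝ) := by gcongr
    _ = colNorm X * (√(S.card : ℝ) * √(S.card : ℝ)) := by ring
    _ = _ := by rw [Real.mul_self_sqrt hc.le]

theorem exists_ne_zero_of_card_supp_ne_zero {d : ℕ} {θ : Fin d → ℝ} (h : (supp θ).card ≠ 0) :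
    ∃ i, θ i ≠ 0 := by
  obtain ⟨i, hi⟩ := Finset.card_pos.1 (Nat.pos_of_ne_zero h)
  exact ⟨i, mem_supp.1 hi⟩

theorem sparseSing_le_unifCompat {n p : ℕ} {X : Matrix (Fin n) (Fin p) ℝ} (hX : 0 < colNorm X)
    (r : ℝ≥0∞) : sparseSing X r ≤ unifCompat X r := by
  refine le_iInf₂ fun θ hθ => (iInf₂_le θ hθ).trans (ENNReal.ofReal_le_ofReal ?_)
  obtain ⟨i, hi⟩ := exists_ne_zero_of_card_supp_ne_zero hθ.1
  have h1 := l1_pos hi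
  have h2 := l2_pos hi
  have h3 := l1_le_sqrt_card_mul_l2 θ
  rw [div_le_div_iff₀ (by positivity) (by positivity)]
  have h4 := mul_le_mul_of_nonneg_left h3 (mul_nonneg (l2_nonneg (X.mulVec θ)) hX.le)
  linarith

theorem unifCompat_le_one {n p : ℕ} {X : Matrix (Fin n) (Fin p) ℝ} (hX : 0 < colNorm X)
    (hp : 1 ≤ p) {r : ℝ≥0∞} (hr : 1 ≤ r) : unifCompat X r ≤ 1 := by
  set i : Fin p := ⟨0, hp⟩
  set θ : Fin p → ℝ := Pi.single i 1 with hθ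
  have hsupp : supp θ = {i} := by
    ext j
    rw [mem_supp, Finset.mem_singleton]
    by_cases hj : j = i <;> simp [hθ, hj]
  have hl1 : l1 θ = 1 := by rw [l1_eq_sum_supp, hsupp]; simp [hθ]
  refine (iInf₂_le θ ⟨by rw [hsupp]; simp, by rw [hsupp]; simpa using hr⟩).trans ?_
  rw [hsupp, hl1, ← ENNReal.ofReal_one]
  refine ENNReal.ofReal_le_ofReal ?_
  rw [div_le_one (by positivity), hθ, Matrix.mulVec_single_one]
  simp only [Finset.card_singleton, Nat.cast_one, Real.sqrt_one, mul_one]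
  exact l2_col_le_colNorm X i

theorem unifCompat_mul_l1_le {n p : ℕ} {X : Matrix (Fin n) (Fin p) ℝ} (hX : 0 < colNorm X)
    {r : ℝ≥0∞} {ψ : ℝ} (hψ : ENNReal.ofReal ψ ≤ unifCompat X r) {h : Fin p → ℝ}
    (hr : ((supp h).card : ℝ≥0∞) ≤ r) :
    ψ * (colNorm X * l1 h) ≤ l2 (X.mulVec h) * √((supp h).card : ℝ) := by
  have hnn : 0 ≤ l2 (X.mulVec h) * √((supp h).card : ℝ) :=
    mul_nonneg (l2_nonneg _) (Real.sqrt_nonneg _)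
  by_cases h0 : (supp h).card = 0
  · rw [l1_eq_sum_supp, Finset.card_eq_zero.1 h0]
    simp
  · obtain ⟨i, hi⟩ := exists_ne_zero_of_card_supp_ne_zero h0
    have h1 := l1_pos hi
    have h2 : ENNReal.ofReal ψ ≤ _ := hψ.trans (iInf₂_le h ⟨h0, hr⟩)
    rwa [ENNReal.ofReal_le_ofReal_iff (by positivity), le_div_iff₀ (by positivity)] at h2

theorem sparseSing_mul_l2_le {n p : ℕ} {X : Matrix (Fin n) (Fin p) ℝ} (hX : 0 < colNorm X)
    {r : ℝ≥0∞} {ψ : ℝ} (hψ : ENNReal.ofReal ψ ≤ sparseSing X r) {h : Fin p → ℝ}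
    (hr : ((supp h).card : ℝ≥0∞) ≤ r) :
    ψ * (colNorm X * l2 h) ≤ l2 (X.mulVec h) := by
  by_cases h0 : (supp h).card = 0
  · have : h = 0 := by
      funext i
      have : i ∉ supp h := by rw [Finset.card_eq_zero.1 h0]; simp
      simpa [mem_supp] using this
    subst this
    have := l2_sq (0 : Fin p → ℝ)
    simp at this
    rw [this]
    simpa using l2_nonneg _
  · obtain ⟨i, hi⟩ := exists_ne_zero_of_card_supp_ne_zero h0
    have h1 := l2_pos hi
    have h2 : ENNReal.ofReal ψ ≤ _ := hψ.trans (iInf₂_le h ⟨h0, hr⟩)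
    rwa [ENNReal.ofReal_le_ofReal_iff (div_nonneg (l2_nonneg _) (by positivity)),
      le_div_iff₀ (by positivity)] at h2

theorem natCast_le_psiDim {n p : ℕ} (X : Matrix (Fin n) (Fin p) ℝ) {A₄ lam ρ : ℝ}
    (hA₄ : 0 < A₄) (hρ : 0 ≤ ρ) {S : Finset (Fin p)} {m : ℕ}
    (hm : (m : ℝ) ≤ (2 + 4 * ρ / A₄) * S.card) : (m : ℝ≥0∞) ≤ psiDim X A₄ lam ρ S := by
  have h1 : (m : ℝ≥0∞) ≤ (2 + ENNReal.ofReal (4 * ρ / A₄)) * (S.card : ℝ≥0∞) := by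
    have h2 := ENNReal.ofReal_le_ofReal hm
    rw [ENNReal.ofReal_natCast, ENNReal.ofReal_mul (by positivity), ENNReal.ofReal_natCast,
      ENNReal.ofReal_add (by norm_num) (by positivity)] at h2
    simpa using h2
  refine h1.trans ?_
  unfold psiDim
  gcongr
  exact le_mul_of_one_le_right zero_le le_self_add

/-! ### Sets of small posterior mass -/

namespace LargeSetting

variable {A₁ A₂ A₃ A₄ : ℝ} {n p : ℕ} {X : Matrix (Fin n) (Fin p) ℝ} {w : ℕ → ℝ} {lam : ℝ}
  {θ₀ θs : Fin p → ℝ} {φ E : ℝ}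

/-- Large dimensions, at a threshold proportional to `ρ G / log p`. -/
theorem outerExp_dimension_le (h : LargeSetting A₁ A₂ A₃ A₄ X w lam) (hs : 1 ≤ (supp θs).card)
    (hφ0 : 0 < φ) (hφ1 : φ ≤ 1) (hφ : ENNReal.ofReal φ ≤ compat X (supp θs))
    (hE : (supp θs).card * Real.log p / φ ^ 2 + l2 (X.mulVec (θ₀ - θs)) ^ 2 ≤ E) (hE1 : 1 ≤ E)
    {F : ∀ d : ℕ, Set (Measure (Fin d → ℝ))}
    (hF : F ∈ ({familyPMF, familyQ, familyQMF} : Set (∀ d : ℕ, Set (Measure (Fin d → ℝ)))))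
    {Q : (Fin n → ℝ) → Measure (Fin p → ℝ)}
    (hQ : ∀ y, IsVBPosterior (F p) (modelPosterior X w lam y) (Q y))
    {ρ G : ℝ} (hG : 0 < ρ * G) (hρG : (A₃ + 60) * E ≤ ρ * G) :
    outerExp (dataLaw X θ₀)
        (fun y => Q y {θ | 4 * (ρ * G) / (A₄ * Real.log p) ≤ ((supp θ).card : ℝ)})
      ≤ ENNReal.ofReal (6 / p + ((A₃ + 61) * E + 1) / (ρ * G)) := by
  have hlog := h.one_le_log
  have hA₄ := h.A₄_pos
  refine h.outerExp_le hs hφ0 hφ1 hφ hE hF hQ (measurableSet_le_card_supp _) hG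
    (H := 2 * (ρ * G) - 49 * E - 1) ?_ (by nlinarith)
  refine (h.lintegral_likRatio_le (H := -(49 * E)) (measurableSet_le_card_supp _)
    (fun θ hθ => hθ) fun θ _ => ?_).trans (ENNReal.ofReal_le_ofReal ?_)
  · refine (mul_le_mul_left (lintegral_mono_set Set.inter_subset_left) _).trans
      ((h.setLIntegral_likRatio_mul_le hφ0 hφ θ).trans ?_)
    gcongr
    have := sq_nonneg (l2 (X.mulVec (θ₀ - θs)))
    linarith
  · have h1 : A₄ / 2 * Real.log p * (4 * (ρ * G) / (A₄ * Real.log p)) = 2 * (ρ * G) := by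
      field_simp; norm_num
    have h2 : (2 : ℝ) ≤ Real.exp 1 := by linarith [Real.exp_one_gt_d9]
    rw [h1]
    calc _ ≤ Real.exp 1 * Real.exp (- -(49 * E) - 2 * (ρ * G)) := by gcongr
      _ = _ := by rw [← Real.exp_add]; ring_nf

/-- Parameters of moderate dimension whose prediction error is large. -/
def largeError (X : Matrix (Fin n) (Fin p) ℝ) (θs : Fin p → ℝ) (D₀ D R : ℝ) : Set (Fin p → ℝ) :=
  {θ | ((supp θ).card : ℝ) < D₀ ∧ ((supp θ).card : ℝ) < D ∧ R < l2 (X.mulVec (θ - θs))}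

theorem measurableSet_largeError (X : Matrix (Fin n) (Fin p) ℝ) (θs : Fin p → ℝ) (D₀ D R : ℝ) :
    MeasurableSet (largeError X θs D₀ D R) := by
  have h : Measurable fun θ : Fin p → ℝ => l2 (X.mulVec (θ - θs)) :=
    (continuous_l2.comp
      (continuous_const.matrix_mulVec (continuous_id.sub continuous_const))).measurable
  exact (measurableSet_lt measurable_card_supp measurable_const).inter
    ((measurableSet_lt measurable_card_supp measurable_const).inter
      (measurableSet_lt measurable_const h))

/-- The `ℓ₁` error in terms of the prediction error, for parameters of moderate dimension. -/
theorem l1_le_of_card_lt (h : LargeSetting A₁ A₂ A₃ A₄ X w lam)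
    {ρ ψ : ℝ} (hρ : 1 ≤ ρ) (hψ : ENNReal.ofReal ψ ≤ psiBar X A₄ lam ρ (supp θ₀))
    (hs0 : (supp θs).card ≤ (supp θ₀).card) (hslog : (supp θs).card * Real.log p ≤ E)
    {θ : Fin p → ℝ} (h1 : ((supp θ).card : ℝ) < 4 * ρ / A₄ * (supp θ₀).card)
    (h2 : ((supp θ).card : ℝ) < 4 * (ρ * E) / (A₄ * Real.log p)) :
    ψ * (colNorm X * l1 (θ - θs)) * √(Real.log p)
      ≤ l2 (X.mulVec (θ - θs)) * (√(4 / A₄ + 1) * √(ρ * E)) := by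
  have hlog := h.one_le_log
  have hA₄ := h.A₄_pos
  have hE0 : 0 ≤ E := le_trans (by positivity) hslog
  have hcard : ((supp (θ - θs)).card : ℝ) ≤ (supp θ).card + (supp θs).card := by
    exact_mod_cast card_supp_sub_le θ θs
  have hs0' : ((supp θs).card : ℝ) ≤ (supp θ₀).card := by exact_mod_cast hs0
  have hdim : ((supp (θ - θs)).card : ℝ≥0∞) ≤ psiDim X A₄ lam ρ (supp θ₀) :=
    natCast_le_psiDim X hA₄ (by linarith) (by nlinarith)
  have h3 := unifCompat_mul_l1_le h.colNorm_pos hψ hdim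
  have h4 : √((supp (θ - θs)).card : ℝ) * √(Real.log p) ≤ √(4 / A₄ + 1) * √(ρ * E) := by
    rw [← Real.sqrt_mul (Nat.cast_nonneg _), ← Real.sqrt_mul (by positivity)]
    refine Real.sqrt_le_sqrt ?_
    rw [lt_div_iff₀ (by positivity)] at h2
    have h5 : (supp θ).card * Real.log p ≤ 4 / A₄ * (ρ * E) := by
      rw [div_mul_eq_mul_div, le_div_iff₀ hA₄]
      linarith
    have h6 : E ≤ ρ * E := le_mul_of_one_le_left hE0 hρ
    have h7 := mul_le_mul_of_nonneg_right hcard (show 0 ≤ Real.log p by linarith)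
    linarith
  calc _ ≤ l2 (X.mulVec (θ - θs)) * √((supp (θ - θs)).card : ℝ) * √(Real.log p) := by gcongr
    _ ≤ _ := by
        rw [mul_assoc]
        exact mul_le_mul_of_nonneg_left h4 (l2_nonneg _)

/-- On the noise event, a large prediction error makes the likelihood ratio exponentially small. -/
theorem likRatio_mul_le_of_mem_largeError (h : LargeSetting A₁ A₂ A₃ A₄ X w lam)
    (hs : 1 ≤ (supp θs).card) (hφ0 : 0 < φ) (hφ1 : φ ≤ 1)
    (hE : (supp θs).card * Real.log p / φ ^ 2 + l2 (X.mulVec (θ₀ - θs)) ^ 2 ≤ E)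
    (hs0 : (supp θs).card ≤ (supp θ₀).card)
    {ρ ψ κ : ℝ} (hρ1 : 1 ≤ ρ) (hψ0 : 0 < ψ) (hψ1 : ψ ≤ 1)
    (hψ : ENNReal.ofReal ψ ≤ psiBar X A₄ lam ρ (supp θ₀)) (hκ : κ = 7 * √(4 / A₄ + 1))
    {θ : Fin p → ℝ} (hθ : θ ∈ largeError X θs (4 * ρ / A₄ * (supp θ₀).card)
      (4 * (ρ * E) / (A₄ * Real.log p)) (4 * (κ + 2) * (√(ρ * E) / ψ)))
    {y : Fin n → ℝ} (hy : y ∈ goodNoise X θ₀ θs) :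
    likRatio X θ₀ y θ * ENNReal.ofReal (Real.exp (lam * l1 θs))
      ≤ ENNReal.ofReal (Real.exp (-(3 * (ρ * E)))) * tilt lam θs θ := by
  have hlog := h.one_le_log
  have hA₄ := h.A₄_pos
  have hlam := h.lam_pos
  have hX := h.colNorm_pos
  have hs1 : (1 : ℝ) ≤ (supp θs).card := by exact_mod_cast hs
  have hV0 := l2_nonneg (X.mulVec (θ₀ - θs))
  have hslog' : (supp θs).card * Real.log p ≤ (supp θs).card * Real.log p / φ ^ 2 :=
    le_div_self (by positivity) (by positivity) (pow_le_one₀ hφ0.le hφ1)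
  have hslog : (supp θs).card * Real.log p ≤ E := by nlinarith
  have hElog : Real.log p ≤ E := by nlinarith
  have hE1 : 1 ≤ E := by linarith
  have hρE : 0 < ρ * E := mul_pos (by linarith) (by linarith)
  have hκ0 : 0 ≤ κ := by rw [hκ]; positivity
  set T : ℝ := √(ρ * E) / ψ with hT
  have hT0 : 0 ≤ T := by positivity
  have hsq : √(ρ * E) ≤ T := le_div_self (by positivity) hψ0 hψ1
  have hVT : l2 (X.mulVec (θ₀ - θs)) ≤ T := by
    refine le_trans (Real.le_sqrt_of_sq_le ?_) hsq
    have : 0 ≤ (supp θs).card * Real.log p / φ ^ 2 := by positivity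
    nlinarith
  have hT2 : ρ * E ≤ T ^ 2 := by
    rw [← Real.sq_sqrt (show 0 ≤ ρ * E by positivity)]
    exact pow_le_pow_left₀ (by positivity) hsq 2
  obtain ⟨hd0, hd, hR⟩ := hθ
  obtain ⟨hy1, hy2⟩ := hy
  have hl1 := h.l1_le_of_card_lt hρ1 hψ hs0 hslog hd0 hd
  rw [likRatio, tilt, ← ENNReal.ofReal_mul (Real.exp_pos _).le,
    ← ENNReal.ofReal_mul (Real.exp_pos _).le, ← Real.exp_add, ← Real.exp_add,
    exponent_eq X θ₀ θs θ y]
  refine ENNReal.ofReal_le_ofReal (Real.exp_le_exp.2 ?_)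
  rw [Set.mem_ofPred_eq, abs_le] at hy2
  have hu := dotProduct_mulVec_le_of_mem_noiseEvent hy1 (θ - θs)
  have huv := dotProduct_le_l2_mul_l2 (X.mulVec (θ - θs)) (X.mulVec (θ₀ - θs))
  have hl1d := l1_nonneg (θ - θs)
  have htri : l1 θs ≤ l1 θ + l1 (θ - θs) := by
    have h1 := l1_add_le θ (θs - θ)
    have h2 : l1 (θs - θ) = l1 (θ - θs) := by
      simp only [l1, Pi.sub_apply, abs_sub_comm]
    rw [add_sub_cancel, h2] at h1
    exact h1
  have htri' := mul_le_mul_of_nonneg_left htri hlam.le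
  have hlaml := mul_le_mul_of_nonneg_right h.lam_le hl1d
  set u := X.mulVec (θ - θs)
  set v := X.mulVec (θ₀ - θs)
  set U := l2 u with hU
  set V := l2 v with hV
  have hU0 : 0 ≤ U := l2_nonneg _
  have e1 : (y - X.mulVec θ₀) ⬝ᵥ (u - v) - (u - v) ⬝ᵥ (u - v) / 2
      = (y - X.mulVec θ₀) ⬝ᵥ u - v ⬝ᵥ (y - X.mulVec θ₀) - U ^ 2 / 2 + u ⬝ᵥ v - V ^ 2 / 2 := by
    rw [hU, hV, l2_sq, l2_sq]
    simp only [dotProduct_sub, sub_dotProduct, dotProduct_comm v]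
    ring
  -- The noise and the prior together contribute `7 ‖X‖ √(log p)` times the `ℓ₁` error.
  have e2 : 7 / 2 * (lamBar X * l1 (θ - θs)) ≤ κ * (U * T) := by
    have e3 : 7 / 2 * (lamBar X * l1 (θ - θs))
        = 7 * (ψ * (colNorm X * l1 (θ - θs)) * √(Real.log p)) / ψ := by
      rw [lamBar]; field_simp
    rw [e3, hκ, hT, div_le_iff₀ hψ0]
    have e4 : 7 * √(4 / A₄ + 1) * (U * (√(ρ * E) / ψ)) * ψ
        = 7 * (U * (√(4 / A₄ + 1) * √(ρ * E))) := by field_simp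
    rw [e4]
    linarith
  have e5 : U * V ≤ U * T := mul_le_mul_of_nonneg_left hVT hU0
  have e6 : (κ + 1) * (U * T) ≤ U ^ 2 / 4 := by
    have h8 : (κ + 1) * T ≤ U / 4 := by linarith
    have h9 := mul_le_mul_of_nonneg_left h8 hU0
    linarith
  have e7 : 4 * (ρ * E) ≤ U ^ 2 / 4 := by
    have h8 : 8 * T ≤ U := by linarith [mul_nonneg hκ0 hT0]
    have h9 : (8 * T) ^ 2 ≤ U ^ 2 := pow_le_pow_left₀ (by positivity) h8 2
    linarith
  have e8 : E ≤ ρ * E := le_mul_of_one_le_left (by linarith) hρ1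
  rw [e1]
  linarith [hy2.1]

/-- Large prediction errors among parameters of moderate dimension. -/
theorem outerExp_largeError_le (h : LargeSetting A₁ A₂ A₃ A₄ X w lam) (hs : 1 ≤ (supp θs).card)
    (hφ0 : 0 < φ) (hφ1 : φ ≤ 1) (hφ : ENNReal.ofReal φ ≤ compat X (supp θs))
    (hE : (supp θs).card * Real.log p / φ ^ 2 + l2 (X.mulVec (θ₀ - θs)) ^ 2 ≤ E)
    (hs0 : (supp θs).card ≤ (supp θ₀).card)
    {F : ∀ d : ℕ, Set (Measure (Fin d → ℝ))}
    (hF : F ∈ ({familyPMF, familyQ, familyQMF} : Set (∀ d : ℕ, Set (Measure (Fin d → ℝ)))))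
    {Q : (Fin n → ℝ) → Measure (Fin p → ℝ)}
    (hQ : ∀ y, IsVBPosterior (F p) (modelPosterior X w lam y) (Q y))
    {ρ ψ κ : ℝ} (hρ : A₃ + 11 ≤ ρ) (hψ0 : 0 < ψ) (hψ1 : ψ ≤ 1)
    (hψ : ENNReal.ofReal ψ ≤ psiBar X A₄ lam ρ (supp θ₀)) (hκ : κ = 7 * √(4 / A₄ + 1)) :
    outerExp (dataLaw X θ₀) (fun y => Q y (largeError X θs (4 * ρ / A₄ * (supp θ₀).card)
        (4 * (ρ * E) / (A₄ * Real.log p)) (4 * (κ + 2) * (√(ρ * E) / ψ))))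
      ≤ ENNReal.ofReal (6 / p + ((A₃ + 61) * E + 1) / (ρ * E)) := by
  have hlog := h.one_le_log
  have hA₃ := h.A₃_pos
  have hs1 : (1 : ℝ) ≤ (supp θs).card := by exact_mod_cast hs
  have hV0 := sq_nonneg (l2 (X.mulVec (θ₀ - θs)))
  have hslog' : (supp θs).card * Real.log p ≤ (supp θs).card * Real.log p / φ ^ 2 :=
    le_div_self (by positivity) (by positivity) (pow_le_one₀ hφ0.le hφ1)
  have hE1 : 1 ≤ E := by nlinarith
  have hρE : 0 < ρ * E := mul_pos (by linarith) (by linarith)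
  have hbig := mul_le_mul_of_nonneg_right hρ (show 0 ≤ E by linarith)
  refine h.outerExp_le hs hφ0 hφ1 hφ hE hF hQ (measurableSet_largeError X θs _ _ _)
    hρE (H := 3 * (ρ * E) - 1) ?_ (by linarith)
  refine (h.lintegral_likRatio_le (H := 3 * (ρ * E)) (t := 0) (measurableSet_largeError X θs _ _ _)
    (fun θ _ => Nat.cast_nonneg _) fun θ hθ => ?_).trans (ENNReal.ofReal_le_ofReal ?_)
  · rw [← lintegral_mul_const _ (measurable_likRatio_left X θ₀ θ)]
    refine (setLIntegral_mono measurable_const fun y hy =>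
      h.likRatio_mul_le_of_mem_largeError hs hφ0 hφ1 hE hs0 (by linarith) hψ0 hψ1 hψ hκ hθ hy).trans ?_
    rw [setLIntegral_const]
    exact mul_le_of_le_one_right zero_le prob_le_one
  · have h2 : (2 : ℝ) ≤ Real.exp 1 := by linarith [Real.exp_one_gt_d9]
    calc _ ≤ Real.exp 1 * Real.exp (-(3 * (ρ * E)) - A₄ / 2 * Real.log p * 0) := by gcongr
      _ = _ := by rw [← Real.exp_add]; ring_nf

end LargeSetting

end SparseVB

namespace SparseVB

/-! ### Outer expectations -/

theorem outerExp_mono {α : Type*} [MeasurableSpace α] (P : Measure α) {f g : α → ℝ≥0∞}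
    (h : f ≤ g) : outerExp P f ≤ outerExp P g :=
  le_iInf₂ fun k hk => le_iInf fun hgk => iInf₂_le_of_le k hk (iInf_le_of_le (h.trans hgk) le_rfl)

theorem outerExp_add_le {α : Type*} [MeasurableSpace α] (P : Measure α) (f g : α → ℝ≥0∞) :
    outerExp P (f + g) ≤ outerExp P f + outerExp P g := by
  refine ENNReal.le_of_forall_pos_le_add fun ε hε hfin => ?_
  have hε' : (ε / 2 : ℝ≥0∞) ≠ 0 := (ENNReal.half_pos (by exact_mod_cast hε.ne')).ne'
  obtain ⟨hf, hg⟩ := ENNReal.add_lt_top.1 hfin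
  obtain ⟨a, ha⟩ := iInf_lt_iff.1 (ENNReal.lt_add_right hf.ne hε')
  obtain ⟨ham, ha⟩ := iInf_lt_iff.1 ha
  obtain ⟨hfa, ha⟩ := iInf_lt_iff.1 ha
  obtain ⟨b, hb⟩ := iInf_lt_iff.1 (ENNReal.lt_add_right hg.ne hε')
  obtain ⟨hbm, hb⟩ := iInf_lt_iff.1 hb
  obtain ⟨hgb, hb⟩ := iInf_lt_iff.1 hb
  calc outerExp P (f + g) ≤ ∫⁻ y, (a y + b y) ∂P :=
        iInf₂_le_of_le (fun y => a y + b y) (ham.add hbm)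
          (iInf_le_of_le (fun y => add_le_add (hfa y) (hgb y)) le_rfl)
    _ = ∫⁻ y, a y ∂P + ∫⁻ y, b y ∂P := lintegral_add_left ham _
    _ ≤ (outerExp P f + ε / 2) + (outerExp P g + ε / 2) := add_le_add ha.le hb.le
    _ = outerExp P f + outerExp P g + ε := by rw [add_add_add_comm, ENNReal.add_halves]

theorem outerExp_union_le {α β : Type*} [MeasurableSpace α] [MeasurableSpace β] (P : Measure α)
    (Q : α → Measure β) (s t : Set β) :
    outerExp P (fun y => Q y (s ∪ t)) ≤ outerExp P (fun y => Q y s) + outerExp P (fun y => Q y t) :=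
  (outerExp_mono P fun _ => measure_union_le _ _).trans (outerExp_add_le P _ _)

/-! ### Oracle rates in real numbers -/

/-- The exponential scale `s_* log p / φ(S_*)² + ‖X (θ₀ - θs)‖²` of the oracle `θs`. -/
noncomputable def oracleScale {n p : ℕ} (X : Matrix (Fin n) (Fin p) ℝ) (θ₀ θs : Fin p → ℝ) : ℝ :=
  (supp θs).card * Real.log p / (compat X (supp θs)).toReal ^ 2 + l2 (X.mulVec (θ₀ - θs)) ^ 2

/-- The constant `7 √(4 / A₄ + 1)`. Noise, prior and tilt together weigh the `ℓ₁` error by at most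
`(7 / 2) λ̄ = 7 ‖X‖ √(log p)`, and the root comes from the dimension bound in
`LargeSetting.l1_le_of_card_lt`. -/
noncomputable def dimConst (A₄ : ℝ) : ℝ := 7 * √(4 / A₄ + 1)

/-- The constant `M` of the oracle rates, chosen large enough for all three errors at once. -/
noncomputable def rateConst (A₄ : ℝ) : ℝ := 4 * (dimConst A₄ + 2) * (dimConst A₄ + 1) + 2

/-- Parameters of large dimension, measured by `θ₀` or by the oracle `θs`, or of large prediction
error. -/
def badSet {n p : ℕ} (X : Matrix (Fin n) (Fin p) ℝ) (A₄ lam ρ : ℝ) (θ₀ θs : Fin p → ℝ) :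
    Set (Fin p → ℝ) :=
  {θ | 4 * ρ / A₄ * (supp θ₀).card ≤ ((supp θ).card : ℝ)} ∪
    ({θ | 4 * (ρ * oracleScale X θ₀ θs) / (A₄ * Real.log p) ≤ ((supp θ).card : ℝ)} ∪
      LargeSetting.largeError X θs (4 * ρ / A₄ * (supp θ₀).card)
        (4 * (ρ * oracleScale X θ₀ θs) / (A₄ * Real.log p))
        (4 * (dimConst A₄ + 2)
          * (√(ρ * oracleScale X θ₀ θs) / (psiBar X A₄ lam ρ (supp θ₀)).toReal)))

/-- What the hypotheses on `θ₀` and `θs` say about the compatibility numbers, as real numbers. -/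
structure OraclePair {n p : ℕ} (X : Matrix (Fin n) (Fin p) ℝ) (A₄ lam c₀ ρ : ℝ)
    (θ₀ θs : Fin p → ℝ) (φ ψ ψt : ℝ) : Prop where
  compat_eq : compat X (supp θs) = ENNReal.ofReal φ
  psiBar_eq : psiBar X A₄ lam ρ (supp θ₀) = ENNReal.ofReal ψ
  psiTilde_eq : psiTilde X A₄ lam ρ (supp θ₀) = ENNReal.ofReal ψt
  compat₀_ge : ENNReal.ofReal c₀ ≤ compat X (supp θ₀)
  φ_pos : 0 < φ
  φ_le : φ ≤ 1
  ψt_pos : 0 < ψt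
  ψt_le : ψt ≤ ψ
  ψ_le : ψ ≤ 1
  c₀_pos : 0 < c₀
  c₀_le : c₀ ≤ 1
  one_le : 1 ≤ (supp θs).card
  card_le : (supp θs).card ≤ (supp θ₀).card

namespace LargeSetting

variable {A₁ A₂ A₃ A₄ : ℝ} {n p : ℕ} {X : Matrix (Fin n) (Fin p) ℝ} {w : ℕ → ℝ} {lam : ℝ}
  {θ₀ θs : Fin p → ℝ} {c₀ ρ s : ℝ}

theorem psiBar_le_one (h : LargeSetting A₁ A₂ A₃ A₄ X w lam) (hs : 1 ≤ (supp θ₀).card) :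
    psiBar X A₄ lam ρ (supp θ₀) ≤ 1 := by
  refine unifCompat_le_one h.colNorm_pos (by have := h.three_le; omega) ?_
  unfold psiDim
  have h1 : (1 : ℝ≥0∞) ≤ ((supp θ₀).card : ℝ≥0∞) := by exact_mod_cast hs
  refine one_le_mul_of_one_le_of_one_le ?_ h1
  exact (by norm_num : (1 : ℝ≥0∞) ≤ 2).trans le_self_add

theorem oraclePair (h : LargeSetting A₁ A₂ A₃ A₄ X w lam) (hc₀ : 0 < c₀)
    (hθ₀ : θ₀ ∈ paramSet X A₄ lam c₀ ρ s) (hθs : θs ∈ oracleSet X θ₀)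
    (hne : compat X (supp θs) ≠ 0) :
    OraclePair X A₄ lam c₀ ρ θ₀ θs (compat X (supp θs)).toReal
      (psiBar X A₄ lam ρ (supp θ₀)).toReal (psiTilde X A₄ lam ρ (supp θ₀)).toReal := by
  have hX := h.colNorm_pos
  obtain ⟨hs1, hs0, -⟩ := hθs
  obtain ⟨hc, -, ht⟩ := hθ₀
  have h1 : compat X (supp θs) ≤ 1 := compat_le_one hX hs1
  have h2 : compat X (supp θ₀) ≤ 1 := compat_le_one hX (hs1.trans hs0)
  have h3 : psiBar X A₄ lam ρ (supp θ₀) ≤ 1 := h.psiBar_le_one (hs1.trans hs0)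
  have h4 : psiTilde X A₄ lam ρ (supp θ₀) ≤ psiBar X A₄ lam ρ (supp θ₀) :=
    sparseSing_le_unifCompat hX _
  have t1 : compat X (supp θs) ≠ ∞ := ne_top_of_le_ne_top ENNReal.one_ne_top h1
  have t3 : psiBar X A₄ lam ρ (supp θ₀) ≠ ∞ := ne_top_of_le_ne_top ENNReal.one_ne_top h3
  have t4 : psiTilde X A₄ lam ρ (supp θ₀) ≠ ∞ := ne_top_of_le_ne_top t3 h4
  have hpos : psiTilde X A₄ lam ρ (supp θ₀) ≠ 0 := fun h0 => by
    rw [h0] at ht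
    exact absurd ht (not_le.2 (ENNReal.ofReal_pos.2 hc₀))
  exact
    { compat_eq := (ENNReal.ofReal_toReal t1).symm
      psiBar_eq := (ENNReal.ofReal_toReal t3).symm
      psiTilde_eq := (ENNReal.ofReal_toReal t4).symm
      compat₀_ge := hc
      φ_pos := ENNReal.toReal_pos hne t1
      φ_le := by simpa using ENNReal.toReal_mono ENNReal.one_ne_top h1
      ψt_pos := ENNReal.toReal_pos hpos t4
      ψt_le := ENNReal.toReal_mono t3 h4
      ψ_le := by simpa using ENNReal.toReal_mono ENNReal.one_ne_top h3
      c₀_pos := hc₀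
      c₀_le := by simpa using hc.trans h2
      one_le := hs1
      card_le := hs0 }

theorem one_le_oracleScale (h : LargeSetting A₁ A₂ A₃ A₄ X w lam) {φ ψ ψt : ℝ}
    (ho : OraclePair X A₄ lam c₀ ρ θ₀ θs φ ψ ψt) :
    (supp θs).card * Real.log p ≤ oracleScale X θ₀ θs ∧ 1 ≤ oracleScale X θ₀ θs ∧
      (supp θs).card * Real.log p / φ ^ 2 + l2 (X.mulVec (θ₀ - θs)) ^ 2 = oracleScale X θ₀ θs := by
  have hlog := h.one_le_log
  have hs1 : (1 : ℝ) ≤ (supp θs).card := by exact_mod_cast ho.one_le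
  have hv := sq_nonneg (l2 (X.mulVec (θ₀ - θs)))
  have hφ : (compat X (supp θs)).toReal = φ := by
    rw [ho.compat_eq, ENNReal.toReal_ofReal ho.φ_pos.le]
  have h1 : (supp θs).card * Real.log p ≤ (supp θs).card * Real.log p / φ ^ 2 :=
    le_div_self (by positivity) (pow_pos ho.φ_pos 2) (pow_le_one₀ ho.φ_pos.le ho.φ_le)
  rw [oracleScale, hφ]
  exact ⟨by linarith, by nlinarith, rfl⟩

theorem outerExp_badSet_le (h : LargeSetting A₁ A₂ A₃ A₄ X w lam) {φ ψ ψt : ℝ}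
    (ho : OraclePair X A₄ lam c₀ ρ θ₀ θs φ ψ ψt) (hρ : (A₃ + 60) / c₀ ^ 2 ≤ ρ)
    {F : ∀ d : ℕ, Set (Measure (Fin d → ℝ))}
    (hF : F ∈ ({familyPMF, familyQ, familyQMF} : Set (∀ d : ℕ, Set (Measure (Fin d → ℝ)))))
    {Q : (Fin n → ℝ) → Measure (Fin p → ℝ)}
    (hQ : ∀ y, IsVBPosterior (F p) (modelPosterior X w lam y) (Q y)) :
    outerExp (dataLaw X θ₀) (fun y => Q y (badSet X A₄ lam ρ θ₀ θs))
      ≤ ENNReal.ofReal (18 / p + 3 * ((A₃ + 62) / c₀ ^ 2) / ρ) := by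
  have hlog := h.one_le_log
  have hp := h.p_pos
  have hA₃ := h.A₃_pos
  have hA₄ := h.A₄_pos
  have hc := ho.c₀_pos
  obtain ⟨hslog, hE1, hE⟩ := h.one_le_oracleScale ho
  set E := oracleScale X θ₀ θs with hEdef
  have hc2 : c₀ ^ 2 ≤ 1 := pow_le_one₀ hc.le ho.c₀_le
  have hρ60 : A₃ + 60 ≤ ρ := (le_div_self (by positivity) (by positivity) hc2).trans hρ
  have hρ0 : 0 < ρ := by linarith
  have hψ : (psiBar X A₄ lam ρ (supp θ₀)).toReal = ψ := by
    rw [ho.psiBar_eq, ENNReal.toReal_ofReal (ho.ψt_pos.le.trans ho.ψt_le)]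
  have hs0 : 1 ≤ (supp θ₀).card := ho.one_le.trans ho.card_le
  have hs0' : (1 : ℝ) ≤ (supp θ₀).card := by exact_mod_cast hs0
  have hK : (A₃ + 62) / ρ ≤ (A₃ + 62) / c₀ ^ 2 / ρ := by
    gcongr
    exact le_div_self (by positivity) (by positivity) hc2
  have hstar : ((A₃ + 61) * E + 1) / (ρ * E) ≤ (A₃ + 62) / c₀ ^ 2 / ρ := by
    refine le_trans ?_ hK
    rw [div_le_div_iff₀ (by positivity) hρ0]
    nlinarith
  -- The threshold in terms of `θ₀` uses the trivial oracle `θs = θ₀`.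
  have b0 : outerExp (dataLaw X θ₀)
      (fun y => Q y {θ | 4 * ρ / A₄ * (supp θ₀).card ≤ ((supp θ).card : ℝ)})
      ≤ ENNReal.ofReal (6 / p + (A₃ + 62) / c₀ ^ 2 / ρ) := by
    set G : ℝ := (supp θ₀).card * Real.log p with hG
    have hG1 : 1 ≤ G := by nlinarith
    have hG2 : G ≤ G / c₀ ^ 2 := le_div_self (by positivity) (by positivity) hc2
    have e1 : 4 * ρ / A₄ * (supp θ₀).card = 4 * (ρ * G) / (A₄ * Real.log p) := by
      rw [hG]; field_simp
    have h1 := h.outerExp_dimension_le (θ₀ := θ₀) (θs := θ₀) (E := G / c₀ ^ 2) (ρ := ρ) (G := G)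
      hs0 hc ho.c₀_le ho.compat₀_ge (by simp [l2_sq, hG]) (by linarith) hF hQ (by positivity)
      (by
        rw [← mul_div_assoc, div_le_iff₀ (by positivity)]
        rw [div_le_iff₀ (by positivity)] at hρ
        nlinarith)
    rw [e1]
    refine h1.trans (ENNReal.ofReal_le_ofReal (add_le_add_right ?_ _))
    calc ((A₃ + 61) * (G / c₀ ^ 2) + 1) / (ρ * G) ≤ ((A₃ + 62) * (G / c₀ ^ 2)) / (ρ * G) := by
          gcongr; linarith
      _ = _ := by field_simp
  have b1 := (h.outerExp_dimension_le (ρ := ρ) (G := E) ho.one_le ho.φ_pos ho.φ_le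
    ho.compat_eq.ge hE.le hE1 hF hQ (by positivity) (by nlinarith)).trans
    (ENNReal.ofReal_le_ofReal (add_le_add_right hstar (6 / (p : ℝ))))
  have b2 := (h.outerExp_largeError_le ho.one_le ho.φ_pos ho.φ_le ho.compat_eq.ge hE.le ho.card_le
    hF hQ (ρ := ρ) (by linarith) (ho.ψt_pos.trans_le ho.ψt_le) ho.ψ_le ho.psiBar_eq.ge
    (κ := dimConst A₄) rfl).trans
    (ENNReal.ofReal_le_ofReal (add_le_add_right hstar (6 / (p : ℝ))))
  unfold badSet
  rw [hψ]
  refine (outerExp_union_le _ _ _ _).trans ((add_le_add b0 ((outerExp_union_le _ _ _ _).trans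
    (add_le_add b1 b2))).trans_eq ?_)
  rw [← ENNReal.ofReal_add (by positivity) (by positivity),
    ← ENNReal.ofReal_add (by positivity) (by positivity)]
  congr 1
  ring

/-- Off the bad set, prediction error and `ℓ₁` distance to the oracle are of the oracle order. -/
theorem errors_le_of_notMem_badSet (h : LargeSetting A₁ A₂ A₃ A₄ X w lam) {φ ψ ψt : ℝ}
    (ho : OraclePair X A₄ lam c₀ ρ θ₀ θs φ ψ ψt) (hρ : 1 ≤ ρ) {θ : Fin p → ℝ}
    (hθ : θ ∉ badSet X A₄ lam ρ θ₀ θs) :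
    ((supp (θ - θ₀)).card : ℝ≥0∞) ≤ psiDim X A₄ lam ρ (supp θ₀) ∧
    l2 (X.mulVec (θ - θs)) ≤ 4 * (dimConst A₄ + 2) * (√(ρ * oracleScale X θ₀ θs) / ψ) ∧
    7 * (ψ * (colNorm X * l1 (θ - θs)) * √(Real.log p))
      ≤ l2 (X.mulVec (θ - θs)) * (dimConst A₄ * √(ρ * oracleScale X θ₀ θs)) := by
  have hA₄ := h.A₄_pos
  obtain ⟨hslog, -, -⟩ := h.one_le_oracleScale ho
  have hψ : (psiBar X A₄ lam ρ (supp θ₀)).toReal = ψ := by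
    rw [ho.psiBar_eq, ENNReal.toReal_ofReal (ho.ψt_pos.le.trans ho.ψt_le)]
  simp only [badSet, Set.mem_union, not_or, Set.mem_ofPred_eq, not_le, hψ] at hθ
  obtain ⟨h1, h2, h3⟩ := hθ
  refine ⟨natCast_le_psiDim X hA₄ (by linarith) ?_, ?_, ?_⟩
  · have hcard : ((supp (θ - θ₀)).card : ℝ) ≤ (supp θ).card + (supp θ₀).card := by
      exact_mod_cast card_supp_sub_le θ θ₀
    have : (0 : ℝ) ≤ (supp θ₀).card := Nat.cast_nonneg _
    linarith
  · by_contra hlt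
    exact h3 ⟨h1, h2, not_le.1 hlt⟩
  · have h4 := h.l1_le_of_card_lt hρ ho.psiBar_eq.ge ho.card_le hslog h1 h2
    rw [dimConst]
    linarith

theorem l2_mulVec_sub_lt (h : LargeSetting A₁ A₂ A₃ A₄ X w lam) {φ ψ ψt : ℝ}
    (ho : OraclePair X A₄ lam c₀ ρ θ₀ θs φ ψ ψt) (hρ : 1 ≤ ρ) {θ : Fin p → ℝ}
    (hθ : θ ∉ badSet X A₄ lam ρ θ₀ θs) :
    l2 (X.mulVec (θ - θ₀)) < rateConst A₄ * √ρ / ψ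
      * (√((supp θs).card * Real.log p) / φ + l2 (X.mulVec (θ₀ - θs))) := by
  have hlog := h.one_le_log
  obtain ⟨-, hU, -⟩ := h.errors_le_of_notMem_badSet ho hρ hθ
  obtain ⟨-, hE1, hE⟩ := h.one_le_oracleScale ho
  have hψ0 := ho.ψt_pos.trans_le ho.ψt_le
  have hφ0 := ho.φ_pos
  have hs1 : (1 : ℝ) ≤ (supp θs).card := by exact_mod_cast ho.one_le
  have hκ : 0 ≤ dimConst A₄ := by unfold dimConst; positivity
  have hV0 := l2_nonneg (X.mulVec (θ₀ - θs))
  have htri : l2 (X.mulVec (θ - θ₀)) ≤ l2 (X.mulVec (θ - θs)) + l2 (X.mulVec (θ₀ - θs)) := by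
    have e : X.mulVec (θ - θ₀) = X.mulVec (θ - θs) + X.mulVec (θs - θ₀) := by
      rw [← Matrix.mulVec_add]; congr 1; abel
    have e2 : l2 (X.mulVec (θs - θ₀)) = l2 (X.mulVec (θ₀ - θs)) := by
      rw [Matrix.mulVec_sub, Matrix.mulVec_sub, l2_sub_comm]
    rw [e, ← e2]
    exact l2_add_le _ _
  set V := l2 (X.mulVec (θ₀ - θs)) with hV
  set q := √((supp θs).card * Real.log p) / φ with hq
  have hq0 : 0 < q := by
    have : 0 < (supp θs).card * Real.log p := by positivity
    positivity
  have hEq : oracleScale X θ₀ θs = q ^ 2 + V ^ 2 := by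
    rw [← hE, hq, div_pow, Real.sq_sqrt (by positivity)]
  have hsqrtE : √(oracleScale X θ₀ θs) ≤ q + V := by
    rw [Real.sqrt_le_left (by positivity), hEq]
    nlinarith
  have hr1 : 1 ≤ √ρ / ψ := by
    rw [one_le_div hψ0]
    exact ho.ψ_le.trans (Real.one_le_sqrt.2 hρ)
  set r := √ρ / ψ with hr
  have e1 : √(ρ * oracleScale X θ₀ θs) / ψ ≤ r * (q + V) := by
    rw [Real.sqrt_mul (by linarith), mul_div_right_comm]
    gcongr
  have e2 : rateConst A₄ * √ρ / ψ * (q + V)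
      = (4 * (dimConst A₄ + 2) * (dimConst A₄ + 1) + 2) * (r * (q + V)) := by
    rw [rateConst, hr]; ring
  have e3 : V < 2 * (r * (q + V)) := by nlinarith
  have e4 : 0 ≤ (4 * (dimConst A₄ + 2) * dimConst A₄) * (r * (q + V)) := by positivity
  have e5 := mul_le_mul_of_nonneg_left e1 (show 0 ≤ 4 * (dimConst A₄ + 2) by positivity)
  rw [e2]
  linarith

theorem l1_sub_le (h : LargeSetting A₁ A₂ A₃ A₄ X w lam) {φ ψ ψt : ℝ}
    (ho : OraclePair X A₄ lam c₀ ρ θ₀ θs φ ψ ψt) (hρ : 1 ≤ ρ) {θ : Fin p → ℝ}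
    (hθ : θ ∉ badSet X A₄ lam ρ θ₀ θs) :
    l1 (θ - θ₀) ≤ l1 (θ₀ - θs) + rateConst A₄ * ρ / ψ ^ 2
      * ((supp θs).card * √(Real.log p) / colNorm X / φ ^ 2
        + l2 (X.mulVec (θ₀ - θs)) ^ 2 / (colNorm X * √(Real.log p))) := by
  have hlog := h.one_le_log
  have hX := h.colNorm_pos
  obtain ⟨-, hU, hl⟩ := h.errors_le_of_notMem_badSet ho hρ hθ
  obtain ⟨-, hE1, hE⟩ := h.one_le_oracleScale ho
  have hψ0 := ho.ψt_pos.trans_le ho.ψt_le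
  have hφ0 := ho.φ_pos
  have hκ : 0 ≤ dimConst A₄ := by unfold dimConst; positivity
  have htri : l1 (θ - θ₀) ≤ l1 (θ₀ - θs) + l1 (θ - θs) := by
    have e : θ - θ₀ = (θs - θ₀) + (θ - θs) := by abel
    have e2 : l1 (θs - θ₀) = l1 (θ₀ - θs) := by
      unfold l1; exact Finset.sum_congr rfl fun i _ => abs_sub_comm _ _
    rw [e, ← e2]
    exact l1_add_le _ _
  refine htri.trans (add_le_add_right ?_ _)
  set E := oracleScale X θ₀ θs with hEdef
  set L := √(Real.log p) with hL
  have hL0 : 0 < L := Real.sqrt_pos.2 (by linarith)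
  have hL2 : Real.log p = L ^ 2 := (Real.sq_sqrt (by linarith)).symm
  have e1 : (supp θs).card * L / colNorm X / φ ^ 2
      + l2 (X.mulVec (θ₀ - θs)) ^ 2 / (colNorm X * L) = E / (colNorm X * L) := by
    rw [← hE, hL2]
    clear_value L
    clear hL hL2 hE hl hU
    field_simp
  rw [e1]
  have hρE : 0 ≤ ρ * E := mul_nonneg (by linarith) (by linarith)
  have e2 : 7 * (ψ * (colNorm X * l1 (θ - θs)) * L)
      ≤ 4 * (dimConst A₄ + 2) * dimConst A₄ * (ρ * E) / ψ := by
    refine hl.trans ?_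
    calc _ ≤ 4 * (dimConst A₄ + 2) * (√(ρ * E) / ψ) * (dimConst A₄ * √(ρ * E)) := by gcongr
      _ = 4 * (dimConst A₄ + 2) * dimConst A₄ * (√(ρ * E) * √(ρ * E)) / ψ := by ring
      _ = _ := by rw [Real.mul_self_sqrt hρE]
  have e3 : rateConst A₄ * ρ / ψ ^ 2 * (E / (colNorm X * L))
      = rateConst A₄ * (ρ * E) / ψ / (ψ * colNorm X * L) := by field_simp
  rw [e3, le_div_iff₀ (by positivity)]
  have e4 : 4 * (dimConst A₄ + 2) * dimConst A₄ * (ρ * E) / ψ ≤ rateConst A₄ * (ρ * E) / ψ := by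
    gcongr
    rw [rateConst]
    linarith
  have e5 : 0 ≤ ψ * (colNorm X * l1 (θ - θs)) * L := by
    have := l1_nonneg (θ - θs)
    positivity
  linarith

theorem l2_sub_le (h : LargeSetting A₁ A₂ A₃ A₄ X w lam) {φ ψ ψt : ℝ}
    (ho : OraclePair X A₄ lam c₀ ρ θ₀ θs φ ψ ψt) (hρ : 1 ≤ ρ) {θ : Fin p → ℝ}
    (hθ : θ ∉ badSet X A₄ lam ρ θ₀ θs) :
    l2 (θ - θ₀) ≤ rateConst A₄ * √ρ / colNorm X / ψt ^ 2
      * (√((supp θs).card * Real.log p) / φ + l2 (X.mulVec (θ₀ - θs))) := by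
  have hX := h.colNorm_pos
  have hlog := h.one_le_log
  have hψt := ho.ψt_pos
  have hφ0 := ho.φ_pos
  have hκ : 0 ≤ dimConst A₄ := by unfold dimConst; positivity
  have hM : 0 ≤ rateConst A₄ := by unfold rateConst; positivity
  have h1 := (h.errors_le_of_notMem_badSet ho hρ hθ).1
  have h2 := sparseSing_mul_l2_le hX (ho.psiTilde_eq.ge) h1
  have h3 := (h.l2_mulVec_sub_lt ho hρ hθ).le
  have hV0 := l2_nonneg (X.mulVec (θ₀ - θs))
  set O := √((supp θs).card * Real.log p) / φ + l2 (X.mulVec (θ₀ - θs)) with hO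
  have hO0 : 0 ≤ O := by positivity
  have h4 : rateConst A₄ * √ρ / ψ * O ≤ rateConst A₄ * √ρ / ψt * O := by
    gcongr
    exact ho.ψt_le
  have e : rateConst A₄ * √ρ / colNorm X / ψt ^ 2 * O
      = rateConst A₄ * √ρ / ψt * O / (ψt * colNorm X) := by field_simp
  rw [e, le_div_iff₀ (by positivity)]
  linarith

end LargeSetting

end SparseVB

namespace SparseVB

open InformationTheory

/-! ### Uniform bounds and the limit -/

theorem rateConst_pos (A₄ : ℝ) : 0 < rateConst A₄ := by
  have : 0 ≤ dimConst A₄ := by unfold dimConst; positivity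
  unfold rateConst
  positivity

section Rates

variable {A₁ A₂ A₃ A₄ : ℝ} {n p : ℕ} {X : Matrix (Fin n) (Fin p) ℝ} {w : ℕ → ℝ} {lam : ℝ}
  {θ₀ θs : Fin p → ℝ} {c₀ ρ M s φ ψ ψt : ℝ}

theorem OraclePair.oracleTerm_eq (ho : OraclePair X A₄ lam c₀ ρ θ₀ θs φ ψ ψt) :
    oracleTerm X θ₀ θs = ENNReal.ofReal
      (√((supp θs).card * Real.log p) / φ + l2 (X.mulVec (θ₀ - θs))) := by
  have hφ := ho.φ_pos
  rw [oracleTerm, ho.compat_eq, ← ENNReal.ofReal_div_of_pos hφ,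
    ← ENNReal.ofReal_add (by positivity) (l2_nonneg _)]

theorem OraclePair.ratePred_eq (ho : OraclePair X A₄ lam c₀ ρ θ₀ θs φ ψ ψt) (hM : 0 < M) :
    ratePred X A₄ lam M ρ θ₀ θs = ENNReal.ofReal (M * √ρ / ψ
      * (√((supp θs).card * Real.log p) / φ + l2 (X.mulVec (θ₀ - θs)))) := by
  have hψ := ho.ψt_pos.trans_le ho.ψt_le
  rw [ratePred, ho.oracleTerm_eq, ho.psiBar_eq, ← ENNReal.ofReal_div_of_pos hψ,
    ← ENNReal.ofReal_mul (by positivity)]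

theorem OraclePair.rateL1_eq (ho : OraclePair X A₄ lam c₀ ρ θ₀ θs φ ψ ψt) (hM : 0 < M)
    (hρ : 0 ≤ ρ) :
    rateL1 X A₄ lam M ρ θ₀ θs = ENNReal.ofReal (l1 (θ₀ - θs) + M * ρ / ψ ^ 2
      * ((supp θs).card * √(Real.log p) / colNorm X / φ ^ 2
        + l2 (X.mulVec (θ₀ - θs)) ^ 2 / (colNorm X * √(Real.log p)))) := by
  have hψ := ho.ψt_pos.trans_le ho.ψt_le
  have hφ := ho.φ_pos
  have hX := colNorm_nonneg X
  have hl := l1_nonneg (θ₀ - θs)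
  rw [rateL1, ho.compat_eq, ho.psiBar_eq, ← ENNReal.ofReal_pow hφ.le, ← ENNReal.ofReal_pow hψ.le,
    ← ENNReal.ofReal_div_of_pos (by positivity), ← ENNReal.ofReal_div_of_pos (by positivity),
    ← ENNReal.ofReal_add (by positivity) (by positivity), ← ENNReal.ofReal_mul (by positivity),
    ← ENNReal.ofReal_add hl (by positivity)]

theorem OraclePair.rateL2_eq (ho : OraclePair X A₄ lam c₀ ρ θ₀ θs φ ψ ψt) (hM : 0 < M) :
    rateL2 X A₄ lam M ρ θ₀ θs = ENNReal.ofReal (M * √ρ / colNorm X / ψt ^ 2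
      * (√((supp θs).card * Real.log p) / φ + l2 (X.mulVec (θ₀ - θs)))) := by
  have hψ := ho.ψt_pos
  have hX := colNorm_nonneg X
  rw [rateL2, ho.oracleTerm_eq, ho.psiTilde_eq, ← ENNReal.ofReal_pow hψ.le,
    ← ENNReal.ofReal_div_of_pos (by positivity), ← ENNReal.ofReal_mul (by positivity)]

namespace LargeSetting

/-- If the oracle has compatibility number zero, then all three rates are infinite, and the bounds
on the errors hold trivially. -/
theorem rates_eq_top (h : LargeSetting A₁ A₂ A₃ A₄ X w lam) (hρ : 0 < ρ) (hM : 0 < M)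
    (hθs : θs ∈ oracleSet X θ₀) (h0 : compat X (supp θs) = 0) :
    ratePred X A₄ lam M ρ θ₀ θs = ∞ ∧ rateL1 X A₄ lam M ρ θ₀ θs = ∞ ∧
      rateL2 X A₄ lam M ρ θ₀ θs = ∞ := by
  have hX := h.colNorm_pos
  have hlog := h.one_le_log
  have hs1 : (1 : ℝ) ≤ (supp θs).card := by exact_mod_cast hθs.1
  have h3 : psiBar X A₄ lam ρ (supp θ₀) ≤ 1 := h.psiBar_le_one (hθs.1.trans hθs.2.1)
  have t3 : psiBar X A₄ lam ρ (supp θ₀) ≠ ∞ := ne_top_of_le_ne_top ENNReal.one_ne_top h3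
  have t4 : psiTilde X A₄ lam ρ (supp θ₀) ≠ ∞ :=
    ne_top_of_le_ne_top t3 (sparseSing_le_unifCompat hX _)
  have hO : oracleTerm X θ₀ θs = ∞ := by
    rw [oracleTerm, h0, ENNReal.div_zero (ENNReal.ofReal_pos.2 (by positivity)).ne', top_add]
  refine ⟨?_, ?_, ?_⟩
  · rw [ratePred, hO, ENNReal.mul_top]
    exact (ENNReal.div_pos (ENNReal.ofReal_pos.2 (by positivity)).ne' t3).ne'
  · rw [rateL1, h0, zero_pow two_ne_zero,
      ENNReal.div_zero (ENNReal.ofReal_pos.2 (by positivity)).ne', top_add, ENNReal.mul_top, add_top]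
    exact (ENNReal.div_pos (ENNReal.ofReal_pos.2 (by positivity)).ne' (ENNReal.pow_ne_top t3)).ne'
  · rw [rateL2, hO, ENNReal.mul_top]
    exact (ENNReal.div_pos (ENNReal.ofReal_pos.2 (by positivity)).ne' (ENNReal.pow_ne_top t4)).ne'

/-- A uniform bound on the mass of sets of parameters that are bad for every oracle with a non-zero
compatibility number and empty for the other oracles. -/
theorem worstMass_le (h : LargeSetting A₁ A₂ A₃ A₄ X w lam) (hc₀ : 0 < c₀)
    (hρ : (A₃ + 60) / c₀ ^ 2 ≤ ρ)
    {F : ∀ d : ℕ, Set (Measure (Fin d → ℝ))}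
    (hF : F ∈ ({familyPMF, familyQ, familyQMF} : Set (∀ d : ℕ, Set (Measure (Fin d → ℝ)))))
    {Q : (Fin n → ℝ) → Measure (Fin p → ℝ)}
    (hQ : ∀ y, IsVBPosterior (F p) (modelPosterior X w lam y) (Q y))
    {B : (Fin p → ℝ) → (Fin p → ℝ) → Set (Fin p → ℝ)}
    (hB : ∀ θ₀ ∈ paramSet X A₄ lam c₀ ρ s, ∀ θs ∈ oracleSet X θ₀, ∀ θ ∈ B θ₀ θs,
      compat X (supp θs) ≠ 0 ∧ θ ∈ badSet X A₄ lam ρ θ₀ θs) :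
    worstMass X A₄ lam c₀ ρ s Q B
      ≤ ENNReal.ofReal (18 / p + 3 * ((A₃ + 62) / c₀ ^ 2) / ρ) := by
  refine iSup₂_le fun θ₀ hθ₀ => iSup₂_le fun θs hθs => ?_
  by_cases h0 : compat X (supp θs) = 0
  · have hem : B θ₀ θs = ∅ :=
      Set.eq_empty_of_forall_notMem fun θ hθ => (hB θ₀ hθ₀ θs hθs θ hθ).1 h0
    rw [hem]
    simp only [measure_empty]
    refine (iInf₂_le_of_le (fun _ => 0) measurable_const (iInf_le_of_le le_rfl ?_))
    simp
  · exact (outerExp_mono _ fun y => measure_mono fun θ hθ =>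
      (hB θ₀ hθ₀ θs hθs θ hθ).2).trans
      (h.outerExp_badSet_le (h.oraclePair hc₀ hθ₀ hθs h0) hρ hF hQ)

variable {F : ∀ d : ℕ, Set (Measure (Fin d → ℝ))} {Q : (Fin n → ℝ) → Measure (Fin p → ℝ)}

theorem worstMass_rates_le (h : LargeSetting A₁ A₂ A₃ A₄ X w lam) (hc₀ : 0 < c₀) (hρ1 : 1 ≤ ρ)
    (hρ : (A₃ + 60) / c₀ ^ 2 ≤ ρ)
    (hF : F ∈ ({familyPMF, familyQ, familyQMF} : Set (∀ d : ℕ, Set (Measure (Fin d → ℝ)))))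
    (hQ : ∀ y, IsVBPosterior (F p) (modelPosterior X w lam y) (Q y)) :
    (worstMass X A₄ lam c₀ ρ s Q fun θ₀ θs =>
        {θ | ratePred X A₄ lam (rateConst A₄) ρ θ₀ θs ≤ ENNReal.ofReal (l2 (X.mulVec (θ - θ₀)))})
      ≤ ENNReal.ofReal (18 / p + 3 * ((A₃ + 62) / c₀ ^ 2) / ρ) ∧
    (worstMass X A₄ lam c₀ ρ s Q fun θ₀ θs =>
        {θ | rateL1 X A₄ lam (rateConst A₄) ρ θ₀ θs < ENNReal.ofReal (l1 (θ - θ₀))})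
      ≤ ENNReal.ofReal (18 / p + 3 * ((A₃ + 62) / c₀ ^ 2) / ρ) ∧
    (worstMass X A₄ lam c₀ ρ s Q fun θ₀ θs =>
        {θ | rateL2 X A₄ lam (rateConst A₄) ρ θ₀ θs < ENNReal.ofReal (l2 (θ - θ₀))})
      ≤ ENNReal.ofReal (18 / p + 3 * ((A₃ + 62) / c₀ ^ 2) / ρ) := by
  have hM := rateConst_pos A₄
  have hρ0 : 0 < ρ := by linarith
  refine ⟨h.worstMass_le hc₀ hρ hF hQ fun θ₀ hθ₀ θs hθs θ hθ => ?_,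
    h.worstMass_le hc₀ hρ hF hQ fun θ₀ hθ₀ θs hθs θ hθ => ?_,
    h.worstMass_le hc₀ hρ hF hQ fun θ₀ hθ₀ θs hθs θ hθ => ?_⟩
  all_goals
    rw [Set.mem_ofPred_eq] at hθ
    have hne : compat X (supp θs) ≠ 0 := fun h0 => by
      obtain ⟨r1, r2, r3⟩ := h.rates_eq_top (A₄ := A₄) hρ0 hM hθs h0
      first
      | rw [r1] at hθ; exact absurd hθ (not_le.2 ENNReal.ofReal_lt_top)
      | rw [r2] at hθ; exact absurd hθ not_top_lt
      | rw [r3] at hθ; exact absurd hθ not_top_lt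
    have ho := h.oraclePair hc₀ hθ₀ hθs hne
    refine ⟨hne, ?_⟩
    by_contra hbad
  · rw [ho.ratePred_eq hM] at hθ
    have h1 := h.l2_mulVec_sub_lt ho hρ1 hbad
    exact absurd hθ (not_le.2 ((ENNReal.ofReal_lt_ofReal_iff ((l2_nonneg _).trans_lt h1)).2 h1))
  · rw [ho.rateL1_eq hM hρ0.le] at hθ
    exact absurd hθ (not_lt.2 (ENNReal.ofReal_le_ofReal (h.l1_sub_le ho hρ1 hbad)))
  · rw [ho.rateL2_eq hM] at hθ
    exact absurd hθ (not_lt.2 (ENNReal.ofReal_le_ofReal (h.l2_sub_le ho hρ1 hbad)))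

end LargeSetting

end Rates

end SparseVB

theorem theorem3 (A₁ A₂ A₃ A₄ : ℝ) (hA₁ : 0 < A₁) (hA₂ : 0 < A₂) (hA₃ : 0 < A₃) (hA₄ : 0 < A₄) :
    ∃ M : ℝ, 0 < M ∧
      ∀ (n p : ℕ → ℕ) (X : ∀ k, Matrix (Fin (n k)) (Fin (p k)) ℝ) (w : ℕ → ℕ → ℝ)
        (lam s ρ : ℕ → ℝ) (c₀ : ℝ),
        Tendsto p atTop atTop →
        (∀ k, IsDimensionPrior A₁ A₂ A₃ A₄ (p k) (w k)) →
        (∀ k, 0 < lam k ∧ colNorm (X k) / (p k : ℝ) ≤ lam k ∧ lam k ≤ 2 * lamBar (X k)) →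
        (∀ k, 1 ≤ s k) →
        lam =O[atTop] (fun k => colNorm (X k) * √(Real.log (p k)) / s k) →
        Tendsto ρ atTop atTop →
        0 < c₀ →
        ∀ F ∈ ({familyPMF, familyQ, familyQMF} : Set (∀ d : ℕ, Set (Measure (Fin d → ℝ)))),
        ∀ Q : ∀ k, (Fin (n k) → ℝ) → Measure (Fin (p k) → ℝ),
        (∀ k y, IsVBPosterior (F (p k)) (modelPosterior (X k) (w k) (lam k) y) (Q k y)) →
        Tendsto (fun k => worstMass (X k) A₄ (lam k) c₀ (ρ k) (s k) (Q k) fun θ₀ θs =>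
            {θ | ratePred (X k) A₄ (lam k) M (ρ k) θ₀ θs
              ≤ ENNReal.ofReal (l2 ((X k).mulVec (θ - θ₀)))}) atTop (𝓝 0) ∧
        Tendsto (fun k => worstMass (X k) A₄ (lam k) c₀ (ρ k) (s k) (Q k) fun θ₀ θs =>
            {θ | rateL1 (X k) A₄ (lam k) M (ρ k) θ₀ θs
              < ENNReal.ofReal (l1 (θ - θ₀))}) atTop (𝓝 0) ∧
        Tendsto (fun k => worstMass (X k) A₄ (lam k) c₀ (ρ k) (s k) (Q k) fun θ₀ θs =>
            {θ | rateL2 (X k) A₄ (lam k) M (ρ k) θ₀ θs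
              < ENNReal.ofReal (l2 (θ - θ₀))}) atTop (𝓝 0) := by
  refine ⟨rateConst A₄, rateConst_pos A₄, ?_⟩
  intro n p X w lam s ρ c₀ hp hprior hlam _ _ hρ hc₀ F hF Q hQ
  have hpR : Tendsto (fun k => (p k : ℝ)) atTop atTop := tendsto_natCast_atTop_atTop.comp hp
  have hev : ∀ᶠ k in atTop, LargeSetting A₁ A₂ A₃ A₄ (X k) (w k) (lam k) ∧ 1 ≤ ρ k ∧
      (A₃ + 60) / c₀ ^ 2 ≤ ρ k := by
    have hpow : Tendsto (fun k => (p k : ℝ) ^ (A₄ / 2)) atTop atTop :=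
      (tendsto_rpow_atTop (half_pos hA₄)).comp hpR
    filter_upwards [hp.eventually_ge_atTop 3, hpow.eventually_ge_atTop (8 * A₂),
      hpR.eventually_ge_atTop (1 / A₁), hρ.eventually_ge_atTop 1,
      hρ.eventually_ge_atTop ((A₃ + 60) / c₀ ^ 2)] with k h1 h2 h3 h4 h5
    obtain ⟨l1, l2, l3⟩ := hlam k
    exact ⟨⟨hA₁, hA₂, hA₃, hA₄, hprior k, l1, l2, l3, h1, h2, h3⟩, h4, h5⟩
  have hlim : Tendsto (fun k => ENNReal.ofReal (18 / p k + 3 * ((A₃ + 62) / c₀ ^ 2) / ρ k)) atTop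
      (𝓝 0) := by
    have := ENNReal.tendsto_ofReal ((hpR.const_div_atTop 18).add
      (hρ.const_div_atTop (3 * ((A₃ + 62) / c₀ ^ 2))))
    simpa using this
  refine ⟨?_, ?_, ?_⟩ <;>
    refine tendsto_of_tendsto_of_tendsto_of_le_of_le' tendsto_const_nhds hlim
      (Eventually.of_forall fun _ => zero_le) ?_ <;>
    filter_upwards [hev] with k hk
  · exact (hk.1.worstMass_rates_le hc₀ hk.2.1 hk.2.2 hF (hQ k)).1
  · exact (hk.1.worstMass_rates_le hc₀ hk.2.1 hk.2.2 hF (hQ k)).2.1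
  · exact (hk.1.worstMass_rates_le hc₀ hk.2.1 hk.2.2 hF (hQ k)).2.2
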